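/- Let $k$ be a field, let $X$ be a variety over $k$ (an integral separated scheme of finite type over $k$) with an action of the split torus $T=\mathbb{G}_m^r$, and let $\operatorname{CDiv}(X)^{inv}$ be the group of $T$-invariant Cartier divisors on $X$, i.e. of those whose pull-backs to $T\times X$ along the action and along the projection coincide. Assume that $\operatorname{CDiv}(X)^{inv}$ is finitely generated. Let $m>0$ be an integer such that the image $\Lambda$ of $$\operatorname{CDiv}(X)^{inv}\to\operatorname{Pic}(X),\qquad D\mapsto[\mathcal{O}(mD)],$$ is a free abelian group, and let $G=\operatorname{Hom}(\Lambda,\mathbb{G}_m)=\operatorname{Spec}k[\Lambda]$. Choose a homomorphism $\lambda\mapsto D_\lambda$ from $\Lambda$ to $\operatorname{CDiv}(X)^{inv}$ with $[\mathcal{O}(D_\lambda)]=\lambda$ for all $\lambda$, and put $$R=\bigoplus_{\lambda\in\Lambda}\Gamma(X,\mathcal{O}(D_\lambda)),\qquad Y=\operatorname{Spec}R .$$ For a section $s\in\Gamma(X,\mathcal{O}(D_\lambda))$ let $X_s\subset X$ and $Y_s\subset Y$ be the open sets where $s$ does not vanish, and let the stable locus $Y^{sta}\subset Y$ be the union of the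 sets $Y_s$ over all $\lambda$ and all $s\in\Gamma(X,\mathcal{O}(D_\lambda))$ such that $X_s$ is affine. For every such choice the following are equivalent: (i) $X$ has an invariant ample family: there are finitely many invariant Cartier divisors $D_1,\dots,D_q$ such that $X$ is covered by the affine ones among the open sets $X_s$, $s\in\Gamma(X,\mathcal{O}(nD_i))$, $1\le i\le q$, $n\ge1$. (ii) There are a quasi-affine variety $Z$ over $k$ with a $T$-action, a split torus $H$ acting freely on $Z$, and a $T$-equivariant morphism $Z\to X$ that is a geometric quotient of $Z$ by $H$. (iii) $Y^{sta}$ is a variety; the $\Lambda$-grading of $R$ induces an action of $G$ on $Y^{sta}$, which is free; the natural morphism $\pi:Y^{sta}\to X$, i.e. the one that restricts to $Y_s=\pi^{-1}(X_s)\to X_s$, $\pi^*(t/s)=t/s$, for all $s,t\in\Gamma(X,\mathcal{O}(D_\lambda))$ with $X_s$ affine, is a geometric quotient of $Y^{sta}$ by $G$; and $Y^{sta}$ has a $T$-action for which $\pi$ is $T$-equivariant. Here an action of a group scheme is free if it is free on $S$-valued points for every $k$-scheme $S$. A geometric quotient is a surjective, submersive, invariant morphism whose geometric fibres are the orbits and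 for which the functions on an open set of the target are the invariant functions on its preimage. -/

import Mathlib

open CategoryTheory MonoidalCategory CartesianMonoidalCategory AlgebraicGeometry Opposite

universe u

noncomputable section

namespace ToricQuot

/-! ### Varieties, diagonalizable groups, actions and quotients -/

section Actions

variable {k : Type u} [Field k]

/-- A variety over `k`: an integral separated scheme of finite type over `k`. -/
class IsVariety (X : Over (Spec (.of k))) : Prop where
  isIntegral : IsIntegral X.left
  isSeparated : IsSeparated X.hom
  locallyOfFiniteType : LocallyOfFiniteType X.hom
  quasiCompact : QuasiCompact X.hom

attribute [instance] IsVariety.isIntegral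

variable (k) in
/-- The diagonalizable group scheme `Hom(M, 𝔾_m) = Spec k[M]` over `k` with character group the
(multiplicatively written) abelian group `M`. -/
abbrev diag (M : Type u) [CommGroup M] : Over (Spec (.of k)) :=
  (Spec (.of (MonoidAlgebra k M))).asOver (Spec (.of k))

variable (k) in
/-- The split torus `𝔾_m^r = Hom(ℤ^r, 𝔾_m)`. -/
abbrev torus (r : ℕ) : Over (Spec (.of k)) :=
  diag k (ULift.{u} (Multiplicative (Fin r → ℤ)))

variable (k) in
/-- The character of `Hom(M, 𝔾_m)` given by `m : M`, as a regular function. -/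
def character {M : Type u} [CommGroup M] (m : M) : Γ((diag k M).left, ⊤) :=
  (Scheme.ΓSpecIso (.of (MonoidAlgebra k M))).inv (MonoidAlgebra.of k M m)

/-- The morphism `G × Z ⟶ Z` of an action of `G` on `Z`. -/
def act (G Z : Over (Spec (.of k))) [GrpObj G] [ModObj G Z] : G ⊗ Z ⟶ Z :=
  ModObj.smul (M := G) (X := Z)

/-- `π` is equivariant for the actions of `G` on `Z` and `X`. -/
def IsEquivariant (G : Over (Spec (.of k))) [GrpObj G] {Z X : Over (Spec (.of k))}
    [ModObj G Z] [ModObj G X] (π : Z ⟶ X) : Prop :=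
  act G Z ≫ π = (G ◁ π) ≫ act G X

/-- The action of `G` on `Z` is free: `G(S)` acts freely on `Z(S)` for every `k`-scheme `S`. -/
def IsFreeAction (G Z : Over (Spec (.of k))) [GrpObj G] [ModObj G Z] : Prop :=
  ∀ (S : Over (Spec (.of k))) (g h : S ⟶ G) (z : S ⟶ Z),
    lift g z ≫ act G Z = lift h z ≫ act G Z → g = h

/-- `π : Z ⟶ X` is a geometric quotient of `Z` by the action of `G`. -/
structure IsGeometricQuotient (G : Over (Spec (.of k))) [GrpObj G] {Z X : Over (Spec (.of k))}
    [ModObj G Z] (π : Z ⟶ X) : Prop where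
  invariant : (act G Z).left ≫ π.left = (snd G Z).left ≫ π.left
  surjective : Surjective π.left
  /-- The geometric fibres of `π` are the orbits: `G × Z ⟶ Z ×_X Z`, `(g, z) ↦ (g z, z)`, is
  surjective. -/
  orbits : Surjective (Limits.pullback.lift (f := π.left) (g := π.left)
    (act G Z).left (snd G Z).left invariant)
  /-- `π` is submersive. -/
  isQuotientMap : Topology.IsQuotientMap π.left
  /-- `𝒪_X` is the sheaf of invariant functions on `Z`. -/
  injective : ∀ U : X.left.Opens, Function.Injective (π.left.app U)
  functions : ∀ (U : X.left.Opens) (f : Γ(Z.left, π.left ⁻¹ᵁ U)),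
    (∃ a : Γ(X.left, U), π.left.app U a = f) ↔
      (act G Z).left.appLE (π.left ⁻¹ᵁ U) (((snd G Z).left ≫ π.left) ⁻¹ᵁ U)
          (by rw [← invariant]; exact le_rfl) f =
        (snd G Z).left.appLE (π.left ⁻¹ᵁ U) (((snd G Z).left ≫ π.left) ⁻¹ᵁ U) le_rfl f

end Actions

/-! ### Cartier divisors on an integral scheme -/

section Cartier

variable (X : Scheme.{u}) [IsIntegral X]

/-- The image of `𝒪_{X,x}^*` in `K(X)^*`. -/
def unitsAt (x : X) : Subgroup X.functionFieldˣ :=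
  (Units.map (algebraMap (X.presheaf.stalk x) X.functionField).toMonoidHom).range

instance (x : X) : CommGroup (X.functionFieldˣ ⧸ unitsAt X x) :=
  QuotientGroup.Quotient.commGroup _

instance : CommGroup (∀ x : X, X.functionFieldˣ ⧸ unitsAt X x) := Pi.commGroup

/-- The group of Cartier divisors, i.e. of global sections of the sheaf `K(X)^* / 𝒪_X^*`, written
multiplicatively: families of germs in `K(X)^* / 𝒪_{X,x}^*` that are locally given by one rational
function, the local equation. -/
def cartierDivisors : Subgroup (∀ x : X, X.functionFieldˣ ⧸ unitsAt X x) where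
  carrier := {D | ∀ x, ∃ U : X.Opens, x ∈ U ∧ ∃ f : X.functionFieldˣ,
    ∀ y ∈ U, D y = (f : X.functionFieldˣ ⧸ unitsAt X y)}
  mul_mem' {D E} hD hE x := by
    obtain ⟨U, hU, f, hf⟩ := hD x
    obtain ⟨V, hV, g, hg⟩ := hE x
    refine ⟨U ⊓ V, ⟨hU, hV⟩, f * g, fun y hy => ?_⟩
    simp [hf y hy.1, hg y hy.2]
  one_mem' x := ⟨⊤, trivial, 1, fun y _ => by simp⟩
  inv_mem' {D} hD x := by
    obtain ⟨U, hU, f, hf⟩ := hD x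
    exact ⟨U, hU, f⁻¹, fun y hy => by simp [hf y hy]⟩

/-- The type of Cartier divisors. -/
def CartierDivisor : Type u := cartierDivisors X

instance : CommGroup (CartierDivisor X) := inferInstanceAs (CommGroup (cartierDivisors X))

variable {X}

/-- The germ of a Cartier divisor at a point. -/
def CartierDivisor.germ (D : CartierDivisor X) (x : X) : X.functionFieldˣ ⧸ unitsAt X x :=
  (show cartierDivisors X from D).1 x

lemma CartierDivisor.germ_mul (D E : CartierDivisor X) (x : X) :
    (D * E).germ x = D.germ x * E.germ x := rfl

lemma CartierDivisor.germ_one (x : X) : (1 : CartierDivisor X).germ x = 1 := rfl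

lemma CartierDivisor.germ_inv (D : CartierDivisor X) (x : X) :
    (D⁻¹).germ x = (D.germ x)⁻¹ := rfl

lemma CartierDivisor.ext {D E : CartierDivisor X} (h : ∀ x, D.germ x = E.germ x) : D = E :=
  Subtype.ext (funext h)

lemma CartierDivisor.exists_local (D : CartierDivisor X) (x : X) :
    ∃ U : X.Opens, x ∈ U ∧ ∃ f : X.functionFieldˣ,
      ∀ y ∈ U, D.germ y = (f : X.functionFieldˣ ⧸ unitsAt X y) :=
  (show cartierDivisors X from D).2 x

/-- `s` belongs to the stalk of `𝒪(D)` at `x`: `s` times a local equation of `D` is regular. -/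
def IsSectionAt (D : CartierDivisor X) (x : X) (s : X.functionField) : Prop :=
  ∀ d : X.functionFieldˣ, (d : X.functionFieldˣ ⧸ unitsAt X x) = D.germ x →
    ∃ a : X.presheaf.stalk x, algebraMap _ X.functionField a = s * d

/-- `s`, as a section of `𝒪(D)`, does not vanish at `x`: `s` times a local equation of `D` is a unit
at `x`. -/
def IsGeneratorAt (D : CartierDivisor X) (x : X) (s : X.functionField) : Prop :=
  ∀ d : X.functionFieldˣ, (d : X.functionFieldˣ ⧸ unitsAt X x) = D.germ x →
    ∃ a : X.presheaf.stalk x, IsUnit a ∧ algebraMap _ X.functionField a = s * d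

lemma coe_eq_iff {x : X} {d e : X.functionFieldˣ} :
    (d : X.functionFieldˣ ⧸ unitsAt X x) = e ↔
      ∃ u : (X.presheaf.stalk x)ˣ,
        (e : X.functionField) = d * algebraMap _ X.functionField (u : X.presheaf.stalk x) := by
  rw [QuotientGroup.eq, unitsAt, MonoidHom.mem_range]
  constructor
  · rintro ⟨u, hu⟩
    refine ⟨u, ?_⟩
    have h2 : e = d * Units.map (algebraMap (X.presheaf.stalk x) X.functionField).toMonoidHom u := by
      rw [hu]; simp
    rw [h2]; simp
  · rintro ⟨u, hu⟩
    refine ⟨u, ?_⟩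
    rw [eq_inv_mul_iff_mul_eq]
    ext
    simp [hu]

lemma isSectionAt_iff {D : CartierDivisor X} {x : X} {s : X.functionField}
    {d : X.functionFieldˣ} (hd : D.germ x = (d : X.functionFieldˣ ⧸ unitsAt X x)) :
    IsSectionAt D x s ↔ ∃ a : X.presheaf.stalk x, algebraMap _ X.functionField a = s * d := by
  refine ⟨fun h => h d hd.symm, fun ⟨a, ha⟩ e he => ?_⟩
  obtain ⟨u, hu⟩ := coe_eq_iff.1 (hd.symm.trans he.symm)
  exact ⟨a * u, by rw [map_mul, ha, hu, mul_assoc]⟩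

lemma isGeneratorAt_iff {D : CartierDivisor X} {x : X} {s : X.functionField}
    {d : X.functionFieldˣ} (hd : D.germ x = (d : X.functionFieldˣ ⧸ unitsAt X x)) :
    IsGeneratorAt D x s ↔
      ∃ a : X.presheaf.stalk x, IsUnit a ∧ algebraMap _ X.functionField a = s * d := by
  refine ⟨fun h => h d hd.symm, fun ⟨a, ha', ha⟩ e he => ?_⟩
  obtain ⟨u, hu⟩ := coe_eq_iff.1 (hd.symm.trans he.symm)
  exact ⟨a * u, ha'.mul u.isUnit, by rw [map_mul, ha, hu, mul_assoc]⟩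

lemma exists_rep (D : CartierDivisor X) (x : X) :
    ∃ d : X.functionFieldˣ, D.germ x = (d : X.functionFieldˣ ⧸ unitsAt X x) :=
  ⟨_, (QuotientGroup.out_eq' (D.germ x)).symm⟩

lemma IsSectionAt.mul {D E : CartierDivisor X} {x : X} {s t : X.functionField}
    (hs : IsSectionAt D x s) (ht : IsSectionAt E x t) : IsSectionAt (D * E) x (s * t) := by
  obtain ⟨d, hd⟩ := exists_rep D x
  obtain ⟨e, he⟩ := exists_rep E x
  obtain ⟨a, ha⟩ := (isSectionAt_iff hd).1 hs
  obtain ⟨b, hb⟩ := (isSectionAt_iff he).1 ht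
  have : (D * E).germ x = ((d * e : X.functionFieldˣ) : X.functionFieldˣ ⧸ unitsAt X x) := by
    rw [CartierDivisor.germ_mul, hd, he]; rfl
  refine (isSectionAt_iff this).2 ⟨a * b, ?_⟩
  rw [map_mul, ha, hb, Units.val_mul]; ring

/-- The module `Γ(U, 𝒪(D))` of sections of `𝒪(D)` over a nonempty open `U`. -/
def sectionsOver (D : CartierDivisor X) (U : X.Opens) [Nonempty U] :
    Submodule Γ(X, U) X.functionField where
  carrier := {s | ∀ x ∈ U, IsSectionAt D x s}
  add_mem' {s t} hs ht x hx d hd := by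
    obtain ⟨a, ha⟩ := hs x hx d hd
    obtain ⟨b, hb⟩ := ht x hx d hd
    exact ⟨a + b, by rw [map_add, ha, hb, add_mul]⟩
  zero_mem' x _ d _ := ⟨0, by simp⟩
  smul_mem' r s hs x hx d hd := by
    obtain ⟨a, ha⟩ := hs x hx d hd
    refine ⟨X.presheaf.germ U x hx r * a, ?_⟩
    rw [map_mul, ha, Scheme.algebraMap_germ_eq_germToFunctionField, Algebra.smul_def,
      RingHom.algebraMap_toAlgebra, mul_assoc]

/-- The group `Γ(X, 𝒪(D))` of global sections of `𝒪(D)`. -/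
def globalSections (D : CartierDivisor X) : AddSubgroup X.functionField where
  carrier := {s | ∀ x, IsSectionAt D x s}
  add_mem' {s t} hs ht x d hd := by
    obtain ⟨a, ha⟩ := hs x d hd
    obtain ⟨b, hb⟩ := ht x d hd
    exact ⟨a + b, by rw [map_add, ha, hb, add_mul]⟩
  zero_mem' x d _ := ⟨0, by simp⟩
  neg_mem' {s} hs x d hd := by
    obtain ⟨a, ha⟩ := hs x d hd
    exact ⟨-a, by rw [map_neg, ha, neg_mul]⟩

/-- `𝒪(D)` and `𝒪(E)` are isomorphic as sheaves of `𝒪_X`-modules. -/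
def IsoSheaves (D E : CartierDivisor X) : Prop :=
  ∃ φ : ∀ (U : X.Opens) [Nonempty U], sectionsOver D U ≃ₗ[Γ(X, U)] sectionsOver E U,
    ∀ (U V : X.Opens) [Nonempty U] [Nonempty V], V ≤ U →
      ∀ (s : sectionsOver D U) (t : sectionsOver D V), (s : X.functionField) = t →
        (φ U s : X.functionField) = φ V t

/-- The principal divisor of a rational function. -/
def principal : X.functionFieldˣ →* CartierDivisor X where
  toFun f := ⟨fun _ => f, fun _ => ⟨⊤, trivial, f, fun _ _ => rfl⟩⟩
  map_one' := rfl
  map_mul' _ _ := rfl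

/-- `𝒪(D)` is isomorphic to `𝒪_X` if and only if `D` is principal. -/
theorem isoSheaves_one_iff (D : CartierDivisor X) :
    IsoSheaves D 1 ↔ ∃ f, D = principal f := by
  constructor
  · rintro ⟨φ, hφ⟩
    have : Nonempty (⊤ : X.Opens) := ⟨⟨genericPoint X, trivial⟩⟩
    have h1 : (1 : X.functionField) ∈ sectionsOver (1 : CartierDivisor X) ⊤ := fun x _ =>
      (isSectionAt_iff (d := 1) rfl).2 ⟨1, by simp⟩
    obtain ⟨t, ht⟩ := (φ ⊤).surjective ⟨1, h1⟩
    have key : ∀ x, ∃ d : X.functionFieldˣ,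
        D.germ x = (d : X.functionFieldˣ ⧸ unitsAt X x) ∧
        ∃ a : X.presheaf.stalk x, IsUnit a ∧ algebraMap _ X.functionField a = t.1 * d := by
      intro x
      obtain ⟨U, hxU, d, hd⟩ := D.exists_local x
      refine ⟨d, hd x hxU, ?_⟩
      obtain ⟨a, ha⟩ := (isSectionAt_iff (hd x hxU)).1 (t.2 x trivial)
      obtain ⟨W, hxW, b, hb⟩ := X.presheaf.exists_germ_eq a
      let V : X.Opens := U ⊓ W
      have hxV : x ∈ V := ⟨hxU, hxW⟩
      have : Nonempty V := ⟨⟨x, hxV⟩⟩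
      let b' : Γ(X, V) := X.presheaf.map (homOfLE inf_le_right).op b
      have hb' : X.germToFunctionField V b' = t.1 * d := by
        rw [← Scheme.algebraMap_germ_eq_germToFunctionField X hxV, ← ha, ← hb]
        congr 1
        exact X.presheaf.germ_res_apply (homOfLE inf_le_right) x hxV b
      have hd' : ((d⁻¹ : X.functionFieldˣ) : X.functionField) ∈ sectionsOver D V :=
        fun y hy => (isSectionAt_iff (hd y hy.1)).2 ⟨1, by simp⟩
      let e : sectionsOver D V := ⟨_, hd'⟩
      have hte : (t : X.functionField) = (b' • e : sectionsOver D V) := by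
        change _ = b' • ((d⁻¹ : X.functionFieldˣ) : X.functionField)
        rw [Algebra.smul_def, RingHom.algebraMap_toAlgebra]
        change _ = X.germToFunctionField V b' * _
        rw [hb', mul_assoc, Units.mul_inv, mul_one]
      have h2 := hφ ⊤ V le_top t (b' • e) hte
      rw [ht, map_smul] at h2
      obtain ⟨c, hc⟩ := (isSectionAt_iff (d := 1) rfl).1 ((φ V e).2 x hxV)
      refine ⟨a, ?_, ha⟩
      refine IsUnit.of_mul_eq_one c ?_
      apply IsFractionRing.injective (X.presheaf.stalk x) X.functionField
      have h3 : (1 : X.functionField) = X.germToFunctionField V b' * (φ V e).1 := by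
        have h4 : (1 : X.functionField) = b' • (φ V e).1 := h2
        rw [Algebra.smul_def, RingHom.algebraMap_toAlgebra] at h4
        exact h4
      rw [map_mul, map_one, ha, hc, h3, hb', Units.val_one, mul_one]
    have ht0 : t.1 ≠ 0 := by
      intro h0
      have h5 : t = 0 := Subtype.ext h0
      rw [h5, map_zero] at ht
      exact zero_ne_one (congrArg Subtype.val ht)
    refine ⟨(Units.mk0 t.1 ht0)⁻¹, CartierDivisor.ext fun x => ?_⟩
    obtain ⟨d, hd, a, ha, hat⟩ := key x
    rw [hd]
    refine (coe_eq_iff.2 ⟨ha.unit, ?_⟩).symm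
    rw [IsUnit.unit_spec, hat, Units.val_inv_eq_inv_val, Units.val_mk0,
      inv_mul_cancel_left₀ ht0]
  · rintro ⟨f, rfl⟩
    have hl : ∀ (x : X) (s : X.functionField),
        IsSectionAt (principal f) x s ↔ IsSectionAt 1 x (s * f) := fun x s => by
      rw [isSectionAt_iff (D := principal f) (d := f) rfl, isSectionAt_iff (d := 1) rfl,
        Units.val_one, mul_one]
    refine ⟨fun U _ =>
      { toFun := fun s => ⟨s.1 * f, fun x hx => (hl x s.1).1 (s.2 x hx)⟩
        invFun := fun s => ⟨s.1 * (f⁻¹ : X.functionFieldˣ), fun x hx =>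
          (hl x _).2 (by rw [mul_assoc, Units.inv_mul, mul_one]; exact s.2 x hx)⟩
        map_add' := fun s t => Subtype.ext (add_mul _ _ _)
        map_smul' := fun r s => Subtype.ext (smul_mul_assoc r s.1 _)
        left_inv := fun s => Subtype.ext (by simp)
        right_inv := fun s => Subtype.ext (by simp) }, ?_⟩
    intro U V _ _ _ s t hst
    change s.1 * _ = t.1 * _
    rw [hst]

variable (X) in
/-- The group of the Cartier divisors `D` with `𝒪(D) ≃ 𝒪_X`. -/
def trivialDivisors : Subgroup (CartierDivisor X) where
  carrier := {D | IsoSheaves D 1}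
  mul_mem' {D E} hD hE := by
    obtain ⟨f, rfl⟩ := (isoSheaves_one_iff D).1 hD
    obtain ⟨g, rfl⟩ := (isoSheaves_one_iff E).1 hE
    exact (isoSheaves_one_iff _).2 ⟨f * g, (map_mul _ _ _).symm⟩
  one_mem' := (isoSheaves_one_iff _).2 ⟨1, (map_one _).symm⟩
  inv_mem' {D} hD := by
    obtain ⟨f, rfl⟩ := (isoSheaves_one_iff D).1 hD
    exact (isoSheaves_one_iff _).2 ⟨f⁻¹, (map_inv _ _).symm⟩

variable (X) in
/-- The group of the isomorphism classes `[𝒪(D)]`, as the quotient of the group of Cartier divisors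
by the kernel of `D ↦ [𝒪(D)]`. As `X` is integral, this is the Picard group of `X`. -/
def Pic : Type u := CartierDivisor X ⧸ trivialDivisors X

instance : CommGroup (Pic X) := QuotientGroup.Quotient.commGroup _

/-- The homomorphism `D ↦ [𝒪(D)]`. -/
def picClass : CartierDivisor X →* Pic X := QuotientGroup.mk' (trivialDivisors X)

/-- The open set `X_s` where a section `s` of `𝒪(D)` does not vanish. -/
def nonvanishing (D : CartierDivisor X) (s : X.functionField) : X.Opens where
  carrier := {x | IsGeneratorAt D x s}
  is_open' := by
    rw [isOpen_iff_forall_mem_open]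
    intro x hx
    obtain ⟨U, hxU, d, hd⟩ := D.exists_local x
    obtain ⟨a, hau, ha⟩ := (isGeneratorAt_iff (hd x hxU)).1 hx
    obtain ⟨W, hxW, b, hb⟩ := X.presheaf.exists_germ_eq a
    refine ⟨U ⊓ X.basicOpen b, fun y hy => ?_, (U ⊓ X.basicOpen b).isOpen, hxU, ?_⟩
    · have hyW : y ∈ W := X.basicOpen_le b hy.2
      have : Nonempty W := ⟨⟨y, hyW⟩⟩
      refine (isGeneratorAt_iff (hd y hy.1)).2
        ⟨X.presheaf.germ W y hyW b, (X.mem_basicOpen b y hyW).1 hy.2, ?_⟩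
      rw [← ha, ← hb, Scheme.algebraMap_germ_eq_germToFunctionField,
        Scheme.algebraMap_germ_eq_germToFunctionField]
    · refine (X.mem_basicOpen b x hxW).2 ?_
      rwa [hb]

end Cartier

/-! ### Invariant divisors and the graded section ring -/

section Invariant

variable {k : Type u} [Field k] (G : Over (Spec (.of k))) [GrpObj G]
  (X : Over (Spec (.of k))) [IsIntegral X.left] [ModObj G X]

/-- The group of the Cartier divisors `D` on `X` that are invariant under the action of `G`: the
pull-backs of `D` to `G × X` along the action and along the projection are the same divisor. At a
point `p`, let `g / h` be a local equation of `D` at the image of `p` under the action and let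
`g' / h'` be one at its projection; the pull-backs of the two must differ by a unit at `p`. -/
def invariantDivisors : Subgroup (CartierDivisor X.left) where
  carrier := {D | ∀ p : (G ⊗ X).left,
    ∃ (g h : X.left.presheaf.stalk ((act G X).left p))
      (g' h' : X.left.presheaf.stalk ((snd G X).left p)) (d d' : X.left.functionFieldˣ),
      h ≠ 0 ∧ h' ≠ 0 ∧
      D.germ ((act G X).left p) = (d : X.left.functionFieldˣ ⧸ unitsAt X.left _) ∧
      D.germ ((snd G X).left p) = (d' : X.left.functionFieldˣ ⧸ unitsAt X.left _) ∧
      d * algebraMap _ X.left.functionField h = algebraMap _ X.left.functionField g ∧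
      d' * algebraMap _ X.left.functionField h' = algebraMap _ X.left.functionField g' ∧
      Associated ((act G X).left.stalkMap p g * (snd G X).left.stalkMap p h')
        ((act G X).left.stalkMap p h * (snd G X).left.stalkMap p g')}
  mul_mem' {D E} hD hE p := by
    obtain ⟨g, h, g', h', d, d', n, n', e, e', q, q', A⟩ := hD p
    obtain ⟨g₂, h₂, g₂', h₂', d₂, d₂', n₂, n₂', e₂, e₂', q₂, q₂', A₂⟩ := hE p
    refine ⟨g * g₂, h * h₂, g' * g₂', h' * h₂', d * d₂, d' * d₂', mul_ne_zero n n₂,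
      mul_ne_zero n' n₂', ?_, ?_, ?_, ?_, ?_⟩
    · rw [CartierDivisor.germ_mul, e, e₂]; rfl
    · rw [CartierDivisor.germ_mul, e', e₂']; rfl
    · rw [map_mul, map_mul, ← q, ← q₂, Units.val_mul]; ring
    · rw [map_mul, map_mul, ← q', ← q₂', Units.val_mul]; ring
    · simp only [map_mul]
      convert! A.mul_mul A₂ using 1 <;> ring
  one_mem' p := by
    refine ⟨1, 1, 1, 1, 1, 1, one_ne_zero, one_ne_zero, rfl, rfl, ?_, ?_, ?_⟩
    · simp
    · simp
    · simp only [map_one]; exact Associated.refl _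
  inv_mem' {D} hD p := by
    obtain ⟨g, h, g', h', d, d', n, n', e, e', q, q', A⟩ := hD p
    have aux : ∀ (x : X.left) (g h : X.left.presheaf.stalk x) (d : X.left.functionFieldˣ),
        h ≠ 0 → d * algebraMap _ X.left.functionField h = algebraMap _ X.left.functionField g →
        g ≠ 0 ∧ ((d⁻¹ : X.left.functionFieldˣ) : X.left.functionField) *
          algebraMap _ X.left.functionField g = algebraMap _ X.left.functionField h := by
      intro x g h d hh hq
      refine ⟨?_, by rw [← hq, ← mul_assoc, Units.inv_mul, one_mul]⟩
      rintro rfl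
      rw [map_zero, mul_eq_zero] at hq
      rcases hq with hq | hq
      · exact d.ne_zero hq
      · exact hh ((map_eq_zero_iff _ (IsFractionRing.injective _ _)).1 hq)
    obtain ⟨a, b⟩ := aux _ g h d n q
    obtain ⟨a', b'⟩ := aux _ g' h' d' n' q'
    refine ⟨h, g, h', g', d⁻¹, d'⁻¹, a, a', ?_, ?_, b, b', A.symm⟩
    · rw [CartierDivisor.germ_inv, e]; rfl
    · rw [CartierDivisor.germ_inv, e']; rfl

/-- `X` admits an invariant ample family: there are finitely many invariant Cartier divisors `D_i`
such that the affine ones among the sets `X_s`, for sections `s` of `𝒪(n D_i)` with `n ≥ 1`,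
cover `X`. The `D_i` stand for the invertible sheaves `𝒪(D_i)`. -/
def HasInvariantAmpleFamily : Prop :=
  ∃ (q : ℕ) (D : Fin q → invariantDivisors G X), ∀ x : X.left,
    ∃ (i : Fin q) (n : ℕ) (s : X.left.functionField), 1 ≤ n ∧
      s ∈ globalSections ((D i : CartierDivisor X.left) ^ n) ∧
      IsAffineOpen (nonvanishing ((D i : CartierDivisor X.left) ^ n) s) ∧
      x ∈ nonvanishing ((D i : CartierDivisor X.left) ^ n) s

/-- The image of the group of invariant Cartier divisors in `Pic(X)` under `D ↦ [𝒪(m D)]`. -/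
def classGroup (m : ℕ) : Subgroup (Pic X.left) :=
  ((picClass.comp (powMonoidHom m)).comp (invariantDivisors G X).subtype).range

/-- `K(X)` is a `k`-algebra. -/
instance functionFieldAlgebra : Algebra k X.left.functionField :=
  haveI : Nonempty (⊤ : X.left.Opens) := ⟨⟨genericPoint X.left, trivial⟩⟩
  ((X.left.germToFunctionField ⊤).hom.comp
    (X.hom.appTop.hom.comp (Scheme.ΓSpecIso (.of k)).inv.hom)).toAlgebra

variable {X}

variable {Λ : Type u} [CommGroup Λ]

/-- The `Λ`-graded `k`-algebra `⨁_{a ∈ Λ} Γ(X, 𝒪(δ a))` attached to a homomorphism `δ` from `Λ` to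
the group of Cartier divisors, as a subalgebra of the group algebra `K(X)[Λ]`. -/
def sectionRing (δ : Λ →* CartierDivisor X.left) :
    Subalgebra k (MonoidAlgebra X.left.functionField Λ) where
  carrier := {F | ∀ a, F.coeff a ∈ globalSections (δ a)}
  mul_mem' {F H} hF hH := by
    intro a
    classical
    rw [MonoidAlgebra.coeff_mul]
    refine sum_mem fun b hb => sum_mem fun c hc => ?_
    beta_reduce
    split_ifs with h
    · intro x
      rw [← h, map_mul]
      exact (hF b x).mul (hH c x)
    · exact zero_mem _
  add_mem' {F H} hF hH a := by
    rw [MonoidAlgebra.coeff_add]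
    exact add_mem (hF a) (hH a)
  algebraMap_mem' r := by
    intro a
    rw [MonoidAlgebra.coe_algebraMap]
    classical
    simp only [Function.comp_apply, MonoidAlgebra.coeff_single, Finsupp.single_apply]
    split_ifs with h
    · intro x
      subst h
      rw [map_one, isSectionAt_iff (d := 1) rfl]
      have : Nonempty (⊤ : X.left.Opens) := ⟨⟨genericPoint X.left, trivial⟩⟩
      have hx : x ∈ (⊤ : X.left.Opens) := trivial
      refine ⟨X.left.presheaf.germ ⊤ x hx
        (X.hom.appTop.hom ((Scheme.ΓSpecIso (.of k)).inv.hom r)), ?_⟩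
      rw [Units.val_one, mul_one]
      exact Scheme.algebraMap_germ_eq_germToFunctionField X.left hx _
    · exact zero_mem _

/-- A section of `𝒪(δ a)` as a homogeneous element of degree `a` of the section ring. -/
def homogeneous (δ : Λ →* CartierDivisor X.left) (a : Λ) (s : globalSections (δ a)) :
    sectionRing δ :=
  ⟨MonoidAlgebra.single a (s : X.left.functionField), fun b => by
    classical
    rw [MonoidAlgebra.coeff_single, Finsupp.single_apply]
    split_ifs with h
    · subst h; exact s.2
    · exact zero_mem _⟩

/-- `Y = Spec R` for the section ring `R`. -/
abbrev specSectionRing (δ : Λ →* CartierDivisor X.left) : Over (Spec (.of k)) :=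
  (Spec (.of (sectionRing δ))).asOver (Spec (.of k))

/-- The stable locus of `Y = Spec R`: the union of the sets `Y_s` over all homogeneous `s` such that
`X_s` is affine. -/
def stableOpen (δ : Λ →* CartierDivisor X.left) : (Spec (.of (sectionRing δ))).Opens :=
  ⨆ (a : Λ) (s : globalSections (δ a)) (_ : IsAffineOpen (nonvanishing (δ a) s.1)),
    PrimeSpectrum.basicOpen (homogeneous δ a s)

/-- The stable locus as a `k`-scheme. -/
def stableLocus (δ : Λ →* CartierDivisor X.left) : Over (Spec (.of k)) :=
  Over.mk ((stableOpen δ).ι ≫ (specSectionRing δ).hom)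

/-- A section of `𝒪(δ a)` as a regular function on the stable locus. -/
def stableFunction (δ : Λ →* CartierDivisor X.left) (a : Λ) (s : globalSections (δ a)) :
    Γ((stableLocus δ).left, ⊤) :=
  (stableOpen δ).ι.appTop ((Scheme.ΓSpecIso (.of (sectionRing δ))).inv (homogeneous δ a s))

/-- The action of `Hom(Λ, 𝔾_m)` on the stable locus is the one that the grading of the section ring
induces: a homogeneous function of degree `a` is pulled back to its product with the
character `a`. -/
def IsGradingAction (δ : Λ →* CartierDivisor X.left) [ModObj (diag k Λ) (stableLocus δ)] : Prop :=
  ∀ (a : Λ) (s : globalSections (δ a)),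
    (act (diag k Λ) (stableLocus δ)).left.appTop (stableFunction δ a s) =
      (fst (diag k Λ) (stableLocus δ)).left.appTop (character k a) *
        (snd (diag k Λ) (stableLocus δ)).left.appTop (stableFunction δ a s)

/-- `π` is the natural morphism from the stable locus to `X`: if `X_s` is affine, for a section `s`
of `𝒪(δ a)`, then `π` restricts to the morphism `Y_s ⟶ X_s` under which a function `t / s`
on `X_s`, for a section `t` of `𝒪(δ a)`, is pulled back to `t / s`. (Every function on `X_s` is
of the form `t / s ^ n`, and `X_s` is also the nonvanishing locus of `s ^ n`.) -/
def IsNaturalMap (δ : Λ →* CartierDivisor X.left) (π : stableLocus δ ⟶ X) : Prop :=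
  ∀ (a : Λ) (s : globalSections (δ a)), IsAffineOpen (nonvanishing (δ a) s.1) →
    π.left ⁻¹ᵁ nonvanishing (δ a) s.1 =
        (stableOpen δ).ι ⁻¹ᵁ PrimeSpectrum.basicOpen (homogeneous δ a s) ∧
      ∀ (t : globalSections (δ a)) (f : Γ(X.left, nonvanishing (δ a) s.1)),
        (∀ (x : X.left) (hx : x ∈ nonvanishing (δ a) s.1),
          algebraMap _ X.left.functionField (X.left.presheaf.germ _ x hx f) * s.1 = t.1) →
        π.left.app (nonvanishing (δ a) s.1) f *
            (stableLocus δ).left.presheaf.map (homOfLE le_top).op (stableFunction δ a s) =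
          (stableLocus δ).left.presheaf.map (homOfLE le_top).op (stableFunction δ a t)

end Invariant

end ToricQuot

end

open ToricQuot

open scoped MonObj TensorProduct

noncomputable section

/-! Write T for the torus acting on X.

(i) ⇒ (iii). Multiplying by m and correcting by a principal divisor turns the sections of an ample
family into homogeneous elements of R, so X is covered by affine sets X_s with s homogeneous in R
(`HasInvariantAmpleFamily.coveredByAffine`). Every rational function is then a quotient of two
homogeneous elements up to degree, so inverting the nonzero homogeneous elements of R gives K(X)[Λ]
(`CoveredByAffine.isLocalization`). Its degree zero part K(X) induces π (`exists_projection`). Since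
Λ is free, the D_λ have near each point local equations d_λ that are multiplicative in λ; the
functions 1/d_λ of degree λ are units on π⁻¹(U) and give a coordinate π⁻¹(U) → G, so that Y is the
trivial torsor over U (`IsProjection.exists_trivialization`). Finiteness and the quotient property
are local on X and follow. The torus T acts on Y through its action on rational functions, and
invariance of the D_λ says precisely that regular sections stay regular
(`IsProjection.exists_torusAction`).

(iii) ⇒ (ii). The stable locus is open in the affine scheme Y, and a basis of Λ identifies G with a
split torus.

(ii) ⇒ (i). The actions of H and T on Z decompose Γ(Z, 𝒪) into weight spaces. Call f good if the
basic open set of f in Spec Γ(Z, 𝒪) lies in Z; components of good functions are good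
(`IsGood.coeff`). Freeness forces the weights of the H-homogeneous functions that do not vanish at z
to generate the character group, and closedness of the orbit over a closed point supplies the
inverse weights up to powers of f (`IsGeometricQuotient.exists_isHomogeneous`). So Z is covered by
sets Z_f on which every character of H is the weight of an invertible quotient of homogeneous
functions (`IsTrivializing`). Such quotients define a section of Z_f → π(Z_f), whence π(Z_f) is
closed in the affine Z_f and is itself affine. The two actions need not commute, but equivariance of
π forces T-components of H-homogeneous functions to be H-homogeneous (`IsHomogeneous.coeff`), so f
may be taken homogeneous for both. Dividing f by semi-invariant units of the same H-weight gives
local equations on X of a T-invariant divisor, whose section 1 is nonzero exactly on π(Z_f)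
(`IsTrivializing.exists_divisor`). Finitely many of these cover X. -/

namespace ToricQuot

/-! ### Regular functions, diagonalizable groups, and actions on points -/

section Functions

variable {k : Type u} [Field k]

/-- The pull-back of regular functions. -/
def pb {S T : Over (Spec (.of k))} (f : S ⟶ T) : Γ(T.left, ⊤) →+* Γ(S.left, ⊤) :=
  f.left.appTop.hom

@[simp]
lemma pb_comp {S T U : Over (Spec (.of k))} (f : S ⟶ T) (g : T ⟶ U) (a) :
    pb (f ≫ g) a = pb f (pb g a) := by
  rw [pb, Over.comp_left, Scheme.Hom.comp_appTop]; rfl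

@[simp]
lemma pb_id {S : Over (Spec (.of k))} (a) : pb (𝟙 S) a = a := by
  simp [pb]

/-- The structure map from `k` to the regular functions. -/
def scalar (S : Over (Spec (.of k))) : k →+* Γ(S.left, ⊤) :=
  S.hom.appTop.hom.comp (Scheme.ΓSpecIso (.of k)).inv.hom

@[simp]
lemma pb_scalar {S T : Over (Spec (.of k))} (f : S ⟶ T) (c : k) :
    pb f (scalar T c) = scalar S c := by
  simp only [pb, scalar, RingHom.comp_apply]
  rw [← Over.w f, Scheme.Hom.comp_appTop]
  rfl

section Affine

variable (A : Type u) [CommRing A] [Algebra k A]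

variable (k) in
/-- `Spec A` as a `k`-scheme. -/
abbrev sp : Over (Spec (.of k)) := (Spec (.of A)).asOver (Spec (.of k))

variable (k) in
/-- An element of `A` as a function on `Spec A`. -/
def coord : A →+* Γ((sp k A).left, ⊤) := (Scheme.ΓSpecIso (.of A)).inv.hom

lemma coord_algebraMap (c : k) : coord k A (algebraMap k A c) = scalar (sp k A) c := by
  have := Scheme.ΓSpecIso_inv_naturality (CommRingCat.ofHom (algebraMap k A))
  exact congr($(this).hom c)

lemma coord_surjective : Function.Surjective (coord k A) :=
  (ConcreteCategory.bijective_of_isIso (Scheme.ΓSpecIso (.of A)).inv).2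

variable {A}

lemma sp_ext {S : Over (Spec (.of k))} {f g : S ⟶ sp k A}
    (h : ∀ a, pb f (coord k A a) = pb g (coord k A a)) : f = g := by
  ext1
  have : IsAffine (sp k A).left := inferInstanceAs (IsAffine (Spec (.of A)))
  refine ext_of_isAffine ?_
  ext a
  obtain ⟨b, rfl⟩ := coord_surjective A a
  exact h b

lemma toSpecΓ_map_comp {S : Scheme.{u}} (p : S ⟶ Spec (.of k)) (φ : A →+* Γ(S, ⊤))
    (h : φ.comp (algebraMap k A) = p.appTop.hom.comp (Scheme.ΓSpecIso (.of k)).inv.hom) :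
    (S.toSpecΓ ≫ Spec.map (CommRingCat.ofHom φ)) ≫
      Spec.map (CommRingCat.ofHom (algebraMap k A)) = p := by
  rw [Category.assoc, ← Spec.map_comp, ← CommRingCat.ofHom_comp, h, CommRingCat.ofHom_comp,
    Spec.map_comp, CommRingCat.ofHom_hom, CommRingCat.ofHom_hom,
    ← Scheme.toSpecΓ_naturality_assoc, ← SpecMap_ΓSpecIso_hom, ← Spec.map_comp]
  simp

lemma appTop_toSpecΓ_map {S : Scheme.{u}} (φ : A →+* Γ(S, ⊤)) (a : A) :
    (S.toSpecΓ ≫ Spec.map (CommRingCat.ofHom φ)).appTop.hom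
      ((Scheme.ΓSpecIso (.of A)).inv.hom a) = φ a := by
  have h := congr($(Scheme.ΓSpecIso_inv_naturality (CommRingCat.ofHom φ)).hom a)
  simp only [CommRingCat.hom_comp, RingHom.comp_apply, CommRingCat.hom_ofHom] at h
  rw [Scheme.Hom.comp_appTop, CommRingCat.hom_comp, RingHom.comp_apply, ← h,
    Scheme.toSpecΓ_appTop]
  exact congr($((Scheme.ΓSpecIso Γ(S, ⊤)).inv_hom_id).hom (φ a))

/-- The morphism to `Spec A` given by a ring homomorphism. -/
def toSp (S : Over (Spec (.of k))) (φ : A →+* Γ(S.left, ⊤))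
    (h : ∀ c, φ (algebraMap k A c) = scalar S c) : S ⟶ sp k A :=
  Over.homMk (S.left.toSpecΓ ≫ Spec.map (CommRingCat.ofHom φ))
    (toSpecΓ_map_comp S.hom φ (RingHom.ext h))

@[simp]
lemma pb_toSp (S : Over (Spec (.of k))) (φ : A →+* Γ(S.left, ⊤)) (h) (a : A) :
    pb (toSp S φ h) (coord k A a) = φ a :=
  appTop_toSpecΓ_map φ a

lemma toSp_preimage (S : Over (Spec (.of k))) (φ : A →+* Γ(S.left, ⊤)) (h) (a : A) :
    (toSp S φ h).left ⁻¹ᵁ PrimeSpectrum.basicOpen a = S.left.basicOpen (φ a) := by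
  have h1 : (toSp S φ h).left ⁻¹ᵁ PrimeSpectrum.basicOpen a =
    S.left.toSpecΓ ⁻¹ᵁ (Spec.map (CommRingCat.ofHom φ) ⁻¹ᵁ PrimeSpectrum.basicOpen a) := rfl
  rw [h1]
  exact S.left.toSpecΓ_preimage_basicOpen (φ a)

end Affine

section Diag

variable {M : Type u} [CommGroup M]

lemma character_eq (m : M) : character k m = coord k (MonoidAlgebra k M) (.of k M m) := rfl

@[simp]
lemma character_one : character k (1 : M) = 1 := by
  rw [character_eq, map_one, map_one]

@[simp]
lemma character_mul (m n : M) : character k (m * n) = character k m * character k n := by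
  rw [character_eq, map_mul, map_mul]; rfl

lemma isUnit_character (m : M) : IsUnit (character k m) :=
  IsUnit.of_mul_eq_one (character k m⁻¹) (by rw [← character_mul, mul_inv_cancel, character_one])

lemma diag_ext {S : Over (Spec (.of k))} {f g : S ⟶ diag k M}
    (h : ∀ m, pb f (character k m) = pb g (character k m)) : f = g := by
  refine sp_ext (A := MonoidAlgebra k M) fun a => ?_
  induction a using MonoidAlgebra.induction_on with
  | of m => exact h m
  | add x y hx hy => simp only [map_add, hx, hy]
  | smul r x hx => simp only [Algebra.smul_def, map_mul, hx, coord_algebraMap, pb_scalar]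

/-- The morphism to `Hom(M, 𝔾_m)` given by a homomorphism from `M` to the invertible functions. -/
def toDiag (S : Over (Spec (.of k))) (χ : M →* Γ(S.left, ⊤)) : S ⟶ diag k M :=
  toSp (A := MonoidAlgebra k M) S (MonoidAlgebra.liftNCRingHom (scalar S) χ
    fun _ _ => mul_comm _ _) fun c => by
      simp [MonoidAlgebra.liftNCRingHom]

@[simp]
lemma pb_toDiag (S : Over (Spec (.of k))) (χ : M →* Γ(S.left, ⊤)) (m : M) :
    pb (toDiag S χ) (character k m) = χ m := by
  rw [character_eq, toDiag, pb_toSp]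
  simp [MonoidAlgebra.liftNCRingHom]

lemma appTop_SpecMap {A B : CommRingCat.{u}} (f : A ⟶ B) (a : A) :
    (Spec.map f).appTop.hom ((Scheme.ΓSpecIso A).inv.hom a) =
      (Scheme.ΓSpecIso B).inv.hom (f.hom a) :=
  congr($(Scheme.ΓSpecIso_inv_naturality f).hom a).symm

lemma pb_one_character (m : M) : pb (η[diag k M]) (character k m) = 1 := by
  refine (appTop_SpecMap (CommRingCat.ofHom
    (Bialgebra.counitAlgHom k (MonoidAlgebra k M)).toRingHom) (.of k M m)).trans ?_
  have : Bialgebra.counitAlgHom k (MonoidAlgebra k M) (.of k M m) = 1 := by simp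
  refine (congrArg _ this).trans (map_one _)

/-- The group law of a diagonalizable group is the spectrum of the comultiplication, which sends a
group-like element a to a ⊗ a; characters are therefore multiplicative. -/
lemma appTop_pullbackSpecIso_comul {A : Type u} [CommRing A] [Bialgebra k A] (a : A)
    (ha : Coalgebra.comul (R := k) a = a ⊗ₜ[k] a) :
    ((pullbackSpecIso k A A).hom ≫
        Spec.map (CommRingCat.ofHom (Bialgebra.comulAlgHom k A).toRingHom)).appTop.hom
          ((Scheme.ΓSpecIso (.of A)).inv.hom a) =
      (Limits.pullback.fst (Spec.map (CommRingCat.ofHom (algebraMap k A)))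
        (Spec.map (CommRingCat.ofHom (algebraMap k A)))).appTop.hom
          ((Scheme.ΓSpecIso (.of A)).inv.hom a) *
        (Limits.pullback.snd (Spec.map (CommRingCat.ofHom (algebraMap k A)))
          (Spec.map (CommRingCat.ofHom (algebraMap k A)))).appTop.hom
          ((Scheme.ΓSpecIso (.of A)).inv.hom a) := by
  rw [← pullbackSpecIso_hom_fst k A A, ← pullbackSpecIso_hom_snd k A A]
  simp only [Scheme.Hom.comp_appTop, CommRingCat.hom_comp, RingHom.comp_apply]
  rw [appTop_SpecMap, appTop_SpecMap, appTop_SpecMap, ← map_mul, ← map_mul]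
  congr 2
  refine ha.trans ?_
  simp [Algebra.TensorProduct.tmul_mul_tmul]

lemma pb_mul_character (m : M) : pb (μ[diag k M]) (character k m) =
    pb (fst _ _) (character k m) * pb (snd _ _) (character k m) :=
  appTop_pullbackSpecIso_comul (A := MonoidAlgebra k M) (.of k M m) (by
    rw [MonoidAlgebra.of_apply, MonoidAlgebra.comul_single]; simp)

end Diag

section Points

variable {G Z : Over (Spec (.of k))} [GrpObj G] [ModObj G Z]

/-- The action on points with values in `S`. -/
def actPt {S : Over (Spec (.of k))} (g : S ⟶ G) (z : S ⟶ Z) : S ⟶ Z := lift g z ≫ act G Z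

variable {S S' : Over (Spec (.of k))}

lemma comp_actPt (f : S' ⟶ S) (g : S ⟶ G) (z : S ⟶ Z) :
    f ≫ actPt g z = actPt (f ≫ g) (f ≫ z) := by
  rw [actPt, actPt, comp_lift_assoc]

lemma act_eq_actPt : act G Z = actPt (fst G Z) (snd G Z) := by
  simp [actPt]

@[simp]
lemma one_actPt (z : S ⟶ Z) : actPt (1 : S ⟶ G) z = z := by
  have h := ModObj.one_smul (M := G) Z
  have e : lift (1 : S ⟶ G) z = lift (toUnit S) z ≫ η[G] ▷ Z := by
    ext1 <;> simp [Hom.one_def]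
  rw [actPt, e, Category.assoc]
  refine (congrArg (lift (toUnit S) z ≫ ·) h).trans ?_
  exact lift_leftUnitor_hom _ _

lemma mul_actPt (g h : S ⟶ G) (z : S ⟶ Z) : actPt (g * h) z = actPt g (actPt h z) := by
  have H := ModObj.mul_smul (M := G) Z
  have e : lift (g * h) z = lift (lift g h) z ≫ μ[G] ▷ Z := by
    ext1 <;> simp [Hom.mul_def]
  rw [actPt, e, Category.assoc]
  refine (congrArg (lift (lift g h) z ≫ ·) H).trans ?_
  change lift (lift g h) z ≫ (α_ G G Z).hom ≫ G ◁ act G Z ≫ act G Z = _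
  rw [lift_lift_associator_hom_assoc, lift_whiskerLeft_assoc]
  rfl

/-- An action from its effect on points. -/
abbrev modObjOfPoints {G Z : Over (Spec (.of k))} [GrpObj G] (a : G ⊗ Z ⟶ Z)
    (h1 : lift (1 : Z ⟶ G) (𝟙 Z) ≫ a = 𝟙 Z)
    (h2 : lift (fst G (G ⊗ Z) * (snd G (G ⊗ Z) ≫ fst G Z)) (snd G (G ⊗ Z) ≫ snd G Z) ≫ a =
      lift (fst G (G ⊗ Z)) (snd G (G ⊗ Z) ≫ a) ≫ a) : ModObj G Z where
  smul := a
  one_smul := by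
    change η[G] ▷ Z ≫ a = (λ_ Z).hom
    have : η[G] ▷ Z = (λ_ Z).hom ≫ lift (1 : Z ⟶ G) (𝟙 Z) := by
      ext1
      · simp only [whiskerRight_fst, Hom.one_def, Category.assoc, lift_fst, comp_toUnit_assoc]
        congr 1
      · simp [leftUnitor_hom]
    rw [this, Category.assoc, h1, Category.comp_id]
  mul_smul := by
    change μ[G] ▷ Z ≫ a = (α_ G G Z).hom ≫ G ◁ a ≫ a
    rw [← cancel_epi (α_ G G Z).inv, Iso.inv_hom_id_assoc]
    have e1 : (α_ G G Z).inv ≫ μ[G] ▷ Z =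
        lift (fst G (G ⊗ Z) * (snd G (G ⊗ Z) ≫ fst G Z)) (snd G (G ⊗ Z) ≫ snd G Z) := by
      ext1
      · have : (α_ G G Z).inv ≫ fst (G ⊗ G) Z = lift (fst G (G ⊗ Z)) (snd G (G ⊗ Z) ≫ fst G Z) := by
          ext1 <;> simp
        simp [Hom.mul_def, reassoc_of% this]
      · simp
    have e2 : G ◁ a = lift (fst G (G ⊗ Z)) (snd G (G ⊗ Z) ≫ a) := by
      ext1 <;> simp
    rw [reassoc_of% e1, e2, h2]

end Points

section Diag

variable {M : Type u} [CommGroup M] {S : Over (Spec (.of k))}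

@[simp]
lemma pb_hom_mul_character (g h : S ⟶ diag k M) (m : M) :
    pb (g * h) (character k m) = pb g (character k m) * pb h (character k m) := by
  rw [Hom.mul_def, pb_comp, pb_mul_character, map_mul, ← pb_comp, ← pb_comp, lift_fst, lift_snd]

@[simp]
lemma pb_hom_one_character (m : M) : pb (1 : S ⟶ diag k M) (character k m) = 1 := by
  rw [Hom.one_def, pb_comp, pb_one_character, map_one]

end Diag

section Opens

/-- An open subset as a `k`-scheme. -/
abbrev res (S : Over (Spec (.of k))) (V : S.left.Opens) : Over (Spec (.of k)) :=
  Over.mk (V.ι ≫ S.hom)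

/-- The inclusion of an open subset. -/
def inc (S : Over (Spec (.of k))) (V : S.left.Opens) : res S V ⟶ S := Over.homMk V.ι

variable {S S' : Over (Spec (.of k))} {V : S.left.Opens}

instance mono_inc : Mono (inc S V) :=
  have : Mono (inc S V).left := inferInstanceAs (Mono V.ι)
  Over.mono_of_mono_left _

/-- The factorization of a morphism through an open subset that contains its image. -/
def liftRes (f : S' ⟶ S) (h : ∀ p, f.left p ∈ V) : S' ⟶ res S V :=
  Over.homMk (IsOpenImmersion.lift V.ι f.left (by
    rw [Scheme.Opens.range_ι]
    exact Set.range_subset_iff.2 h)) (by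
    change _ ≫ V.ι ≫ S.hom = _
    rw [IsOpenImmersion.lift_fac_assoc, Over.w])

@[simp]
lemma liftRes_inc (f : S' ⟶ S) (h : ∀ p, f.left p ∈ V) : liftRes f h ≫ inc S V = f := by
  ext1
  exact IsOpenImmersion.lift_fac _ _ _

@[simp]
lemma liftRes_inc_assoc (f : S' ⟶ S) (h : ∀ p, f.left p ∈ V) {W : Over (Spec (.of k))}
    (g : S ⟶ W) : liftRes f h ≫ inc S V ≫ g = f ≫ g := by
  rw [← Category.assoc, liftRes_inc]

lemma liftRes_congr {f g : S' ⟶ S} (e : f = g) (h : ∀ p, f.left p ∈ V)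
    (h' : ∀ p, g.left p ∈ V) : liftRes f h = liftRes g h' := by
  subst e; rfl

/-- A point of an open subset as a point of the corresponding scheme. -/
def resPt (V : S.left.Opens) (x : S.left) (hx : x ∈ V) : (res S V).left :=
  show V.toScheme from ⟨x, hx⟩

@[simp]
lemma inc_resPt (x : S.left) (hx : x ∈ V) : (inc S V).left (resPt V x hx) = x := rfl

lemma comp_left_apply {S T U : Over (Spec (.of k))} (f : S ⟶ T) (g : T ⟶ U) (p : S.left) :
    (f ≫ g).left p = g.left (f.left p) := rfl

lemma inc_mem (p : (res S V).left) : (inc S V).left p ∈ V := p.2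

end Opens

end Functions

/-! ### Rational functions and their pull-back under dominant morphisms -/

section FunctionField

variable {X Y Z : Scheme.{u}} [IsIntegral X] [IsIntegral Y] [IsIntegral Z]

lemma map_genericPoint (f : X ⟶ Y) [IsDominant f] : f (genericPoint X) = genericPoint Y := by
  have h := (genericPoint_spec X).image f.continuous
  rw [Set.image_univ, f.denseRange.closure_range] at h
  exact h.eq (genericPoint_spec Y)

/-- The pull-back of rational functions under a dominant morphism. -/
def ff (f : X ⟶ Y) [IsDominant f] : Y.functionField →+* X.functionField :=
  (Y.presheaf.stalkSpecializes (specializes_of_eq (map_genericPoint f)) ≫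
    f.stalkMap (genericPoint X)).hom

lemma ff_algebraMap (f : X ⟶ Y) [IsDominant f] (x : X) (a : Y.presheaf.stalk (f x)) :
    ff f (algebraMap _ Y.functionField a) = algebraMap _ X.functionField (f.stalkMap x a) := by
  have h : Y.presheaf.stalkSpecializes ((genericPoint_spec Y).specializes trivial) ≫
      Y.presheaf.stalkSpecializes (specializes_of_eq (map_genericPoint f)) ≫
      f.stalkMap (genericPoint X) =
      f.stalkMap x ≫ X.presheaf.stalkSpecializes ((genericPoint_spec X).specializes trivial) := by
    rw [← f.stalkSpecializes_stalkMap, ← Category.assoc, TopCat.Presheaf.stalkSpecializes_comp]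
  exact congr($(h).hom a)

lemma genericPoint_mem {U : X.Opens} {x : X} (hx : x ∈ U) : genericPoint X ∈ U :=
  ((genericPoint_spec X).specializes trivial).mem_open U.2 hx

/-- A function on an open set as a rational function. -/
def toK (U : X.Opens) (hU : genericPoint X ∈ U) : Γ(X, U) →+* X.functionField :=
  (X.presheaf.germ U (genericPoint X) hU).hom

lemma toK_injective (U : X.Opens) (hU : genericPoint X ∈ U) : Function.Injective (toK U hU) :=
  germ_injective_of_isIntegral _ _ _

lemma algebraMap_germ {U : X.Opens} {x : X} (hx : x ∈ U) (a : Γ(X, U)) :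
    algebraMap (X.presheaf.stalk x) X.functionField (X.presheaf.germ U x hx a) =
      toK U (genericPoint_mem hx) a :=
  haveI : Nonempty U := ⟨⟨x, hx⟩⟩
  Scheme.algebraMap_germ_eq_germToFunctionField X hx a

lemma toK_map {U V : X.Opens} (h : U ≤ V) (hU : genericPoint X ∈ U) (a : Γ(X, V)) :
    toK U hU (X.presheaf.map (homOfLE h).op a) = toK V (h hU) a :=
  X.presheaf.germ_res_apply (homOfLE h) _ hU a

lemma genericPoint_mem_preimage (f : X ⟶ Y) [IsDominant f] {U : Y.Opens}
    (hU : genericPoint Y ∈ U) : genericPoint X ∈ f ⁻¹ᵁ U :=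
  show f (genericPoint X) ∈ U from (map_genericPoint f).symm ▸ hU

lemma ff_toK (f : X ⟶ Y) [IsDominant f] (U : Y.Opens) (hU : genericPoint Y ∈ U) (a : Γ(Y, U)) :
    ff f (toK U hU a) = toK (f ⁻¹ᵁ U) (genericPoint_mem_preimage f hU) (f.app U a) := by
  have hU' : genericPoint X ∈ f ⁻¹ᵁ U := genericPoint_mem_preimage f hU
  have hU'' : f (genericPoint X) ∈ U := hU'
  have h := ff_algebraMap f (genericPoint X) (Y.presheaf.germ U _ hU'' a)
  rw [algebraMap_germ hU''] at h
  refine h.trans (Eq.trans (congrArg _ ?_) (algebraMap_germ hU' (f.app U a)))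
  exact congr($(f.germ_stalkMap U _ hU'').hom a)

@[simp]
lemma ff_id (a : X.functionField) : ff (𝟙 X) a = a := by
  obtain ⟨U, hU, b, rfl⟩ := X.presheaf.exists_germ_eq a
  refine (ff_toK (𝟙 X) U hU b).trans ?_
  rw [Scheme.Hom.id_app]
  rfl

lemma ff_comp (f : X ⟶ Y) (g : Y ⟶ Z) [IsDominant f] [IsDominant g] (a : Z.functionField) :
    ff (f ≫ g) a = ff f (ff g a) := by
  obtain ⟨U, hU, b, rfl⟩ := Z.presheaf.exists_germ_eq a
  have h1 := ff_toK (f ≫ g) U hU b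
  have h2 := (congrArg (ff f) (ff_toK g U hU b)).trans
    (ff_toK f (g ⁻¹ᵁ U) (genericPoint_mem_preimage g hU) (g.app U b))
  refine h1.trans (Eq.trans ?_ h2.symm)
  rw [Scheme.Hom.comp_app]
  rfl

lemma ff_injective (f : X ⟶ Y) [IsDominant f] : Function.Injective (ff f) := (ff f).injective

lemma ff_congr {f g : X ⟶ Y} [IsDominant f] [IsDominant g] (h : f = g) (a) : ff f a = ff g a := by
  subst h; rfl

/-- The local ring of a point as a subring of the function field. -/
def regularAt (x : X) : Subring X.functionField :=
  (algebraMap (X.presheaf.stalk x) X.functionField).range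

/-- A rational function is regular and does not vanish at a point. -/
def IsUnitAt (x : X) (f : X.functionField) : Prop :=
  ∃ a : X.presheaf.stalk x, IsUnit a ∧ algebraMap _ X.functionField a = f

lemma algebraMap_stalk_injective (x : X) :
    Function.Injective (algebraMap (X.presheaf.stalk x) X.functionField) :=
  IsFractionRing.injective _ _

lemma isUnitAt_iff {x : X} {f : X.functionField} :
    IsUnitAt x f ↔ f ≠ 0 ∧ f ∈ regularAt x ∧ f⁻¹ ∈ regularAt x := by
  constructor
  · rintro ⟨a, ha, rfl⟩
    refine ⟨(ha.map (algebraMap _ X.functionField)).ne_zero, ⟨a, rfl⟩, ?_⟩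
    obtain ⟨u, rfl⟩ := ha
    refine ⟨(u⁻¹ : (X.presheaf.stalk x)ˣ), ?_⟩
    refine eq_inv_of_mul_eq_one_left ?_
    rw [← map_mul, Units.inv_mul, map_one]
  · rintro ⟨h0, ⟨a, rfl⟩, ⟨b, hb⟩⟩
    refine ⟨a, IsUnit.of_mul_eq_one b (algebraMap_stalk_injective x ?_), rfl⟩
    rw [map_mul, hb, mul_inv_cancel₀ h0, map_one]

lemma IsUnitAt.ne_zero {x : X} {f : X.functionField} (h : IsUnitAt x f) : f ≠ 0 :=
  (isUnitAt_iff.1 h).1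

lemma IsUnitAt.mem {x : X} {f : X.functionField} (h : IsUnitAt x f) : f ∈ regularAt x :=
  (isUnitAt_iff.1 h).2.1

lemma IsUnitAt.inv {x : X} {f : X.functionField} (h : IsUnitAt x f) : IsUnitAt x f⁻¹ := by
  obtain ⟨a, b, c⟩ := isUnitAt_iff.1 h
  exact isUnitAt_iff.2 ⟨inv_ne_zero a, c, by rwa [inv_inv]⟩

lemma IsUnitAt.mul {x : X} {f g : X.functionField} (hf : IsUnitAt x f) (hg : IsUnitAt x g) :
    IsUnitAt x (f * g) := by
  obtain ⟨a, ha, rfl⟩ := hf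
  obtain ⟨b, hb, rfl⟩ := hg
  exact ⟨a * b, ha.mul hb, map_mul _ _ _⟩

lemma IsUnitAt.pow {x : X} {f : X.functionField} (hf : IsUnitAt x f) (n : ℕ) :
    IsUnitAt x (f ^ n) := by
  obtain ⟨a, ha, rfl⟩ := hf
  exact ⟨a ^ n, ha.pow n, map_pow _ _ _⟩

lemma isUnitAt_one {x : X} : IsUnitAt x (1 : X.functionField) := ⟨1, isUnit_one, map_one _⟩

lemma IsUnitAt.div {x : X} {f g : X.functionField} (hf : IsUnitAt x f) (hg : IsUnitAt x g) :
    IsUnitAt x (f / g) := by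
  rw [div_eq_mul_inv]; exact hf.mul hg.inv

/-- A product of regular functions is a unit only if the factors are. -/
lemma IsUnitAt.of_mul {x : X} {f g : X.functionField} (h : IsUnitAt x (f * g))
    (hf : f ∈ regularAt x) (hg : g ∈ regularAt x) : IsUnitAt x f := by
  obtain ⟨a, rfl⟩ := hf
  obtain ⟨b, rfl⟩ := hg
  obtain ⟨c, hc, h⟩ := h
  rw [← map_mul] at h
  rw [algebraMap_stalk_injective x h] at hc
  exact ⟨a, isUnit_of_mul_isUnit_left hc, rfl⟩

lemma mem_unitsAt_iff {x : X} {f : X.functionFieldˣ} :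
    f ∈ unitsAt X x ↔ IsUnitAt x (f : X.functionField) := by
  constructor
  · rintro ⟨u, rfl⟩
    exact ⟨u, u.isUnit, rfl⟩
  · rintro ⟨a, ha, h⟩
    exact ⟨ha.unit, Units.ext h⟩

lemma quotient_eq_iff {x : X} {f g : X.functionFieldˣ} :
    (f : X.functionFieldˣ ⧸ unitsAt X x) = g ↔ IsUnitAt x ((f : X.functionField) / g) := by
  rw [eq_comm, QuotientGroup.eq, mem_unitsAt_iff, Units.val_mul, Units.val_inv_eq_inv_val,
    inv_mul_eq_div]

lemma ff_mem_regularAt (f : X ⟶ Y) [IsDominant f] {x : X} {a : Y.functionField}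
    (h : a ∈ regularAt (f x)) : ff f a ∈ regularAt x := by
  obtain ⟨b, rfl⟩ := h
  exact ⟨_, (ff_algebraMap f x b).symm⟩

lemma IsUnitAt.ff (f : X ⟶ Y) [IsDominant f] {x : X} {a : Y.functionField}
    (h : IsUnitAt (f x) a) : IsUnitAt x (ff f a) := by
  obtain ⟨b, hb, rfl⟩ := h
  exact ⟨_, hb.map (f.stalkMap x).hom, (ff_algebraMap f x b).symm⟩

lemma IsUnitAt.of_ff (f : X ⟶ Y) [IsDominant f] {x : X} {a : Y.functionField}
    (h : IsUnitAt x (ToricQuot.ff f a)) (ha : a ∈ regularAt (f x)) : IsUnitAt (f x) a := by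
  obtain ⟨b, rfl⟩ := ha
  obtain ⟨c, hc, h⟩ := h
  rw [ff_algebraMap] at h
  rw [algebraMap_stalk_injective x h] at hc
  exact ⟨b, isUnit_of_map_unit (f.stalkMap x).hom b hc, rfl⟩

lemma toK_mem_regularAt {U : X.Opens} {x : X} (hx : x ∈ U) (a : Γ(X, U)) (hU) :
    toK U hU a ∈ regularAt x :=
  ⟨_, algebraMap_germ hx a⟩

lemma isUnitAt_toK_iff {U : X.Opens} {x : X} (hx : x ∈ U) (a : Γ(X, U)) (hU) :
    IsUnitAt x (toK U hU a) ↔ x ∈ X.basicOpen a := by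
  rw [X.mem_basicOpen a x hx]
  constructor
  · rintro ⟨b, hb, h⟩
    rw [← algebraMap_germ hx a] at h
    rwa [← algebraMap_stalk_injective x h]
  · intro h
    exact ⟨_, h, algebraMap_germ hx a⟩

/-- A rational function that is regular at the points of an open set is a function on it. -/
lemma exists_toK_eq {U : X.Opens} (hU : genericPoint X ∈ U) {f : X.functionField}
    (h : ∀ x ∈ U, f ∈ regularAt x) : ∃ a, toK U hU a = f := by
  have key : ∀ x : U, ∃ (V : X.Opens) (hV : V ≤ U) (hx : x.1 ∈ V) (a : Γ(X, V)),
      toK V (genericPoint_mem hx) a = f := by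
    rintro ⟨x, hx⟩
    obtain ⟨b, hb⟩ := h x hx
    obtain ⟨W, hxW, c, hc⟩ := X.presheaf.exists_germ_eq b
    refine ⟨U ⊓ W, inf_le_left, ⟨hx, hxW⟩, X.presheaf.map (homOfLE inf_le_right).op c, ?_⟩
    rw [toK_map, ← algebraMap_germ hxW, hc, hb]
  choose V hVU hxV a ha using key
  obtain ⟨s, hs, -⟩ := X.sheaf.existsUnique_gluing' V U (fun i => homOfLE (hVU i))
    (fun x hx => TopologicalSpace.Opens.mem_iSup.2 ⟨⟨x, hx⟩, hxV ⟨x, hx⟩⟩) a (by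
      intro i j
      have hg : genericPoint X ∈ V i ⊓ V j :=
        ⟨genericPoint_mem (hxV i), genericPoint_mem (hxV j)⟩
      apply toK_injective _ hg
      exact (toK_map inf_le_left hg (a i)).trans
        (((ha i).trans (ha j).symm).trans (toK_map inf_le_right hg (a j)).symm))
  refine ⟨s, ?_⟩
  have h1 := hs ⟨_, hU⟩
  rw [← ha ⟨_, hU⟩, ← h1]
  exact (toK_map (hVU _) (hxV _) s).symm

lemma fromSpecStalk_comp (f : X ⟶ Y) [IsDominant f] :
    X.fromSpecStalk (genericPoint X) ≫ f =
      Spec.map (CommRingCat.ofHom (ff f)) ≫ Y.fromSpecStalk (genericPoint Y) := by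
  rw [← Scheme.SpecMap_stalkMap_fromSpecStalk, ff, CommRingCat.ofHom_hom, Spec.map_comp,
    Category.assoc, Scheme.SpecMap_stalkSpecializes_fromSpecStalk]

instance : IsDominant (X.fromSpecStalk (genericPoint X)) := by
  refine ⟨?_⟩
  have h : genericPoint X ∈ Set.range (X.fromSpecStalk (genericPoint X)) := by
    rw [X.range_fromSpecStalk]
    exact specializes_rfl
  exact Dense.mono (Set.singleton_subset_iff.2 h) (dense_iff_closure_eq.2 (genericPoint_spec X))

/-- The two morphisms agree on the generic point, which is dense in a reduced scheme, and the target
is separated. Identities between dominant morphisms thus become identities in a field. -/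
lemma hom_ext_of_ff {S : Scheme.{u}} {f g : X ⟶ Y} [IsDominant f] [IsDominant g] (s : Y ⟶ S)
    [IsSeparated s] (h : f ≫ s = g ≫ s) (H : ∀ a, ff f a = ff g a) : f = g := by
  refine ext_of_isDominant_of_isSeparated s h (X.fromSpecStalk (genericPoint X)) ?_
  rw [fromSpecStalk_comp, fromSpecStalk_comp, RingHom.ext H]

end FunctionField

section Over

variable {k : Type u} [Field k] {S T : Over (Spec (.of k))} [IsIntegral S.left] [IsIntegral T.left]

variable (S) in
/-- A regular function as a rational function. -/
def rat : Γ(S.left, ⊤) →+* S.left.functionField := toK ⊤ trivial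

lemma rat_injective : Function.Injective (rat S) := toK_injective _ _

lemma rat_pb (f : S ⟶ T) [IsDominant f.left] (a : Γ(T.left, ⊤)) :
    rat S (pb f a) = ff f.left (rat T a) :=
  (ff_toK f.left ⊤ trivial a).symm

lemma rat_mem_regularAt (x : S.left) (a) : rat S a ∈ regularAt x :=
  toK_mem_regularAt (U := ⊤) trivial a _

lemma isUnitAt_rat_iff {x : S.left} {a} : IsUnitAt x (rat S a) ↔ x ∈ S.left.basicOpen a :=
  isUnitAt_toK_iff (U := ⊤) trivial a _

lemma exists_rat_eq {f : S.left.functionField} (h : ∀ x, f ∈ regularAt x) : ∃ a, rat S a = f :=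
  exists_toK_eq (U := ⊤) trivial fun x _ => h x

lemma over_ext_of_ff {f g : S ⟶ T} [IsDominant f.left] [IsDominant g.left] [IsSeparated T.hom]
    (H : ∀ a, ff f.left a = ff g.left a) : f = g := by
  ext1
  exact hom_ext_of_ff T.hom (by rw [Over.w, Over.w]) H

end Over

/-! ### Tori and their products with varieties -/

section Torus

variable {k : Type u} [Field k]

instance (r : ℕ) : IsMulTorsionFree (ULift.{u} (Multiplicative (Fin r → ℤ))) :=
  have : IsMulTorsionFree (Multiplicative (Fin r → ℤ)) := inferInstance
  Function.Injective.isMulTorsionFree (MulEquiv.ulift (α := Multiplicative (Fin r → ℤ))).toMonoidHom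
    (MulEquiv.injective _)

instance (r : ℕ) : Monoid.FG (ULift.{u} (Multiplicative (Fin r → ℤ))) :=
  have : AddGroup.FG (Fin r → ℤ) := Module.Finite.iff_addGroup_fg.1 inferInstance
  have : Group.FG (Multiplicative (Fin r → ℤ)) := inferInstance
  have : Monoid.FG (Multiplicative (Fin r → ℤ)) := Group.fg_iff_monoid_fg.1 this
  Monoid.fg_of_surjective (MulEquiv.ulift (α := Multiplicative (Fin r → ℤ))).symm.toMonoidHom
    (MulEquiv.surjective _)

variable (k) (M : Type u) [CommGroup M] [Monoid.FG M] [IsMulTorsionFree M]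

instance : LocallyOfFiniteType (diag k M).hom :=
  inferInstanceAs (LocallyOfFiniteType (Spec (.of (MonoidAlgebra k M)) ↘ Spec (.of k)))

instance : IsAffine (diag k M).left := inferInstanceAs (IsAffine (Spec _))

instance : IsAffineHom (diag k M).hom :=
  inferInstanceAs (IsAffineHom (Spec.map (CommRingCat.ofHom (algebraMap k (MonoidAlgebra k M)))))

/-- Base change to K turns k[M] into K[M], which is a domain because M is torsion-free. This is what
makes products with a torus integral, so that function fields of such products can be used. -/
instance : GeometricallyIntegral (diag k M).hom := by
  refine ⟨geometrically_iff_of_commRing.2 fun K _ _ Y p q h => ?_⟩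
  have h' : IsPullback p q (Spec.map (CommRingCat.ofHom (algebraMap k (MonoidAlgebra k M))))
    (Spec.map (CommRingCat.ofHom (algebraMap k K))) := h
  let e : Y ≅ Spec (.of (MonoidAlgebra k M ⊗[k] K)) :=
    h'.isoPullback ≪≫ pullbackSpecIso k (MonoidAlgebra k M) K
  let e' : MonoidAlgebra k M ⊗[k] K ≃+* MonoidAlgebra K M :=
    ((Algebra.TensorProduct.comm k _ _).toRingEquiv).trans
      (MonoidAlgebra.scalarTensorEquiv k K).toRingEquiv
  have : IsDomain (MonoidAlgebra k M ⊗[k] K) := e'.toMulEquiv.isDomain _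
  have : IsIntegral (Spec (.of (MonoidAlgebra k M ⊗[k] K))) := inferInstance
  have : Nonempty Y := ⟨e.inv (genericPoint _)⟩
  exact isIntegral_of_isOpenImmersion e.hom

variable {k M}

instance (E : Over (Spec (.of k))) [IsVariety E] : IsVariety (diag k M ⊗ E) := by
  have := IsVariety.isSeparated (X := E)
  have := IsVariety.locallyOfFiniteType (X := E)
  have := IsVariety.quasiCompact (X := E)
  have : IsLocallyNoetherian E.left := LocallyOfFiniteType.isLocallyNoetherian E.hom
  refine ⟨inferInstanceAs (IsIntegral (Limits.pullback (diag k M).hom E.hom)), ?_, ?_, ?_⟩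
  all_goals
    rw [← Over.w (snd (diag k M) E)]
  · have : IsSeparated (snd (diag k M) E).left :=
      inferInstanceAs (IsSeparated (Limits.pullback.snd (diag k M).hom E.hom))
    infer_instance
  · have : LocallyOfFiniteType (snd (diag k M) E).left :=
      inferInstanceAs (LocallyOfFiniteType (Limits.pullback.snd (diag k M).hom E.hom))
    infer_instance
  · have : QuasiCompact (snd (diag k M) E).left :=
      inferInstanceAs (QuasiCompact (Limits.pullback.snd (diag k M).hom E.hom))
    infer_instance

end Torus

/-! ### A local criterion for geometric quotients -/

section Quotient

lemma appLE_appLE {X Y Z : Scheme.{u}} (f : X ⟶ Y) (g : Y ⟶ Z) {U : Z.Opens} {V : Y.Opens}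
    {W : X.Opens} (e₁ : V ≤ g ⁻¹ᵁ U) (e₂ : W ≤ f ⁻¹ᵁ V) (a : Γ(Z, U)) :
    f.appLE V W e₂ (g.appLE U V e₁ a) = (f ≫ g).appLE U W (e₂.trans fun _ h => e₁ h) a :=
  congr($(Scheme.Hom.appLE_comp_appLE f g U V W e₁ e₂).hom a)

lemma appLE_of_eq {X Y : Scheme.{u}} {f g : X ⟶ Y} (h : f = g) {U : Y.Opens} {V : X.Opens}
    (e : V ≤ f ⁻¹ᵁ U) (a : Γ(Y, U)) : f.appLE U V e a = g.appLE U V (h ▸ e) a := by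
  subst h; rfl

lemma appLE_ι_bijective {X : Scheme.{u}} (U : X.Opens) (e : ⊤ ≤ U.ι ⁻¹ᵁ U) :
    Function.Bijective (U.ι.appLE U ⊤ e) := by
  have h : U.ι.appLE U ⊤ e = U.ι.app U ≫ U.toScheme.presheaf.map (eqToHom (by simp)).op := by
    rw [Scheme.Hom.app_eq_appLE, Scheme.Hom.appLE_map]
  have := U.ι.isIso_app U (by simp)
  rw [h]
  exact ConcreteCategory.bijective_of_isIso _

lemma appLE_map_apply {X Y : Scheme.{u}} (f : X ⟶ Y) {U V : Y.Opens} {W : X.Opens}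
    (i : U ≤ V) (e : W ≤ f ⁻¹ᵁ U) (a : Γ(Y, V)) :
    f.appLE U W e (Y.presheaf.map (homOfLE i).op a) = f.appLE V W (e.trans fun _ h => i h) a :=
  congr($(Scheme.Hom.map_appLE f e (homOfLE i).op).hom a)

lemma map_appLE_apply {X Y : Scheme.{u}} (f : X ⟶ Y) {U : Y.Opens} {V W : X.Opens}
    (i : V ≤ W) (e : W ≤ f ⁻¹ᵁ U) (a : Γ(Y, U)) :
    X.presheaf.map (homOfLE i).op (f.appLE U W e a) = f.appLE U V (i.trans e) a :=
  congr($(Scheme.Hom.appLE_map f e (homOfLE i).op).hom a)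

/-- Functions that agree locally are equal. -/
lemma section_ext {X : Scheme.{u}} {V : X.Opens} {a b : Γ(X, V)}
    (h : ∀ x ∈ V, ∃ (U : X.Opens) (hU : U ≤ V), x ∈ U ∧
      X.presheaf.map (homOfLE hU).op a = X.presheaf.map (homOfLE hU).op b) : a = b := by
  choose U hU hx hab using fun x : V => h x.1 x.2
  refine X.sheaf.eq_of_locally_eq' U V (fun i => homOfLE (hU i)) (fun x hxV =>
    TopologicalSpace.Opens.mem_iSup.2 ⟨⟨x, hxV⟩, hx ⟨x, hxV⟩⟩) a b fun i => hab i

variable {k : Type u} [Field k] {G Z X : Over (Spec (.of k))} [GrpObj G] [ModObj G Z]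

lemma resMap_mem (π : Z ⟶ X) (U : X.left.Opens) (p : (res Z (π.left ⁻¹ᵁ U)).left) :
    (inc Z (π.left ⁻¹ᵁ U) ≫ π).left p ∈ U := p.2

/-- The restriction of a morphism to the preimage of an open set. -/
def resMap (π : Z ⟶ X) (U : X.left.Opens) : res Z (π.left ⁻¹ᵁ U) ⟶ res X U :=
  liftRes (inc Z (π.left ⁻¹ᵁ U) ≫ π) (resMap_mem π U)

lemma resMap_inc (π : Z ⟶ X) (U : X.left.Opens) :
    resMap π U ≫ inc X U = inc Z (π.left ⁻¹ᵁ U) ≫ π := liftRes_inc _ _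

lemma liftRes_resMap {S : Over (Spec (.of k))} (π : Z ⟶ X) (U : X.left.Opens) (y : S ⟶ Z)
    (m : ∀ p, y.left p ∈ π.left ⁻¹ᵁ U) (m' : ∀ p, (y ≫ π).left p ∈ U) :
    liftRes y m ≫ resMap π U = liftRes (y ≫ π) m' := by
  rw [← cancel_mono (inc X U), Category.assoc, resMap_inc, liftRes_inc, liftRes_inc_assoc]

/-- Over `U`, the morphism `π` has a section `σ`, and `g` is the group element that moves the
section to a given point. -/
def HasLocalSection (π : Z ⟶ X) (U : X.left.Opens) : Prop :=
  ∃ (σ : res X U ⟶ Z) (g : res Z (π.left ⁻¹ᵁ U) ⟶ G), σ ≫ π = inc X U ∧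
    actPt g (resMap π U ≫ σ) = inc Z (π.left ⁻¹ᵁ U)

lemma HasLocalSection.mono {π : Z ⟶ X} {U V : X.left.Opens}
    (h : HasLocalSection (G := G) π U) (hV : V ≤ U) : HasLocalSection (G := G) π V := by
  obtain ⟨σ, g, h1, h2⟩ := h
  have hi : ∀ p : (res X V).left, (inc X V).left p ∈ U := fun p => hV p.2
  have hj : ∀ p : (res Z (π.left ⁻¹ᵁ V)).left, (inc Z (π.left ⁻¹ᵁ V)).left p ∈ π.left ⁻¹ᵁ U :=
    fun p => hV p.2
  refine ⟨liftRes (inc X V) hi ≫ σ, liftRes (inc Z (π.left ⁻¹ᵁ V)) hj ≫ g, ?_, ?_⟩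
  · rw [Category.assoc, h1, liftRes_inc]
  · have := congrArg (liftRes (inc Z (π.left ⁻¹ᵁ V)) hj ≫ ·) h2
    simp only [comp_actPt, liftRes_inc] at this
    refine Eq.trans (congrArg (actPt _) ?_) this
    rw [← Category.assoc, ← Category.assoc]
    have h3 : ∀ p : (res Z (π.left ⁻¹ᵁ V)).left, (inc Z (π.left ⁻¹ᵁ V) ≫ π).left p ∈ U :=
      fun p => hV p.2
    rw [liftRes_resMap π U _ hj h3]
    refine congrArg (· ≫ σ) ?_
    rw [← cancel_mono (inc X U), Category.assoc, liftRes_inc, liftRes_inc, resMap_inc]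

variable {π : Z ⟶ X} (hπ : act G Z ≫ π = snd G Z ≫ π)
  (H : ∀ x, ∃ U : X.left.Opens, x ∈ U ∧ HasLocalSection (G := G) π U)

include H in
lemma surjective_of_local : Function.Surjective π.left := by
  intro x
  obtain ⟨U, hx, σ, g, h, -⟩ := H x
  refine ⟨σ.left (resPt U x hx), ?_⟩
  rw [← comp_left_apply, h, inc_resPt]

include H in
-- Over U the section σ is a right inverse of π, so σ^* recovers a function from its pull-back.
lemma injective_of_local (V : X.left.Opens) : Function.Injective (π.left.app V) := by
  intro a b hab
  refine section_ext fun x hx => ?_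
  obtain ⟨U₀, hxU₀, hU₀⟩ := H x
  obtain ⟨σ, g, h, -⟩ := hU₀.mono (V := U₀ ⊓ V) inf_le_left
  refine ⟨U₀ ⊓ V, inf_le_right, ⟨hxU₀, hx⟩, ?_⟩
  apply (appLE_ι_bijective (U₀ ⊓ V) (by simp)).1
  rw [appLE_map_apply, appLE_map_apply]
  have e : (σ ≫ π).left = (U₀ ⊓ V).ι := congrArg Over.Hom.left h
  have e' : ⊤ ≤ (σ ≫ π).left ⁻¹ᵁ V := by rw [e]; exact fun p _ => p.2.2
  have h1 := appLE_of_eq e (U := V) (V := ⊤) e' a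
  have h2 := appLE_of_eq e (U := V) (V := ⊤) e' b
  refine h1.symm.trans (Eq.trans ?_ h2)
  have h3 (c) := appLE_appLE σ.left π.left (U := V) (V := π.left ⁻¹ᵁ V) (W := ⊤) le_rfl e' c
  refine (h3 a).symm.trans (Eq.trans ?_ (h3 b))
  rw [← Scheme.Hom.app_eq_appLE, hab]

include H in
lemma isQuotientMap_of_local : Topology.IsQuotientMap π.left := by
  refine (Topology.isQuotientMap_iff _).2 ⟨?_, surjective_of_local H⟩
  refine Topology.isCoinducing_iff.2 fun s => ⟨fun hs => ?_, fun hs => hs.preimage π.left.continuous⟩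
  rw [isOpen_iff_forall_mem_open]
  intro x hx
  obtain ⟨U, hxU, σ, g, h, -⟩ := H x
  have h1 : σ.left ⁻¹' (π.left ⁻¹' s) = (inc X U).left ⁻¹' s := by rw [← h]; rfl
  have h2 : IsOpen ((inc X U).left ⁻¹' s) := h1 ▸ hs.preimage σ.left.continuous
  refine ⟨U.ι '' ((inc X U).left ⁻¹' s), ?_, U.ι.isOpenEmbedding.isOpenMap _ h2, ?_⟩
  · rintro _ ⟨p, hp, rfl⟩
    exact hp
  · exact ⟨resPt U x hxU, hx, rfl⟩

include H in
-- The function on the base is σ^* f. As z is the translate of σ(π(z)) by g(z), invariance of f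
-- gives π^* σ^* f = f; the local functions glue because pull-back along π is injective.
lemma functions_of_local (V : X.left.Opens) (f : Γ(Z.left, π.left ⁻¹ᵁ V))
    (e₁ : ((snd G Z).left ≫ π.left) ⁻¹ᵁ V ≤ (act G Z).left ⁻¹ᵁ π.left ⁻¹ᵁ V)
    (hf : (act G Z).left.appLE (π.left ⁻¹ᵁ V) (((snd G Z).left ≫ π.left) ⁻¹ᵁ V) e₁ f =
      (snd G Z).left.appLE (π.left ⁻¹ᵁ V) (((snd G Z).left ≫ π.left) ⁻¹ᵁ V) le_rfl f) :
    ∃ a, π.left.app V a = f := by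
  -- An invariant function has the same pull-back under two S-valued points in the same orbit.
  have inv : ∀ {S : Over (Spec (.of k))} (p q : S ⟶ Z) (g : S ⟶ G), p = actPt g q →
      ∀ (e : ⊤ ≤ p.left ⁻¹ᵁ π.left ⁻¹ᵁ V) (e' : ⊤ ≤ q.left ⁻¹ᵁ π.left ⁻¹ᵁ V),
      p.left.appLE (π.left ⁻¹ᵁ V) ⊤ e f = q.left.appLE (π.left ⁻¹ᵁ V) ⊤ e' f := by
    rintro S _ q g rfl e e'
    have h1 : (actPt g q).left = (lift g q).left ≫ (act G Z).left := rfl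
    have h2 : q.left = (lift g q).left ≫ (snd G Z).left := by rw [← Over.comp_left, lift_snd]
    have e'' : ⊤ ≤ (lift g q).left ⁻¹ᵁ ((snd G Z).left ≫ π.left) ⁻¹ᵁ V := by
      rw [h2] at e'; exact e'
    refine (appLE_of_eq h1 e f).trans ?_
    refine (appLE_appLE _ _ e₁ e'' f).symm.trans ?_
    refine (congrArg _ hf).trans ?_
    have e₂ : ((snd G Z).left ≫ π.left) ⁻¹ᵁ V ≤ (snd G Z).left ⁻¹ᵁ π.left ⁻¹ᵁ V := le_rfl
    refine (appLE_appLE _ _ e₂ e'' f).trans ?_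
    exact (appLE_of_eq h2 e' f).symm
  have key : ∀ x : V, ∃ (U : X.left.Opens) (hU : U ≤ V) (a : Γ(X.left, U)), x.1 ∈ U ∧
      π.left.app U a = Z.left.presheaf.map (homOfLE fun _ h => hU h).op f := by
    rintro ⟨x, hx⟩
    obtain ⟨U₀, hxU₀, hU₀⟩ := H x
    obtain ⟨σ, g, h, h'⟩ := hU₀.mono (V := U₀ ⊓ V) inf_le_left
    generalize hU : U₀ ⊓ V = U at *
    have hUV : U ≤ V := hU ▸ inf_le_right
    have e2 : (σ ≫ π).left = U.ι := congrArg Over.Hom.left h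
    have e3 : ⊤ ≤ (σ ≫ π).left ⁻¹ᵁ V := by rw [e2]; exact fun p _ => hUV p.2
    have e4 : ⊤ ≤ σ.left ⁻¹ᵁ (π.left ⁻¹ᵁ V) := e3
    obtain ⟨a, ha⟩ := (appLE_ι_bijective U (by simp)).2 (σ.left.appLE _ ⊤ e4 f)
    refine ⟨U, hUV, a, hU ▸ ⟨hxU₀, hx⟩, ?_⟩
    apply (appLE_ι_bijective (π.left ⁻¹ᵁ U) (by simp)).1
    have e5 : ⊤ ≤ (inc Z (π.left ⁻¹ᵁ U)).left ⁻¹ᵁ π.left ⁻¹ᵁ V := fun p _ => hUV p.2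
    have e6 : (resMap π U).left ≫ U.ι = (π.left ⁻¹ᵁ U).ι ≫ π.left :=
      congrArg Over.Hom.left (resMap_inc π U)
    have e7 : ⊤ ≤ (resMap π U ≫ σ).left ⁻¹ᵁ π.left ⁻¹ᵁ V := fun p _ => e4 trivial
    have e8 : ⊤ ≤ (π.left ⁻¹ᵁ U).ι ⁻¹ᵁ π.left ⁻¹ᵁ U := fun p _ => p.2
    have e9 : ⊤ ≤ ((resMap π U).left ≫ U.ι) ⁻¹ᵁ U := by rw [e6]; exact e8
    have e10 : (⊤ : U.toScheme.Opens) ≤ U.ι ⁻¹ᵁ U := fun p _ => p.2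
    have e11 : π.left ⁻¹ᵁ U ≤ π.left ⁻¹ᵁ V := fun _ h => hUV h
    have c1 := appLE_map_apply (π.left ⁻¹ᵁ U).ι e11 e8 f
    have c2 := inv _ (resMap π U ≫ σ) g h'.symm e5 e7
    have e12 : (⊤ : (res Z (π.left ⁻¹ᵁ U)).left.Opens) ≤ (resMap π U).left ⁻¹ᵁ ⊤ := le_top
    have c3 := appLE_appLE (resMap π U).left σ.left e4 e12 f
    have c4 := appLE_appLE (π.left ⁻¹ᵁ U).ι π.left (U := U) le_rfl e8 a
    have c5 := appLE_of_eq e6 e9 a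
    have c6 := appLE_appLE (resMap π U).left U.ι e10 e12 a
    rw [Scheme.Hom.app_eq_appLE]
    refine c4.trans (c5.symm.trans (c6.symm.trans ?_))
    refine (congrArg _ ha).trans ?_
    exact c3.trans (c2.symm.trans c1.symm)
  choose U hUV a hx ha using key
  obtain ⟨s, hs, -⟩ := X.left.sheaf.existsUnique_gluing' U V (fun i => homOfLE (hUV i))
    (fun x hxV => TopologicalSpace.Opens.mem_iSup.2 ⟨⟨x, hxV⟩, hx ⟨x, hxV⟩⟩) a (by
      intro i j
      apply injective_of_local H (U i ⊓ U j)
      change π.left.app _ (X.left.presheaf.map (homOfLE inf_le_left).op (a i)) =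
        π.left.app _ (X.left.presheaf.map (homOfLE inf_le_right).op (a j))
      have i₁ : π.left ⁻¹ᵁ (U i ⊓ U j) ≤ π.left ⁻¹ᵁ U i := fun _ h => h.1
      have i₂ : π.left ⁻¹ᵁ (U i ⊓ U j) ≤ π.left ⁻¹ᵁ U j := fun _ h => h.2
      have n (i' : V) (l : U i ⊓ U j ≤ U i') (l' : π.left ⁻¹ᵁ (U i ⊓ U j) ≤ π.left ⁻¹ᵁ U i') :
          π.left.app (U i ⊓ U j) (X.left.presheaf.map (homOfLE l).op (a i')) =
            Z.left.presheaf.map (homOfLE l').op (π.left.app (U i') (a i')) := by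
        rw [Scheme.Hom.app_eq_appLE, Scheme.Hom.app_eq_appLE]
        exact (appLE_map_apply π.left l le_rfl (a i')).trans
          (map_appLE_apply π.left l' le_rfl (a i')).symm
      rw [n i inf_le_left i₁, n j inf_le_right i₂, ha, ha]
      rw [← ConcreteCategory.comp_apply, ← ConcreteCategory.comp_apply, ← Functor.map_comp,
        ← Functor.map_comp]
      rfl)
  refine ⟨s, section_ext fun z hz => ?_⟩
  refine ⟨π.left ⁻¹ᵁ U ⟨π.left z, hz⟩, fun _ h => hUV _ h, hx ⟨π.left z, hz⟩, ?_⟩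
  rw [← ha, ← hs, Scheme.Hom.app_eq_appLE, Scheme.Hom.app_eq_appLE]
  refine (map_appLE_apply π.left _ le_rfl s).trans ?_
  exact (appLE_map_apply π.left (hUV _) le_rfl s).symm

include H in
-- A point q of Z ×_X Z is a pair of points of Z over the residue field of q, with a common image in
-- U. Both are translates, by g₁ and g₂, of the same point of the section, so g₁ g₂⁻¹ carries the
-- second to the first over that field.
lemma orbits_of_local (w : (act G Z).left ≫ π.left = (snd G Z).left ≫ π.left) :
    Surjective (Limits.pullback.lift (f := π.left) (g := π.left)
      (act G Z).left (snd G Z).left w) := by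
  refine ⟨fun q => ?_⟩
  let P := Limits.pullback π.left π.left
  let S : Over (Spec (.of k)) := Over.mk (P.fromSpecResidueField q ≫
    Limits.pullback.fst π.left π.left ≫ Z.hom)
  have hc := Limits.pullback.condition (f := π.left) (g := π.left)
  let y₁ : S ⟶ Z := Over.homMk (P.fromSpecResidueField q ≫ Limits.pullback.fst π.left π.left)
    (Category.assoc _ _ _)
  let y₂ : S ⟶ Z := Over.homMk (P.fromSpecResidueField q ≫ Limits.pullback.snd π.left π.left)
    (by
      change _ = P.fromSpecResidueField q ≫ Limits.pullback.fst π.left π.left ≫ Z.hom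
      rw [← Over.w π, reassoc_of% hc, Category.assoc])
  have hy : y₁ ≫ π = y₂ ≫ π := by
    ext1
    change (P.fromSpecResidueField q ≫ Limits.pullback.fst π.left π.left) ≫ π.left =
      (P.fromSpecResidueField q ≫ Limits.pullback.snd π.left π.left) ≫ π.left
    rw [Category.assoc, Category.assoc, hc]
  obtain ⟨U, hxU, σ, g, h, h'⟩ := H (π.left (Limits.pullback.fst π.left π.left q))
  have m₁ : ∀ p, y₁.left p ∈ π.left ⁻¹ᵁ U := by
    intro p
    have : y₁.left p = Limits.pullback.fst π.left π.left q :=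
      congrArg (Limits.pullback.fst π.left π.left) (Scheme.fromSpecResidueField_apply q p)
    rw [this]; exact hxU
  have m₂ : ∀ p, y₂.left p ∈ π.left ⁻¹ᵁ U := by
    intro p
    change (y₂ ≫ π).left p ∈ U
    rw [← hy]; exact m₁ p
  have key : ∀ (y : S ⟶ Z) (m : ∀ p, y.left p ∈ π.left ⁻¹ᵁ U) (m' : ∀ p, (y ≫ π).left p ∈ U),
      actPt (liftRes y m ≫ g) (liftRes (y ≫ π) m' ≫ σ) = y := by
    intro y m m'
    have := congrArg (liftRes y m ≫ ·) h'
    simp only [comp_actPt, liftRes_inc] at this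
    refine Eq.trans (congrArg (actPt _) ?_) this
    rw [← Category.assoc, liftRes_resMap π U y m m']
  have n₁ : ∀ p, (y₁ ≫ π).left p ∈ U := m₁
  have n₂ : ∀ p, (y₂ ≫ π).left p ∈ U := m₂
  have e : liftRes (y₂ ≫ π) n₂ = liftRes (y₁ ≫ π) n₁ := liftRes_congr hy.symm _ _
  have k₁ := key y₁ m₁ n₁
  have k₂ := key y₂ m₂ n₂
  rw [e] at k₂
  set g₁ := liftRes y₁ m₁ ≫ g
  set g₂ := liftRes y₂ m₂ ≫ g
  have k₃ : actPt (g₁ * g₂⁻¹) y₂ = y₁ := by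
    rw [← k₂, ← mul_actPt, inv_mul_cancel_right, k₁]
  have k₄ : (lift (g₁ * g₂⁻¹) y₂).left ≫ Limits.pullback.lift (f := π.left) (g := π.left)
      (act G Z).left (snd G Z).left w = P.fromSpecResidueField q := by
    apply Limits.pullback.hom_ext
    · rw [Category.assoc, Limits.pullback.lift_fst]
      exact congrArg Over.Hom.left k₃
    · rw [Category.assoc, Limits.pullback.lift_snd]
      exact congrArg Over.Hom.left (lift_snd (g₁ * g₂⁻¹) y₂)
  let p : Spec (P.residueField q) := default
  refine ⟨(lift (g₁ * g₂⁻¹) y₂).left p, ?_⟩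
  have k₅ := congrArg (fun f => f p) k₄
  exact k₅.trans (Scheme.fromSpecResidueField_apply q p)

include hπ H in
/-- An invariant morphism that locally has sections that meet every orbit is a geometric
quotient. -/
theorem isGeometricQuotient_of_local : IsGeometricQuotient G π where
  invariant := congrArg Over.Hom.left hπ
  surjective := ⟨surjective_of_local H⟩
  orbits := orbits_of_local H _
  isQuotientMap := isQuotientMap_of_local H
  injective := injective_of_local H
  functions U f := by
    constructor
    · rintro ⟨a, rfl⟩
      have e : ((snd G Z).left ≫ π.left) ⁻¹ᵁ U ≤ ((act G Z).left ≫ π.left) ⁻¹ᵁ U := by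
        rw [show (act G Z).left ≫ π.left = (snd G Z).left ≫ π.left from
          congrArg Over.Hom.left hπ]
      rw [Scheme.Hom.app_eq_appLE]
      refine (appLE_appLE (act G Z).left π.left le_rfl e a).trans ?_
      refine (appLE_of_eq (congrArg Over.Hom.left hπ) e a).trans ?_
      exact (appLE_appLE (snd G Z).left π.left le_rfl le_rfl a).symm
    · exact functions_of_local H U f _

end Quotient

/-! ### Morphisms from homomorphisms of function fields -/

section Extend

variable {S X B : Scheme.{u}} [IsIntegral S] [IsIntegral X]

/-- The morphism `h`, defined on an open set, induces the homomorphism `φ` of function fields. -/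
def Represents (φ : X.functionField →+* S.functionField) {U : S.Opens} (hU : genericPoint S ∈ U)
    (h : U.toScheme ⟶ X) : Prop :=
  U.fromSpecStalkOfMem _ hU ≫ h =
    Spec.map (CommRingCat.ofHom φ) ≫ X.fromSpecStalk (genericPoint X)

lemma isDominant_of_injective_of_mem {W Y S : Scheme.{u}} (j : W ⟶ Y) (o : Y ⟶ S)
    [IsOpenImmersion o] (h : IsDominant (j ≫ o)) : IsDominant j := by
  refine ⟨fun y => ?_⟩
  have h1 : Dense (o ⁻¹' Set.range (j ≫ o)) :=
    h.denseRange.preimage o.isOpenEmbedding.isOpenMap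
  refine Dense.mono ?_ h1 y
  rintro _ ⟨w, hw⟩
  exact ⟨w, o.isOpenEmbedding.injective hw⟩

instance (U : S.Opens) (hU : genericPoint S ∈ U) :
    IsDominant (U.fromSpecStalkOfMem _ hU) := by
  apply isDominant_of_injective_of_mem _ U.ι
  rw [Scheme.Opens.fromSpecStalkOfMem_ι]
  infer_instance

/-- On the overlap the two morphisms agree at the generic point; the overlap is reduced and the
target separated, so they agree there. This is the gluing condition. -/
lemma Represents.ext {φ : X.functionField →+* S.functionField} {U V : S.Opens}
    {hU : genericPoint S ∈ U} {hV : genericPoint S ∈ V} {f : U.toScheme ⟶ X} {g : V.toScheme ⟶ X}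
    (hf : Represents φ hU f) (hg : Represents φ hV g) (p : S ⟶ B) (q : X ⟶ B) [IsSeparated q]
    (hf' : f ≫ q = U.ι ≫ p) (hg' : g ≫ q = V.ι ≫ p) :
    Limits.pullback.fst U.ι V.ι ≫ f = Limits.pullback.snd U.ι V.ι ≫ g := by
  let j : Spec (S.presheaf.stalk (genericPoint S)) ⟶ Limits.pullback U.ι V.ι :=
    Limits.pullback.lift (U.fromSpecStalkOfMem _ hU) (V.fromSpecStalkOfMem _ hV) (by
      rw [Scheme.Opens.fromSpecStalkOfMem_ι, Scheme.Opens.fromSpecStalkOfMem_ι])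
  have hj : IsDominant j := by
    apply isDominant_of_injective_of_mem j (Limits.pullback.fst U.ι V.ι ≫ U.ι)
    rw [Limits.pullback.lift_fst_assoc, Scheme.Opens.fromSpecStalkOfMem_ι]
    infer_instance
  have : AlgebraicGeometry.IsReduced (Limits.pullback U.ι V.ι) :=
    isReduced_of_isOpenImmersion (Limits.pullback.fst U.ι V.ι ≫ U.ι)
  refine ext_of_isDominant_of_isSeparated q ?_ j ?_
  · rw [Category.assoc, Category.assoc, hf', hg', Limits.pullback.condition_assoc]
  · rw [Limits.pullback.lift_fst_assoc, Limits.pullback.lift_snd_assoc]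
    exact hf.trans hg.symm

/-- A homomorphism of function fields that maps the functions on an affine open set `V` to functions
on `U` is induced by a morphism `U ⟶ V`. -/
lemma exists_represents (φ : X.functionField →+* S.functionField) {U : S.Opens}
    (hU : genericPoint S ∈ U) {V : X.Opens} (hV : IsAffineOpen V) (hgV : genericPoint X ∈ V)
    (H : ∀ f : Γ(X, V), ∀ y ∈ U, φ (toK V hgV f) ∈ regularAt y) :
    ∃ h : U.toScheme ⟶ X, Represents φ hU h ∧ ∀ y, h y ∈ V := by
  have H' : ∀ f : Γ(X, V), φ (toK V hgV f) ∈ (toK U hU).range := fun f => by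
    obtain ⟨a, ha⟩ := exists_toK_eq hU (H f)
    exact ⟨a, ha⟩
  let e := RingEquiv.ofBijective (toK U hU).rangeRestrict
    ⟨fun a b hab => toK_injective U hU (congrArg Subtype.val hab), (toK U hU).rangeRestrict_surjective⟩
  let ψ : Γ(X, V) →+* Γ(S, U) := (e.symm : _ →+* Γ(S, U)).comp
    ((φ.comp (toK V hgV)).codRestrict (toK U hU).range H')
  have hψ : (toK U hU).comp ψ = φ.comp (toK V hgV) := by
    ext f
    exact congrArg Subtype.val (e.apply_symm_apply ⟨_, H' f⟩)
  refine ⟨U.toSpecΓ ≫ Spec.map (CommRingCat.ofHom ψ) ≫ hV.fromSpec, ?_, fun y => ?_⟩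
  · have h1 : CommRingCat.ofHom ψ ≫ S.presheaf.germ U _ hU =
        X.presheaf.germ V _ hgV ≫ CommRingCat.ofHom φ := by
      ext f
      exact congr($hψ f)
    rw [Represents, ← Category.assoc, Scheme.Opens.fromSpecStalkOfMem_toSpecΓ,
      ← hV.fromSpecStalk_eq_fromSpecStalk hgV, IsAffineOpen.fromSpecStalk]
    rw [← Spec.map_comp_assoc, ← Spec.map_comp_assoc]
    exact congrArg (fun t => Spec.map t ≫ hV.fromSpec) h1
  · have := hV.range_fromSpec
    exact this.le ⟨(U.toSpecΓ ≫ Spec.map (CommRingCat.ofHom ψ)) y, rfl⟩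

lemma isDominant_of_represents {φ : X.functionField →+* S.functionField} {f : S ⟶ X}
    (h : S.fromSpecStalk _ ≫ f =
      Spec.map (CommRingCat.ofHom φ) ≫ X.fromSpecStalk (genericPoint X)) :
    IsDominant f ∧ ∀ _ : IsDominant f, ∀ a, ff f a = φ a := by
  have hf : IsDominant f := by
    have h0 : IsDominant (S.fromSpecStalk (genericPoint S) ≫ f) := by
      rw [h]
      let K : Type u := X.functionField
      -- The spectrum of a field is a single point.
      have : Surjective (Spec.map (CommRingCat.ofHom φ)) := by
        refine ⟨fun p => ⟨(⊥ : PrimeSpectrum S.functionField), ?_⟩⟩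
        exact Subsingleton.elim (α := PrimeSpectrum X.functionField) _ _
      infer_instance
    exact IsDominant.of_comp (S.fromSpecStalk (genericPoint S)) f
  refine ⟨hf, fun _ a => ?_⟩
  rw [fromSpecStalk_comp, cancel_mono] at h
  exact congr($(Spec.map_injective h).hom a)

/-- A homomorphism `φ` of function fields is induced by a morphism `S ⟶ X` if, locally on `S`, it
maps the functions on some affine open set to regular functions. -/
theorem exists_hom_of_functionField [IsAffine B] (p : S ⟶ B) (q : X ⟶ B) [IsSeparated q]
    (φ : X.functionField →+* S.functionField)
    (hφ : S.fromSpecStalk _ ≫ p =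
      Spec.map (CommRingCat.ofHom φ) ≫ X.fromSpecStalk (genericPoint X) ≫ q)
    (H : ∀ y : S, ∃ U : S.Opens, y ∈ U ∧ ∃ (V : X.Opens) (_ : IsAffineOpen V)
      (hV : genericPoint X ∈ V), ∀ f : Γ(X, V), ∀ y ∈ U, φ (toK V hV f) ∈ regularAt y) :
    ∃ f : S ⟶ X, f ≫ q = p ∧ (IsDominant f ∧ ∀ _ : IsDominant f, ∀ a, ff f a = φ a) ∧
      ∀ (U : S.Opens) (V : X.Opens) (_ : IsAffineOpen V) (hV : genericPoint X ∈ V),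
        (∀ f : Γ(X, V), ∀ y ∈ U, φ (toK V hV f) ∈ regularAt y) → ∀ y ∈ U, f y ∈ V := by
  have comp : ∀ {U : S.Opens} {hU : genericPoint S ∈ U} {h : U.toScheme ⟶ X},
      Represents φ hU h → h ≫ q = U.ι ≫ p := by
    intro U hU h hh
    refine ext_of_isDominant_of_isSeparated (X := U.toScheme) (Limits.terminal.from B)
      (Limits.terminal.hom_ext _ _) (U.fromSpecStalkOfMem _ hU) ?_
    have h1 := congrArg (· ≫ q) hh
    simp only [Category.assoc] at h1
    rw [h1, ← hφ, ← Category.assoc, Scheme.Opens.fromSpecStalkOfMem_ι]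
  choose U hyU V hV hgV hreg using H
  choose h hh hhV using fun y => exists_represents φ (genericPoint_mem (hyU y)) (hV y) (hgV y)
    (hreg y)
  let 𝒰 : S.OpenCover := S.openCoverOfIsOpenCover U (by
    rw [TopologicalSpace.IsOpenCover, eq_top_iff]
    exact fun y _ => TopologicalSpace.Opens.mem_iSup.2 ⟨y, hyU y⟩)
  let f : S ⟶ X := 𝒰.glueMorphisms h fun x y =>
    (hh x).ext (hh y) p q (comp (hh x)) (comp (hh y))
  have hf : ∀ y, (U y).ι ≫ f = h y := 𝒰.ι_glueMorphisms h _
  have hfp : f ≫ q = p := by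
    refine 𝒰.hom_ext _ _ fun y => ?_
    have h1 (y : S) : (U y).ι ≫ f ≫ q = (U y).ι ≫ p := by rw [reassoc_of% hf, comp (hh y)]
    exact h1 y
  have hrep : S.fromSpecStalk _ ≫ f =
      Spec.map (CommRingCat.ofHom φ) ≫ X.fromSpecStalk (genericPoint X) := by
    let y : S := genericPoint S
    rw [← (U y).fromSpecStalkOfMem_ι _ (hyU y), Category.assoc, hf]
    exact hh y
  refine ⟨f, hfp, isDominant_of_represents hrep, fun W T hT hgT hW y hy => ?_⟩
  -- `W` and `T` need not belong to the chosen cover: the morphism `W ⟶ T` built from `φ` coincides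
  -- with the restriction of `f`, since both represent `φ`.
  obtain ⟨g, hg, hgT'⟩ := exists_represents φ (genericPoint_mem hy) hT hgT hW
  have h2 : W.ι ≫ f = g := by
    refine ext_of_isDominant_of_isSeparated (X := W.toScheme) q ?_
      (W.fromSpecStalkOfMem _ (genericPoint_mem hy)) ?_
    · rw [Category.assoc, hfp, comp hg]
    · rw [← Category.assoc, Scheme.Opens.fromSpecStalkOfMem_ι, hrep]
      exact hg.symm
  have h3 := hgT' ⟨y, hy⟩
  rw [← h2] at h3
  exact h3

end Extend

section Over

variable {k : Type u} [Field k] {S X : Over (Spec (.of k))} [IsIntegral S.left]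
  [IsIntegral X.left]

lemma fromSpecStalk_comp_hom (S : Over (Spec (.of k))) [IsIntegral S.left] :
    S.left.fromSpecStalk (genericPoint S.left) ≫ S.hom =
      Spec.map (CommRingCat.ofHom ((rat S).comp (scalar S))) := by
  have : IsAffine (Spec (CommRingCat.of k)) := inferInstance
  refine ext_of_isAffine ?_
  ext c
  obtain ⟨c, rfl⟩ := (ConcreteCategory.bijective_of_isIso (Scheme.ΓSpecIso (.of k)).inv).2 c
  refine Eq.trans ?_ (appTop_SpecMap (CommRingCat.ofHom ((rat S).comp (scalar S))) c).symm
  rw [Scheme.Hom.comp_appTop, Scheme.fromSpecStalk_appTop]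
  rfl

/-- A homomorphism `φ` of function fields over `k` is induced by a morphism `S ⟶ X` if, locally on
`S`, it maps the functions on some affine open set to regular functions. -/
theorem exists_hom_over_of_functionField [IsSeparated X.hom]
    (φ : X.left.functionField →+* S.left.functionField)
    (hφ : ∀ c, φ (rat X (scalar X c)) = rat S (scalar S c))
    (H : ∀ y : S.left, ∃ U : S.left.Opens, y ∈ U ∧ ∃ (V : X.left.Opens) (_ : IsAffineOpen V)
      (hV : genericPoint X.left ∈ V), ∀ f : Γ(X.left, V), ∀ y ∈ U,
        φ (toK V hV f) ∈ regularAt y) :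
    ∃ f : S ⟶ X, (IsDominant f.left ∧ ∀ _ : IsDominant f.left, ∀ a, ff f.left a = φ a) ∧
      ∀ (U : S.left.Opens) (V : X.left.Opens) (_ : IsAffineOpen V)
        (hV : genericPoint X.left ∈ V),
        (∀ f : Γ(X.left, V), ∀ y ∈ U, φ (toK V hV f) ∈ regularAt y) →
          ∀ y ∈ U, f.left y ∈ V := by
  obtain ⟨f, h1, h2, h3⟩ := exists_hom_of_functionField S.hom X.hom φ (by
    rw [fromSpecStalk_comp_hom, fromSpecStalk_comp_hom, ← Spec.map_comp]
    congr 1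
    ext c
    exact (hφ c).symm) H
  exact ⟨Over.homMk f h1, h2, h3⟩

variable {G Z : Over (Spec (.of k))} [GrpObj G] [ModObj G Z]

/-- The unit section splits the action. Surjectivity gives dominance, so rational functions can be
pulled back along the action, and likewise along the projection. -/
instance : Surjective (act G Z).left := by
  have h : lift (1 : Z ⟶ G) (𝟙 Z) ≫ act G Z = 𝟙 Z := one_actPt (𝟙 Z)
  have h' : Surjective ((lift (1 : Z ⟶ G) (𝟙 Z)).left ≫ (act G Z).left) := by
    rw [← Over.comp_left, h]
    exact inferInstanceAs (Surjective (𝟙 Z.left))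
  exact Surjective.of_comp (lift (1 : Z ⟶ G) (𝟙 Z)).left _

instance (G Z : Over (Spec (.of k))) [GrpObj G] : Surjective (snd G Z).left := by
  have h : lift (1 : Z ⟶ G) (𝟙 Z) ≫ snd G Z = 𝟙 Z := lift_snd _ _
  have h' : Surjective ((lift (1 : Z ⟶ G) (𝟙 Z)).left ≫ (snd G Z).left) := by
    rw [← Over.comp_left, h]
    exact inferInstanceAs (Surjective (𝟙 Z.left))
  exact Surjective.of_comp (lift (1 : Z ⟶ G) (𝟙 Z)).left _

instance (G : Over (Spec (.of k))) {Z X : Over (Spec (.of k))} (f : Z ⟶ X)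
    [Surjective f.left] : Surjective (G ◁ f).left := by
  rw [Over.whiskerLeft_left]
  have : MorphismProperty.IsStableUnderComposition @Surjective :=
    ⟨fun f g (_ : Surjective f) (_ : Surjective g) => inferInstanceAs (Surjective (f ≫ g))⟩
  exact MorphismProperty.pullbackMap (P := @Surjective) (inferInstanceAs (Surjective (𝟙 G.left)))
    ‹Surjective f.left› (Category.id_comp _).symm (Over.w f).symm

end Over

/-! ### Sections of Cartier divisors and their extension -/

section Sections

variable {X : Scheme.{u}} [IsIntegral X] {D E : CartierDivisor X} {x : X} {s t : X.functionField}

lemma isSectionAt_iff_mem {d : X.functionFieldˣ}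
    (hd : D.germ x = (d : X.functionFieldˣ ⧸ unitsAt X x)) :
    IsSectionAt D x s ↔ s * d ∈ regularAt x := isSectionAt_iff hd

lemma isGeneratorAt_iff_isUnitAt {d : X.functionFieldˣ}
    (hd : D.germ x = (d : X.functionFieldˣ ⧸ unitsAt X x)) :
    IsGeneratorAt D x s ↔ IsUnitAt x (s * d) := isGeneratorAt_iff hd

lemma germ_mul_eq {d e : X.functionFieldˣ}
    (hd : D.germ x = (d : X.functionFieldˣ ⧸ unitsAt X x))
    (he : E.germ x = (e : X.functionFieldˣ ⧸ unitsAt X x)) :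
    (D * E).germ x = ((d * e : X.functionFieldˣ) : X.functionFieldˣ ⧸ unitsAt X x) := by
  rw [CartierDivisor.germ_mul, hd, he]; rfl

lemma germ_pow_eq {d : X.functionFieldˣ}
    (hd : D.germ x = (d : X.functionFieldˣ ⧸ unitsAt X x)) (n : ℕ) :
    (D ^ n).germ x = ((d ^ n : X.functionFieldˣ) : X.functionFieldˣ ⧸ unitsAt X x) := by
  induction n with
  | zero => rw [pow_zero, pow_zero]; rfl
  | succ n ih => rw [pow_succ, pow_succ, germ_mul_eq ih hd]

lemma IsGeneratorAt.isSectionAt (h : IsGeneratorAt D x s) : IsSectionAt D x s := by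
  obtain ⟨d, hd⟩ := exists_rep D x
  exact (isSectionAt_iff_mem hd).2 ((isGeneratorAt_iff_isUnitAt hd).1 h).mem

lemma IsGeneratorAt.ne_zero (h : IsGeneratorAt D x s) : s ≠ 0 := by
  obtain ⟨d, hd⟩ := exists_rep D x
  exact left_ne_zero_of_mul ((isGeneratorAt_iff_isUnitAt hd).1 h).ne_zero

lemma IsGeneratorAt.mul (hs : IsGeneratorAt D x s) (ht : IsGeneratorAt E x t) :
    IsGeneratorAt (D * E) x (s * t) := by
  obtain ⟨d, hd⟩ := exists_rep D x
  obtain ⟨e, he⟩ := exists_rep E x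
  rw [isGeneratorAt_iff_isUnitAt hd] at hs
  rw [isGeneratorAt_iff_isUnitAt he] at ht
  rw [isGeneratorAt_iff_isUnitAt (germ_mul_eq hd he), Units.val_mul, mul_mul_mul_comm]
  exact hs.mul ht

lemma isGeneratorAt_one : IsGeneratorAt (1 : CartierDivisor X) x 1 := by
  rw [isGeneratorAt_iff_isUnitAt (d := 1) rfl, Units.val_one, mul_one]
  exact isUnitAt_one

lemma isSectionAt_one : IsSectionAt (1 : CartierDivisor X) x s ↔ s ∈ regularAt x := by
  rw [isSectionAt_iff_mem (d := 1) rfl, Units.val_one, mul_one]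

lemma isGeneratorAt_one_iff : IsGeneratorAt (1 : CartierDivisor X) x s ↔ IsUnitAt x s := by
  rw [isGeneratorAt_iff_isUnitAt (d := 1) rfl, Units.val_one, mul_one]

lemma IsGeneratorAt.pow (hs : IsGeneratorAt D x s) (n : ℕ) : IsGeneratorAt (D ^ n) x (s ^ n) := by
  induction n with
  | zero => rw [pow_zero, pow_zero]; exact isGeneratorAt_one
  | succ n ih => rw [pow_succ, pow_succ]; exact ih.mul hs

lemma IsSectionAt.pow (hs : IsSectionAt D x s) (n : ℕ) : IsSectionAt (D ^ n) x (s ^ n) := by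
  induction n with
  | zero => rw [pow_zero, pow_zero]; exact isGeneratorAt_one.isSectionAt
  | succ n ih => rw [pow_succ, pow_succ]; exact ih.mul hs

/-- If a product of sections does not vanish, then neither do the factors. -/
lemma IsGeneratorAt.of_mul (h : IsGeneratorAt (D * E) x (s * t)) (hs : IsSectionAt D x s)
    (ht : IsSectionAt E x t) : IsGeneratorAt D x s := by
  obtain ⟨d, hd⟩ := exists_rep D x
  obtain ⟨e, he⟩ := exists_rep E x
  rw [isSectionAt_iff_mem hd] at hs
  rw [isSectionAt_iff_mem he] at ht
  rw [isGeneratorAt_iff_isUnitAt (germ_mul_eq hd he), Units.val_mul, mul_mul_mul_comm] at h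
  exact (isGeneratorAt_iff_isUnitAt hd).2 (h.of_mul hs ht)

lemma isOpen_isSectionAt (h : IsSectionAt D x s) :
    ∃ U : X.Opens, x ∈ U ∧ ∀ y ∈ U, IsSectionAt D y s := by
  obtain ⟨U, hxU, d, hd⟩ := D.exists_local x
  obtain ⟨a, ha⟩ := (isSectionAt_iff (hd x hxU)).1 h
  obtain ⟨W, hxW, b, hb⟩ := X.presheaf.exists_germ_eq a
  refine ⟨U ⊓ W, ⟨hxU, hxW⟩, fun y hy => (isSectionAt_iff_mem (hd y hy.1)).2 ?_⟩
  rw [← ha, ← hb, algebraMap_germ hxW]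
  exact toK_mem_regularAt hy.2 b _

lemma regularAt_genericPoint (f : X.functionField) : f ∈ regularAt (genericPoint X) := by
  obtain ⟨U, hU, b, rfl⟩ := X.presheaf.exists_germ_eq f
  exact toK_mem_regularAt hU b hU

lemma isUnitAt_genericPoint {f : X.functionField} (hf : f ≠ 0) : IsUnitAt (genericPoint X) f :=
  isUnitAt_iff.2 ⟨hf, regularAt_genericPoint _, regularAt_genericPoint _⟩

/-- A function on the complement of the zeros of `a` becomes regular after multiplication by a
power of `a`. -/
lemma exists_pow_mul_mem {V : X.Opens} (hV : IsAffineOpen V) (hg : genericPoint X ∈ V)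
    (a : Γ(X, V)) (f : X.functionField) (h : ∀ y ∈ X.basicOpen a, f ∈ regularAt y) :
    ∃ n, ∀ y ∈ V, f * toK V hg a ^ n ∈ regularAt y := by
  by_cases ha : a = 0
  · refine ⟨1, fun y _ => ?_⟩
    rw [ha, map_zero, zero_pow one_ne_zero, mul_zero]
    exact zero_mem _
  have hga : genericPoint X ∈ X.basicOpen a := by
    rw [← isUnitAt_toK_iff hg a hg]
    have h0 : toK V hg a ≠ 0 := (map_ne_zero_iff _ (toK_injective V hg)).2 ha
    exact isUnitAt_genericPoint h0
  obtain ⟨b, hb⟩ := exists_toK_eq hga h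
  have := hV.isLocalization_basicOpen a
  obtain ⟨⟨c, ⟨_, n, rfl⟩⟩, hc⟩ := IsLocalization.surj (Submonoid.powers a) b
  refine ⟨n, fun y hy => ?_⟩
  have h2 : toK V hg c = f * toK V hg a ^ n := by
    have h3 := congrArg (toK _ hga) hc
    have h4 (r : Γ(X, V)) : toK _ hga (algebraMap Γ(X, V) Γ(X, X.basicOpen a) r) = toK V hg r :=
      toK_map (X.basicOpen_le a) hga r
    rw [map_mul, h4, h4, hb, map_pow] at h3
    exact h3.symm
  rw [← h2]
  exact toK_mem_regularAt hy c hg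

/-- A section of `𝒪(D)` over the nonvanishing locus of a section `t` of `𝒪(E)` extends after
multiplication by a power of `t`. -/
lemma exists_isSectionAt_mul_pow {W : X.Opens} (hW : IsCompact (W : Set X))
    (ht : ∀ x ∈ W, IsSectionAt E x t)
    (hs : ∀ x ∈ W, IsGeneratorAt E x t → IsSectionAt D x s) :
    ∃ n : ℕ, ∀ m, n ≤ m → ∀ x ∈ W, IsSectionAt (D * E ^ m) x (s * t ^ m) := by
  have key : ∀ x ∈ W, ∃ V : X.Opens, x ∈ V ∧ ∃ n : ℕ, ∀ m, n ≤ m → ∀ y ∈ V,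
      IsSectionAt (D * E ^ m) y (s * t ^ m) := by
    intro x hx
    obtain ⟨U₁, hx₁, d, hd⟩ := D.exists_local x
    obtain ⟨U₂, hx₂, e, he⟩ := E.exists_local x
    -- On a small affine open set both divisors are principal, and the claim is about clearing
    -- denominators of one rational function.
    obtain ⟨V, hV, hxV, hVU⟩ := exists_isAffineOpen_mem_and_subset
      (x := x) (U := U₁ ⊓ U₂ ⊓ W) ⟨⟨hx₁, hx₂⟩, hx⟩
    have hg := genericPoint_mem hxV
    obtain ⟨a, ha⟩ := exists_toK_eq hg (f := t * e) fun y hy =>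
      (isSectionAt_iff_mem (he y (hVU hy).1.2)).1 (ht y (hVU hy).2)
    obtain ⟨n, hn⟩ := exists_pow_mul_mem hV hg a (s * d) (by
      intro y hy
      have hyV := X.basicOpen_le a hy
      rw [← isUnitAt_toK_iff hyV a hg, ha,
        ← isGeneratorAt_iff_isUnitAt (he y (hVU hyV).1.2)] at hy
      exact (isSectionAt_iff_mem (hd y (hVU hyV).1.1)).1 (hs y (hVU hyV).2 hy))
    refine ⟨V, hxV, n, fun m hm y hy => ?_⟩
    rw [isSectionAt_iff_mem (germ_mul_eq (hd y (hVU hy).1.1) (germ_pow_eq (he y (hVU hy).1.2) m))]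
    have h1 := Subring.mul_mem _ (hn y hy) (Subring.pow_mem _ (toK_mem_regularAt hy a hg) (m - n))
    rw [mul_assoc, ← pow_add, Nat.add_sub_cancel' hm, ha] at h1
    convert h1 using 1
    rw [Units.val_mul, Units.val_pow_eq_pow_val]
    ring
  choose! V hxV n hn using key
  -- The local claim holds for all exponents from `n` on, so the maximum over a finite subcover
  -- works everywhere.
  obtain ⟨T, hT⟩ := hW.elim_nhds_subcover' (fun x _ => (V x : Set X))
    (fun x hx => (V x).2.mem_nhds (hxV x hx))
  refine ⟨T.sup fun x => n x, fun m hm x hx => ?_⟩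
  obtain ⟨y, hyT, hy⟩ := Set.mem_iUnion₂.1 (hT hx)
  exact hn y.1 y.2 m ((Finset.le_sup (f := fun x : W => n x) hyT).trans hm) x hy

lemma mem_nonvanishing : x ∈ nonvanishing D s ↔ IsGeneratorAt D x s := Iff.rfl

lemma nonvanishing_pow (hs : ∀ x, IsSectionAt D x s) (n : ℕ) :
    nonvanishing (D ^ (n + 1)) (s ^ (n + 1)) = nonvanishing D s := by
  ext x
  refine ⟨fun h => ?_, fun h => h.pow (n + 1)⟩
  change IsGeneratorAt _ _ _ at h
  rw [pow_succ', pow_succ'] at h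
  exact h.of_mul (hs x) ((hs x).pow n)

variable {L : Type u} [CommGroup L]

/-- The affine ones among the nonvanishing loci of the sections of the divisors `δ a` cover. -/
def CoveredByAffine (δ : L →* CartierDivisor X) : Prop :=
  ∀ x, ∃ a, ∃ s ∈ globalSections (δ a),
    IsAffineOpen (nonvanishing (δ a) s) ∧ x ∈ nonvanishing (δ a) s

variable {δ : L →* CartierDivisor X} [CompactSpace X] (hδ : CoveredByAffine δ)

include hδ

/-- The affine nonvanishing loci form a basis of the topology. -/
lemma CoveredByAffine.exists_le {U : X.Opens} (hx : x ∈ U) :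
    ∃ a, ∃ t ∈ globalSections (δ a), IsAffineOpen (nonvanishing (δ a) t) ∧
      x ∈ nonvanishing (δ a) t ∧ nonvanishing (δ a) t ≤ U := by
  obtain ⟨a, s, hs, haff, hxs⟩ := hδ x
  obtain ⟨g, hgU, hxg⟩ := haff.exists_basicOpen_le ⟨x, hx⟩ hxs
  have hgen := genericPoint_mem hxs
  obtain ⟨n, hn⟩ := exists_isSectionAt_mul_pow (D := 1) (E := δ a) (t := s)
    (s := toK _ hgen g) (W := ⊤) isCompact_univ (fun x _ => hs x) (fun y _ hy =>
      isSectionAt_one.2 (toK_mem_regularAt (U := nonvanishing (δ a) s) hy g _))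
  -- One power of `s` more than needed for regularity: the additional factor makes the section
  -- vanish outside X_s, so that its nonvanishing locus is exactly that of `g` inside X_s.
  have hn1 := hn (n + 1) n.le_succ
  simp only [one_mul] at hn1
  have e : nonvanishing (δ (a ^ (n + 1))) (toK _ hgen g * s ^ (n + 1)) = X.basicOpen g := by
    ext y
    change IsGeneratorAt _ y _ ↔ _
    rw [map_pow]
    constructor
    · intro h
      have hn2 := hn n le_rfl y trivial
      rw [one_mul] at hn2
      have hy : IsGeneratorAt (δ a) y s := by
        rw [pow_succ', pow_succ', mul_left_comm] at h
        exact h.of_mul (hs y) hn2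
      have h3 : IsGeneratorAt (1 * δ a ^ (n + 1)) y (toK _ hgen g * s ^ (n + 1)) := by
        rwa [one_mul]
      exact (isUnitAt_toK_iff (U := nonvanishing (δ a) s) hy g hgen).1
        (isGeneratorAt_one_iff.1 (h3.of_mul
          (isSectionAt_one.2 (toK_mem_regularAt (U := nonvanishing (δ a) s) hy g _))
          ((hs y).pow _)))
    · intro h
      have hy : IsGeneratorAt (δ a) y s := X.basicOpen_le g h
      rw [← one_mul (δ a ^ (n + 1))]
      exact (isGeneratorAt_one_iff.2
        ((isUnitAt_toK_iff (U := nonvanishing (δ a) s) hy g hgen).2 h)).mul (hy.pow _)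
  refine ⟨a ^ (n + 1), _, fun y => ?_, e ▸ haff.basicOpen g, e ▸ hxg, e ▸ hgU⟩
  rw [map_pow]
  exact hn1 y trivial

/-- A section near a point extends after multiplication by a section that does not vanish at the
point. -/
lemma CoveredByAffine.exists_mul_mem {c : L} {f : X.functionField}
    (hf : IsSectionAt (δ c) x f) {U : X.Opens} (hx : x ∈ U) :
    ∃ a, ∃ t ∈ globalSections (δ a), IsAffineOpen (nonvanishing (δ a) t) ∧
      x ∈ nonvanishing (δ a) t ∧ nonvanishing (δ a) t ≤ U ∧
        f * t ∈ globalSections (δ (c * a)) := by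
  obtain ⟨V, hxV, hV⟩ := isOpen_isSectionAt hf
  obtain ⟨a, t, ht, haff, hxt, hle⟩ := hδ.exists_le (U := U ⊓ V) ⟨hx, hxV⟩
  obtain ⟨n, hn⟩ := exists_isSectionAt_mul_pow (D := δ c) (E := δ a) (t := t)
    (s := f) (W := ⊤) isCompact_univ (fun x _ => ht x) (fun y _ hy => hV y (hle hy).2)
  -- The exponent is positive, so passing to the power does not enlarge the nonvanishing locus.
  have e : nonvanishing (δ (a ^ (n + 1))) (t ^ (n + 1)) = nonvanishing (δ a) t := by
    rw [map_pow, nonvanishing_pow ht]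
  refine ⟨a ^ (n + 1), t ^ (n + 1), fun y => ?_, e ▸ haff, e ▸ hxt, e ▸ fun y hy => (hle hy).1,
    fun y => ?_⟩
  · rw [map_pow]; exact (ht y).pow _
  · rw [map_mul, map_pow]; exact hn (n + 1) n.le_succ y trivial

end Sections

/-! ### The section ring and the function field of the stable locus -/

section SectionRing

variable {k : Type u} [Field k] {X : Over (Spec (.of k))} [IsIntegral X.left] {L : Type u}
  [CommGroup L] (δ : L →* CartierDivisor X.left)

instance {L : Type u} [CommGroup L] [Monoid.FG L] [IsMulTorsionFree L] {K : Type u} [Field K] : IsDomain (MonoidAlgebra K L) := by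
  have : NoZeroDivisors (MonoidAlgebra K L) := inferInstance
  have : Nontrivial (MonoidAlgebra K L) := inferInstance
  exact NoZeroDivisors.to_isDomain _

/-- The inclusion of the stable locus into the spectrum of the section ring. -/
abbrev stableInc : stableLocus δ ⟶ sp k (sectionRing δ) :=
  inc (sp k (sectionRing δ)) (stableOpen δ)

instance : Mono (stableInc δ) :=
  mono_inc (S := sp k (sectionRing δ)) (V := stableOpen δ)

/-- An element of the section ring as a regular function on the stable locus. -/
def stableFn : sectionRing δ →+* Γ((stableLocus δ).left, ⊤) :=
  (pb (stableInc δ)).comp (coord k (sectionRing δ))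

lemma stableFn_homogeneous (a : L) (s : globalSections (δ a)) :
    stableFn δ (homogeneous δ a s) = stableFunction δ a s := rfl

lemma stableFn_algebraMap (c : k) :
    stableFn δ (algebraMap k _ c) = scalar (stableLocus δ) c := by
  rw [stableFn, RingHom.comp_apply, coord_algebraMap, pb_scalar]

lemma mem_basicOpen_stableFn {y : (stableLocus δ).left} {F : sectionRing δ} :
    y ∈ (stableLocus δ).left.basicOpen (stableFn δ F) ↔
      (stableInc δ).left y ∈ PrimeSpectrum.basicOpen F := by
  have h := (stableInc δ).left.preimage_basicOpen_top (coord k (sectionRing δ) F)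
  have h2 : (sp k (sectionRing δ)).left.basicOpen (coord k (sectionRing δ) F) =
    PrimeSpectrum.basicOpen F := basicOpen_eq_of_affine (R := .of (sectionRing δ)) F
  rw [h2] at h
  exact (SetLike.ext_iff.1 h y).symm

variable {δ} in
@[elab_as_elim]
lemma sectionRing_induction {P : sectionRing δ → Prop} (F : sectionRing δ)
    (add : ∀ F H, P F → P H → P (F + H))
    (single : ∀ a s, P (homogeneous δ a s)) : P F := by
  classical
  have h0 : P 0 := by
    have : homogeneous δ 1 0 = 0 := Subtype.ext (by simp [homogeneous])
    rw [← this]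
    exact single 1 0
  have h1 (T : Finset L) : P (∑ a ∈ T, homogeneous δ a ⟨_, F.2 a⟩) := by
    induction T using Finset.induction_on with
    | empty => exact h0
    | insert a T ha ih => rw [Finset.sum_insert ha]; exact add _ _ (single _ _) ih
  have h2 : F = ∑ a ∈ F.1.coeff.support, homogeneous δ a ⟨_, F.2 a⟩ := by
    refine Subtype.ext ?_
    rw [AddSubmonoidClass.coe_finsetSum]
    exact (MonoidAlgebra.sum_coeff_single F.1).symm
  rw [h2]
  exact h1 _

/-- The stable locus is open in an affine scheme whose ring is additively generated by homogeneous
elements. The axioms of the actions on the stable locus are checked with this on sections only. -/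
lemma hom_ext_stableLocus {S : Over (Spec (.of k))} {f g : S ⟶ stableLocus δ}
    (h : ∀ (a : L) (s : globalSections (δ a)),
      pb f (stableFunction δ a s) = pb g (stableFunction δ a s)) : f = g := by
  rw [← cancel_mono (stableInc δ)]
  refine sp_ext fun F => ?_
  rw [pb_comp, pb_comp]
  change pb f (stableFn δ F) = pb g (stableFn δ F)
  induction F using sectionRing_induction with
  | add F H hF hH => rw [map_add, map_add, map_add, hF, hH]
  | single a s => exact h a s

lemma coord_injective {A : Type u} [CommRing A] [Algebra k A] :
    Function.Injective (coord k A) :=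
  (ConcreteCategory.bijective_of_isIso (Scheme.ΓSpecIso (.of A)).inv).1

variable [Monoid.FG L] [IsMulTorsionFree L]

instance : IsDomain (sectionRing δ) := inferInstance

instance : IsIntegral (Spec (.of (sectionRing δ))) := inferInstance

lemma isIntegral_stableLocus [Nonempty (stableLocus δ).left] : IsIntegral (stableLocus δ).left :=
  have : Nonempty (stableOpen δ).toScheme := ‹Nonempty (stableLocus δ).left›
  show IsIntegral (stableOpen δ).toScheme from isIntegral_of_isOpenImmersion (stableOpen δ).ι

instance : IsIntegral (sp k (sectionRing δ)).left :=
  inferInstanceAs (IsIntegral (Spec (.of (sectionRing δ))))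

variable [IsIntegral (stableLocus δ).left]

instance : IsDominant (stableInc δ).left := by
  refine ⟨?_⟩
  have h := (stableOpen δ).ι.isOpenEmbedding.isOpen_range
  exact h.dense ⟨_, genericPoint (stableLocus δ).left, rfl⟩

lemma stableFn_injective : Function.Injective (stableFn δ) := by
  have h1 : Function.Injective (rat _ ∘ stableFn δ) := by
    have : (rat _ ∘ stableFn δ) = ff (stableInc δ).left ∘ rat _ ∘ coord k (sectionRing δ) :=
      funext fun F => rat_pb (stableInc δ) (coord k _ F)
    rw [this]
    exact (ff_injective _).comp (rat_injective.comp coord_injective)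
  exact h1.of_comp

/-- The nonzero homogeneous elements of the section ring. -/
def nonzeroHomogeneous : Submonoid (sectionRing δ) where
  carrier := {F | ∃ a, ∃ s : X.left.functionField, s ≠ 0 ∧ F.1 = MonoidAlgebra.single a s}
  one_mem' := ⟨1, 1, one_ne_zero, rfl⟩
  mul_mem' := by
    rintro F H ⟨a, s, hs, hF⟩ ⟨b, t, ht, hH⟩
    refine ⟨a * b, s * t, mul_ne_zero hs ht, ?_⟩
    rw [← MonoidAlgebra.single_mul_single, ← hF, ← hH]
    rfl

omit [Monoid.FG L] [IsMulTorsionFree L] [IsIntegral (stableLocus δ).left] in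
lemma homogeneous_mem_nonzero {a : L} {s : globalSections (δ a)} (hs : s.1 ≠ 0) :
    homogeneous δ a s ∈ nonzeroHomogeneous δ := ⟨a, s, hs, rfl⟩

variable [CompactSpace X.left]

omit [Monoid.FG L] [IsMulTorsionFree L] [IsIntegral (stableLocus δ).left] in
variable {δ} in
-- Any rational function f is a section of 𝒪(δ c) near the generic point, so f t is a global section
-- for a suitable nonzero section t. Hence f in degree c is the quotient of the homogeneous elements
-- f t and t.
lemma CoveredByAffine.isLocalization (hδ : CoveredByAffine δ) :
    IsLocalization (nonzeroHomogeneous δ) (MonoidAlgebra X.left.functionField L) := by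
  refine (isLocalization_iff _ _).2 ⟨?_, ?_, ?_⟩
  · rintro ⟨F, a, s, hs, hF⟩
    refine IsUnit.of_mul_eq_one (MonoidAlgebra.single a⁻¹ s⁻¹) ?_
    change F.1 * _ = 1
    rw [hF, MonoidAlgebra.single_mul_single, mul_inv_cancel, mul_inv_cancel₀ hs]
    rfl
  · intro F
    induction F using MonoidAlgebra.induction_linear with
    | zero => exact ⟨⟨0, 1⟩, by simp⟩
    | add F H hF hH =>
      obtain ⟨⟨F', s⟩, hF⟩ := hF
      obtain ⟨⟨H', t⟩, hH⟩ := hH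
      refine ⟨⟨F' * t + H' * s, s * t⟩, ?_⟩
      simp only [Submonoid.coe_mul, map_add, map_mul] at hF hH ⊢
      rw [← hF, ← hH]
      ring
    | single c f =>
      obtain ⟨d, hd⟩ := exists_rep (δ c) (genericPoint X.left)
      obtain ⟨a, t, ht, -, ht0, -, hft⟩ := hδ.exists_mul_mem (c := c) (f := f)
        ((isSectionAt_iff_mem hd).2 (regularAt_genericPoint _)) (U := ⊤) trivial
      refine ⟨⟨homogeneous δ (c * a) ⟨_, hft⟩, ⟨homogeneous δ a ⟨t, ht⟩,
        homogeneous_mem_nonzero δ (IsGeneratorAt.ne_zero ht0)⟩⟩, ?_⟩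
      change MonoidAlgebra.single c f * MonoidAlgebra.single a t = MonoidAlgebra.single _ _
      rw [MonoidAlgebra.single_mul_single]
  · intro F H h
    exact ⟨1, by rw [Subtype.ext h]⟩

variable {δ} (hδ : CoveredByAffine δ)

/-- The canonical homomorphism from `K(X)[Λ]` to the function field of the stable locus. -/
def stableRat : MonoidAlgebra X.left.functionField L →+* (stableLocus δ).left.functionField :=
  haveI := hδ.isLocalization
  IsLocalization.lift (M := nonzeroHomogeneous δ) (g := (rat _).comp (stableFn δ)) (by
    rintro ⟨F, a, s, hs, hF⟩
    rw [isUnit_iff_ne_zero, RingHom.comp_apply, map_ne_zero_iff _ rat_injective,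
      map_ne_zero_iff _ (stableFn_injective δ)]
    rintro rfl
    exact hs (by simpa using hF.symm))

lemma stableRat_coe (F : sectionRing δ) :
    stableRat hδ (F : MonoidAlgebra X.left.functionField L) = rat _ (stableFn δ F) :=
  haveI := hδ.isLocalization
  IsLocalization.lift_eq (M := nonzeroHomogeneous δ) _ F

/-- The rational function on the stable locus of degree `a` given by `f`. -/
def homRat (a : L) (f : X.left.functionField) : (stableLocus δ).left.functionField :=
  stableRat hδ (MonoidAlgebra.single a f)

lemma homRat_section (a : L) (s : globalSections (δ a)) :
    homRat hδ a s.1 = rat _ (stableFunction δ a s) :=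
  stableRat_coe hδ (homogeneous δ a s)

lemma homRat_mul (a b : L) (f g : X.left.functionField) :
    homRat hδ (a * b) (f * g) = homRat hδ a f * homRat hδ b g := by
  rw [homRat, ← MonoidAlgebra.single_mul_single, map_mul]; rfl

lemma homRat_one : homRat hδ 1 1 = 1 := map_one (stableRat hδ)

lemma homRat_pow (a : L) (f : X.left.functionField) (n : ℕ) :
    homRat hδ (a ^ n) (f ^ n) = homRat hδ a f ^ n := by
  rw [homRat, homRat, ← map_pow, MonoidAlgebra.single_pow]

lemma homRat_ne_zero (a : L) {f : X.left.functionField} (hf : f ≠ 0) : homRat hδ a f ≠ 0 := by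
  intro h
  have := homRat_mul hδ a a⁻¹ f f⁻¹
  rw [mul_inv_cancel, mul_inv_cancel₀ hf, homRat_one, h, zero_mul] at this
  exact one_ne_zero this

lemma homRat_inv (a : L) (f : X.left.functionField) (hf : f ≠ 0) :
    homRat hδ a⁻¹ f⁻¹ = (homRat hδ a f)⁻¹ := by
  refine eq_inv_of_mul_eq_one_left ?_
  rw [← homRat_mul, inv_mul_cancel, inv_mul_cancel₀ hf, homRat_one]

/-- The homomorphism `K(X) → K(Y)` of degree zero. -/
def baseRat : X.left.functionField →+* (stableLocus δ).left.functionField :=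
  (stableRat hδ).comp MonoidAlgebra.singleOneRingHom

lemma baseRat_apply (f) : baseRat hδ f = homRat hδ 1 f := rfl

lemma baseRat_mul_homRat (f g) (a : L) : baseRat hδ f * homRat hδ a g = homRat hδ a (f * g) := by
  rw [baseRat_apply, ← homRat_mul, one_mul]

lemma mem_stable_iff {y : (stableLocus δ).left} {a : L} {s : globalSections (δ a)} :
    IsUnitAt y (homRat hδ a s.1) ↔
      (stableInc δ).left y ∈ PrimeSpectrum.basicOpen (homogeneous δ a s) := by
  rw [homRat_section, isUnitAt_rat_iff, ← stableFn_homogeneous, mem_basicOpen_stableFn]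

lemma homRat_mem_regularAt (y : (stableLocus δ).left) {a : L} {s : X.left.functionField}
    (hs : s ∈ globalSections (δ a)) : homRat hδ a s ∈ regularAt y := by
  rw [homRat_section hδ a ⟨s, hs⟩]
  exact rat_mem_regularAt _ _

/-- Every point of the stable locus lies over a nonvanishing locus that is affine. -/
lemma exists_isUnitAt_homRat (y : (stableLocus δ).left) :
    ∃ a, ∃ t ∈ globalSections (δ a), IsAffineOpen (nonvanishing (δ a) t) ∧
      IsUnitAt y (homRat hδ a t) := by
  have h : (stableInc δ).left y ∈ stableOpen δ := inc_mem (S := sp k (sectionRing δ)) y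
  obtain ⟨a, h⟩ := TopologicalSpace.Opens.mem_iSup.1 h
  obtain ⟨s, h⟩ := TopologicalSpace.Opens.mem_iSup.1 h
  obtain ⟨hs, hy⟩ := TopologicalSpace.Opens.mem_iSup.1 h
  exact ⟨a, s.1, s.2, hs, (mem_stable_iff hδ).2 hy⟩

end SectionRing

/-! ### Morphisms to the stable locus -/

section Pulls

variable {k : Type u} [Field k] {S T U : Over (Spec (.of k))} [IsIntegral S.left]
  [IsIntegral T.left] [IsIntegral U.left]

/-- The rational function `f` is regular at the image of the generic point, and its pull-back
is `g`. -/
def Pulls (h : S ⟶ T) (f : T.left.functionField) (g : S.left.functionField) : Prop :=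
  ∃ a : T.left.presheaf.stalk (h.left (genericPoint S.left)),
    algebraMap _ T.left.functionField a = f ∧ h.left.stalkMap (genericPoint S.left) a = g

variable {h : S ⟶ T}

lemma Pulls.unique {f g g'} (H : Pulls h f g) (H' : Pulls h f g') : g = g' := by
  obtain ⟨a, rfl, rfl⟩ := H
  obtain ⟨b, hb, rfl⟩ := H'
  rw [algebraMap_stalk_injective _ hb]

lemma Pulls.mul {f g f' g'} (H : Pulls h f g) (H' : Pulls h f' g') :
    Pulls h (f * f') (g * g') := by
  obtain ⟨a, rfl, rfl⟩ := H
  obtain ⟨b, rfl, rfl⟩ := H'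
  exact ⟨a * b, map_mul _ _ _, map_mul _ _ _⟩

lemma pulls_rat (h : S ⟶ T) (a) : Pulls h (rat T a) (rat S (pb h a)) := by
  refine ⟨T.left.presheaf.germ ⊤ _ trivial a, algebraMap_germ (U := ⊤) trivial a, ?_⟩
  exact congr($(h.left.germ_stalkMap ⊤ (genericPoint S.left) trivial).hom a)

/-- Here `h` need not be dominant, for instance when it is the unit section of a product with a
torus, and `ff h.left` need not exist. A function that comes from `U` can still be pulled back,
because `h ≫ p` hits the generic point of `U`. -/
lemma pulls_ff (h : S ⟶ T) (p : T ⟶ U) [IsDominant p.left] [IsDominant (h ≫ p).left]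
    (f : U.left.functionField) : Pulls h (ff p.left f) (ff (h ≫ p).left f) := by
  have h0 : IsDominant (h.left ≫ p.left) := ‹IsDominant (h ≫ p).left›
  have e : p.left (h.left (genericPoint S.left)) = genericPoint U.left :=
    map_genericPoint (h.left ≫ p.left)
  obtain ⟨W, hW, b, rfl⟩ := U.left.presheaf.exists_germ_eq f
  have hW' : h.left (genericPoint S.left) ∈ p.left ⁻¹ᵁ W := by
    change p.left (h.left (genericPoint S.left)) ∈ W
    rwa [e]
  refine ⟨T.left.presheaf.germ (p.left ⁻¹ᵁ W) _ hW' (p.left.app W b), ?_, ?_⟩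
  · exact (algebraMap_germ hW' _).trans (ff_toK p.left W hW b).symm
  · refine Eq.trans ?_ (ff_toK (h ≫ p).left W hW b).symm
    exact congr($(h.left.germ_stalkMap (p.left ⁻¹ᵁ W) (genericPoint S.left) hW').hom
      (p.left.app W b))

end Pulls

section ToGlobal

variable {k : Type u} [Field k] (S : Over (Spec (.of k))) [IsIntegral S.left] {A : Type u}
  [CommRing A]

/-- A homomorphism to the function field with everywhere regular values. -/
def toGlobal (ψ : A →+* S.left.functionField) (h : ∀ a y, ψ a ∈ regularAt y) :
    A →+* Γ(S.left, ⊤) :=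
  ((RingEquiv.ofBijective (rat S).rangeRestrict
    ⟨fun _ _ hab => rat_injective (congrArg Subtype.val hab),
      (rat S).rangeRestrict_surjective⟩).symm : (rat S).range →+* Γ(S.left, ⊤)).comp
    (ψ.codRestrict (rat S).range fun a => exists_rat_eq (h a))

@[simp]
lemma rat_toGlobal (ψ : A →+* S.left.functionField) (h) (a : A) :
    rat S (toGlobal S ψ h a) = ψ a :=
  congrArg Subtype.val ((RingEquiv.ofBijective (rat S).rangeRestrict
    ⟨fun _ _ hab => rat_injective (congrArg Subtype.val hab),
      (rat S).rangeRestrict_surjective⟩).apply_symm_apply ⟨ψ a, exists_rat_eq (h a)⟩)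

/-- A family of everywhere regular and invertible rational functions as a morphism to a
diagonalizable group. -/
lemma exists_toDiag {M : Type u} [CommGroup M] (χ : M →* S.left.functionField)
    (h : ∀ a y, χ a ∈ regularAt y) :
    ∃ g : S ⟶ diag k M, ∀ a, rat S (pb g (character k a)) = χ a := by
  choose f hf using fun a => exists_rat_eq (h a)
  refine ⟨toDiag S ⟨⟨f, rat_injective ?_⟩, fun a b => rat_injective ?_⟩, fun a => ?_⟩
  · rw [hf, map_one, map_one]
  · rw [hf, map_mul, map_mul, hf, hf]
  · rw [pb_toDiag]; exact hf a

end ToGlobal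

section ToStable

variable {k : Type u} [Field k] {X : Over (Spec (.of k))} [IsIntegral X.left] {L : Type u}
  [CommGroup L] {δ : L →* CartierDivisor X.left} (S : Over (Spec (.of k))) [IsIntegral S.left]

/-- The homomorphism from `K(X)[Λ]` that is given by `φ` on `K(X)` and by `e` on `Λ`. -/
def gradedHom {K K' : Type u} [Field K] [Field K'] (φ : K →+* K') (e : L →* K') :
    MonoidAlgebra K L →+* K' :=
  MonoidAlgebra.liftNCRingHom φ e fun _ _ => mul_comm _ _

@[simp]
lemma gradedHom_single {K K' : Type u} [Field K] [Field K'] (φ : K →+* K') (e : L →* K') (a f) :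
    gradedHom φ e (MonoidAlgebra.single a f) = φ f * e a := by
  simp [gradedHom, MonoidAlgebra.liftNCRingHom]

lemma algebraMap_eq_rat_scalar (c : k) :
    algebraMap k X.left.functionField c = rat X (scalar X c) := rfl

/-- A morphism to the stable locus. -/
theorem exists_toStable (φ : X.left.functionField →+* S.left.functionField)
    (e : L →* S.left.functionField) (hφ : ∀ c, φ (rat X (scalar X c)) = rat S (scalar S c))
    (hreg : ∀ a, ∀ s ∈ globalSections (δ a), ∀ y, φ s * e a ∈ regularAt y)
    (hst : ∀ y, ∃ a, ∃ s ∈ globalSections (δ a), IsAffineOpen (nonvanishing (δ a) s) ∧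
      IsUnitAt y (φ s * e a)) :
    ∃ f : S ⟶ stableLocus δ, ∀ F : sectionRing δ, rat S (pb f (stableFn δ F)) =
      gradedHom φ e F.1 := by
  let ψ : sectionRing δ →+* S.left.functionField :=
    (gradedHom φ e).comp (sectionRing δ).val.toRingHom
  have hψ (a) (s : globalSections (δ a)) : ψ (homogeneous δ a s) = φ s * e a :=
    gradedHom_single φ e a s.1
  have h1 : ∀ F y, ψ F ∈ regularAt y := by
    intro F y
    induction F using sectionRing_induction with
    | add F H hF hH => rw [map_add]; exact add_mem hF hH
    | single a s => rw [hψ]; exact hreg a s.1 s.2 y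
  let f₀ : S ⟶ sp k (sectionRing δ) := toSp S (toGlobal S ψ h1) fun c => rat_injective (by
    rw [rat_toGlobal, ← hφ, ← algebraMap_eq_rat_scalar]
    change gradedHom φ e (MonoidAlgebra.single 1 (algebraMap k X.left.functionField c)) = _
    rw [gradedHom_single, map_one, mul_one])
  -- The hypothesis `hst` provides at each point a section `s` with affine nonvanishing locus whose
  -- image is a unit, so the image of the point lies in Y_s.
  have h2 : ∀ p, f₀.left p ∈ stableOpen δ := by
    intro p
    obtain ⟨a, s, hs, haff, hu⟩ := hst p
    have h3 : p ∈ f₀.left ⁻¹ᵁ PrimeSpectrum.basicOpen (homogeneous δ a ⟨s, hs⟩) := by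
      rw [toSp_preimage, ← isUnitAt_rat_iff, rat_toGlobal, hψ]
      exact hu
    exact TopologicalSpace.Opens.mem_iSup.2 ⟨a, TopologicalSpace.Opens.mem_iSup.2 ⟨⟨s, hs⟩,
      TopologicalSpace.Opens.mem_iSup.2 ⟨haff, h3⟩⟩⟩
  obtain ⟨f, hf⟩ : ∃ f : S ⟶ stableLocus δ, f ≫ stableInc δ = f₀ :=
    ⟨liftRes (S := sp k (sectionRing δ)) f₀ h2, liftRes_inc (S := sp k (sectionRing δ)) f₀ h2⟩
  refine ⟨f, fun F => ?_⟩
  have h4 : pb f (stableFn δ F) = pb f₀ (coord k _ F) :=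
    (pb_comp f (stableInc δ) _).symm.trans (by rw [hf])
  exact (congrArg (rat S) (h4.trans (pb_toSp S _ _ F))).trans (rat_toGlobal S ψ h1 F)

section StableMaps

variable {S} [Monoid.FG L] [IsMulTorsionFree L] [IsIntegral (stableLocus δ).left]
  [CompactSpace X.left] (hδ : CoveredByAffine δ)

/-- The pull-back of homogeneous rational functions under a dominant morphism to the stable locus is
determined by the pull-back of sections. -/
lemma ff_homRat {f : S ⟶ stableLocus δ} [IsDominant f.left]
    {φ : X.left.functionField →+* S.left.functionField} {e : L →* S.left.functionField}
    (h : ∀ F : sectionRing δ, rat S (pb f (stableFn δ F)) = gradedHom φ e F.1)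
    (a : L) (g : X.left.functionField) : ff f.left (homRat hδ a g) = φ g * e a := by
  have := hδ.isLocalization
  have h1 : (ff f.left).comp (stableRat hδ) = gradedHom φ e := by
    refine IsLocalization.ringHom_ext (nonzeroHomogeneous δ) (RingHom.ext fun F => ?_)
    change ff f.left (stableRat hδ F.1) = gradedHom φ e F.1
    rw [stableRat_coe, ← rat_pb, h]
  rw [← gradedHom_single, ← h1]
  rfl

end StableMaps

end ToStable

/-! ### The projection from the stable locus to X -/

section Extension

variable {X : Scheme.{u}} [IsIntegral X] [CompactSpace X] {D E : CartierDivisor X} {x : X}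
  {f t : X.functionField}

/-- The poles of f inside the affine set X_t are cleared by a function g on X_t that is a unit at x,
those outside by a power of t. Unlike in `CoveredByAffine.exists_mul_mem` the section t is
prescribed: it has to be one that is already known to be invertible at a given point of Y. -/
lemma exists_mul_pow_mem (ht : t ∈ globalSections E) (haff : IsAffineOpen (nonvanishing E t))
    (hx : x ∈ nonvanishing E t) (hf : IsSectionAt D x f) :
    ∃ (g : X.functionField) (n : ℕ), IsUnitAt x g ∧
      f * g * t ^ n ∈ globalSections (D * E ^ n) := by
  obtain ⟨V, hxV, hV⟩ := isOpen_isSectionAt hf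
  obtain ⟨g, hgV, hxg⟩ := haff.exists_basicOpen_le ⟨x, hxV⟩ hx
  have hgen := genericPoint_mem hx
  obtain ⟨m, hm⟩ := exists_isSectionAt_mul_pow (D := D) (E := 1) (t := toK _ hgen g) (s := f)
    (W := nonvanishing E t) haff.isCompact (fun y hy =>
      isSectionAt_one.2 (toK_mem_regularAt hy g _)) (fun y hy hy' => hV y (hgV
        ((isUnitAt_toK_iff hy g hgen).1 (isGeneratorAt_one_iff.1 hy'))))
  obtain ⟨n, hn⟩ := exists_isSectionAt_mul_pow (D := D) (E := E) (t := t)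
    (s := f * toK _ hgen g ^ m) (W := ⊤) isCompact_univ (fun y _ => ht y) (fun y _ hy => by
      have := hm m le_rfl y hy
      rwa [one_pow, mul_one] at this)
  exact ⟨toK _ hgen g ^ m, n, ((isUnitAt_toK_iff hx g hgen).2 hxg).pow m,
    fun y => hn n le_rfl y trivial⟩

omit [CompactSpace X]

lemma IsGeneratorAt.inv (h : IsGeneratorAt D x f) : IsGeneratorAt D⁻¹ x f⁻¹ := by
  obtain ⟨d, hd⟩ := exists_rep D x
  have hd' : (D⁻¹).germ x = ((d⁻¹ : X.functionFieldˣ) : X.functionFieldˣ ⧸ unitsAt X x) := by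
    rw [CartierDivisor.germ_inv, hd]; rfl
  rw [isGeneratorAt_iff_isUnitAt hd] at h
  rw [isGeneratorAt_iff_isUnitAt hd', Units.val_inv_eq_inv_val, ← mul_inv]
  exact h.inv

lemma isGeneratorAt_inv_rep {d : X.functionFieldˣ}
    (hd : D.germ x = (d : X.functionFieldˣ ⧸ unitsAt X x)) :
    IsGeneratorAt D x (d : X.functionField)⁻¹ := by
  rw [isGeneratorAt_iff_isUnitAt hd, inv_mul_cancel₀ d.ne_zero]
  exact isUnitAt_one

end Extension

section Variety

variable {k : Type u} [Field k]

instance (X : Over (Spec (.of k))) [IsVariety X] : CompactSpace X.left :=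
  have := IsVariety.quasiCompact (X := X)
  QuasiCompact.compactSpace_of_compactSpace X.hom

instance (X : Over (Spec (.of k))) [IsVariety X] : IsLocallyNoetherian X.left :=
  have := IsVariety.locallyOfFiniteType (X := X)
  LocallyOfFiniteType.isLocallyNoetherian X.hom

lemma isVariety_of_isOpenImmersion {W X : Over (Spec (.of k))} [IsVariety X] (i : W ⟶ X)
    [IsOpenImmersion i.left] [Nonempty W.left] : IsVariety W := by
  have := IsVariety.locallyOfFiniteType (X := X)
  have := IsVariety.isSeparated (X := X)
  have := IsVariety.quasiCompact (X := X)
  have : IsIntegral W.left := isIntegral_of_isOpenImmersion i.left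
  refine ⟨this, ?_, ?_, ?_⟩ <;> rw [← Over.w i] <;> infer_instance

lemma isVariety_res (X : Over (Spec (.of k))) [IsVariety X] (U : X.left.Opens) {x : X.left}
    (hx : x ∈ U) : IsVariety (res X U) :=
  have : IsOpenImmersion (inc X U).left := inferInstanceAs (IsOpenImmersion U.ι)
  have : Nonempty (res X U).left := ⟨resPt U x hx⟩
  isVariety_of_isOpenImmersion (inc X U)

end Variety

section Projection

variable {k : Type u} [Field k] {X : Over (Spec (.of k))} [IsVariety X] {L : Type u}
  [CommGroup L] {δ : L →* CartierDivisor X.left} [Monoid.FG L] [IsMulTorsionFree L]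
  [IsIntegral (stableLocus δ).left] (hδ : CoveredByAffine δ)

/-- For large n the product f tⁿ is a global section, so f = (f tⁿ)/tⁿ in the function field of Y,
where the numerator is regular and the denominator is a unit at y. -/
lemma baseRat_regular {a : L} {t : X.left.functionField} (ht : t ∈ globalSections (δ a))
    {y : (stableLocus δ).left} (hy : IsUnitAt y (homRat hδ a t)) {f : X.left.functionField}
    (hf : ∀ x ∈ nonvanishing (δ a) t, f ∈ regularAt x) : baseRat hδ f ∈ regularAt y := by
  obtain ⟨n, hn⟩ := exists_isSectionAt_mul_pow (D := 1) (E := δ a) (t := t)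
    (s := f) (W := ⊤) isCompact_univ (fun x _ => ht x) (fun x _ hx => isSectionAt_one.2 (hf x hx))
  have h1 : f * t ^ n ∈ globalSections (δ (a ^ n)) := fun x => by
    have := hn n le_rfl x trivial
    rwa [one_mul, ← map_pow] at this
  have h2 := homRat_mem_regularAt hδ y h1
  rw [← baseRat_mul_homRat, homRat_pow] at h2
  have h3 := Subring.mul_mem _ h2 (hy.pow n).inv.mem
  rwa [mul_inv_cancel_right₀ (hy.pow n).ne_zero] at h3

lemma baseRat_scalar (c : k) :
    baseRat hδ (rat X (scalar X c)) = rat _ (scalar (stableLocus δ) c) := by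
  rw [← stableFn_algebraMap, ← stableRat_coe hδ]
  rfl

/-- The function field of `Y` determines a morphism to `X` that maps the nonvanishing locus in `Y`
of a section to the one in `X`. -/
theorem exists_projection : ∃ π : stableLocus δ ⟶ X,
    (IsDominant π.left ∧ ∀ _ : IsDominant π.left, ∀ f, ff π.left f = baseRat hδ f) ∧
    ∀ a, ∀ t ∈ globalSections (δ a), IsAffineOpen (nonvanishing (δ a) t) →
      ∀ y, IsUnitAt y (homRat hδ a t) → IsGeneratorAt (δ a) (π.left y) t := by
  have := IsVariety.isSeparated (X := X)
  have key : ∀ {a t} (ht : t ∈ globalSections (δ a)) {y : (stableLocus δ).left},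
      IsUnitAt y (homRat hδ a t) → y ∈ (stableLocus δ).left.basicOpen
        (stableFunction δ a ⟨t, ht⟩) ∧ genericPoint X.left ∈ nonvanishing (δ a) t ∧
      ∀ (hg) (f : Γ(X.left, nonvanishing (δ a) t)), ∀ y' ∈ (stableLocus δ).left.basicOpen
        (stableFunction δ a ⟨t, ht⟩), baseRat hδ (toK _ hg f) ∈ regularAt y' := by
    intro a t ht y hy
    rw [homRat_section hδ a ⟨t, ht⟩, isUnitAt_rat_iff] at hy
    refine ⟨hy, ?_, fun hg f y' hy' => ?_⟩
    · have h0 : t ≠ 0 := by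
        rintro rfl
        rw [← isUnitAt_rat_iff, ← homRat_section hδ] at hy
        exact hy.ne_zero (by simp [homRat])
      obtain ⟨d, hd⟩ := exists_rep (δ a) (genericPoint X.left)
      exact (isGeneratorAt_iff_isUnitAt hd).2 (isUnitAt_genericPoint (mul_ne_zero h0 d.ne_zero))
    · rw [← isUnitAt_rat_iff, ← homRat_section hδ] at hy'
      exact baseRat_regular hδ ht hy' fun x hx => toK_mem_regularAt hx f hg
  obtain ⟨π, h1, h2⟩ := exists_hom_over_of_functionField (baseRat hδ) (baseRat_scalar hδ) (by
    intro y
    obtain ⟨a, t, ht, haff, hy⟩ := exists_isUnitAt_homRat hδ y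
    obtain ⟨h1, h2, h3⟩ := key ht hy
    exact ⟨_, h1, _, haff, h2, h3 h2⟩)
  refine ⟨π, h1, fun a t ht haff y hy => ?_⟩
  obtain ⟨h3, h4, h5⟩ := key ht hy
  exact h2 _ _ haff h4 (h5 h4) y h3

/-- `π` is the projection: it induces `baseRat` and is compatible with nonvanishing loci. -/
structure IsProjection (π : stableLocus δ ⟶ X) : Prop where
  isDominant : IsDominant π.left
  ff_eq : ∀ f, ff π.left f = baseRat hδ f
  isGeneratorAt : ∀ a, ∀ t ∈ globalSections (δ a), IsAffineOpen (nonvanishing (δ a) t) →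
      ∀ y, IsUnitAt y (homRat hδ a t) → IsGeneratorAt (δ a) (π.left y) t

variable {hδ} {π : stableLocus δ ⟶ X} (hπ : IsProjection hδ π) {y : (stableLocus δ).left} {a : L}
  {f : X.left.functionField}

include hπ

/-- With g and t from `exists_mul_pow_mem`, the homogeneous function f g tⁿ is regular at y. Both t
and g are units there, the latter because it is pulled back along π from a unit at π(y). -/
lemma IsProjection.mem_regularAt (hf : IsSectionAt (δ a) (π.left y) f) :
    homRat hδ a f ∈ regularAt y := by
  have := hπ.isDominant
  obtain ⟨b, t, ht, haff, hy⟩ := exists_isUnitAt_homRat hδ y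
  obtain ⟨g, n, hg, hgt⟩ := exists_mul_pow_mem ht haff (hπ.isGeneratorAt b t ht haff y hy) hf
  rw [← map_pow, ← map_mul] at hgt
  have h2 := homRat_mem_regularAt hδ y hgt
  rw [homRat_mul, homRat_pow, mul_comm f g, ← baseRat_mul_homRat, ← hπ.ff_eq] at h2
  have h3 := (hg.ff π.left).mul (hy.pow n)
  rw [mul_right_comm] at h2
  have h4 := Subring.mul_mem _ h3.inv.mem h2
  rwa [inv_mul_cancel_left₀ h3.ne_zero] at h4

lemma IsProjection.isUnitAt (hf : IsGeneratorAt (δ a) (π.left y) f) :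
    IsUnitAt y (homRat hδ a f) := by
  refine isUnitAt_iff.2 ⟨homRat_ne_zero hδ a hf.ne_zero, hπ.mem_regularAt hf.isSectionAt, ?_⟩
  rw [← homRat_inv hδ a f hf.ne_zero]
  refine hπ.mem_regularAt ?_
  rw [map_inv]
  exact hf.inv.isSectionAt

/-- For the converse, f is compared with the local generator 1/d of 𝒪(δ a) at π(y). Their quotient f
d is regular at π(y) and becomes a unit at y, so it is a unit at π(y) since the map of stalks is
local. Affineness of the nonvanishing locus is no longer required. -/
lemma IsProjection.isUnitAt_iff (hf : f ∈ globalSections (δ a)) :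
    IsUnitAt y (homRat hδ a f) ↔ IsGeneratorAt (δ a) (π.left y) f := by
  refine ⟨fun h => ?_, fun h => hπ.isUnitAt h⟩
  have := hπ.isDominant
  obtain ⟨d, hd⟩ := exists_rep (δ a) (π.left y)
  have h1 := hπ.isUnitAt (isGeneratorAt_inv_rep hd)
  have h2 := h.div h1
  rw [isGeneratorAt_iff_isUnitAt hd]
  refine IsUnitAt.of_ff π.left ?_ ((isSectionAt_iff_mem hd).1 (hf _))
  rw [hπ.ff_eq]
  convert h2 using 1
  rw [eq_div_iff h1.ne_zero, baseRat_mul_homRat, mul_inv_cancel_right₀ d.ne_zero]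

end Projection

/-! ### Local triviality of the projection and finiteness of the stable locus -/

section LocalEquations

variable {X : Scheme.{u}} [IsIntegral X] {L : Type u} [CommGroup L]

/-- Near every point there are local equations of the divisors `δ a` that depend
multiplicatively on `a`. -/
lemma exists_localEquations [Module.Free ℤ (Additive L)] [Module.Finite ℤ (Additive L)]
    (δ : L →* CartierDivisor X) (x : X) : ∃ U : X.Opens, x ∈ U ∧ ∃ d : L →* X.functionFieldˣ,
      ∀ y ∈ U, ∀ a, (δ a).germ y = (d a : X.functionFieldˣ ⧸ unitsAt X y) := by
  -- Local equations for a basis extend multiplicatively, and finitely many neighbourhoods have an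
  -- open intersection. Freeness of Λ is essential here.
  let b := Module.Free.chooseBasis ℤ (Additive L)
  choose U hU d hd using fun i => (δ (b i).toMul).exists_local x
  let D : Additive L →ₗ[ℤ] Additive X.functionFieldˣ := b.constr ℤ fun i => Additive.ofMul (d i)
  refine ⟨⟨⋂ i, U i, isOpen_iInter_of_finite fun i => (U i).2⟩, Set.mem_iInter.2 hU,
    { toFun := fun a => (D (Additive.ofMul a)).toMul
      map_one' := by rw [ofMul_one, map_zero]; rfl
      map_mul' := fun a b => by rw [ofMul_mul, map_add]; rfl }, fun y hy a => ?_⟩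
  have hy' : ∀ i, y ∈ U i := Set.mem_iInter.1 hy
  let g₁ : Additive L →+ Additive (X.functionFieldˣ ⧸ unitsAt X y) :=
    { toFun := fun a => Additive.ofMul ((δ a.toMul).germ y)
      map_zero' := by rw [toMul_zero, map_one]; rfl
      map_add' := fun a b => by rw [toMul_add, map_mul]; rfl }
  let g₂ : Additive L →+ Additive (X.functionFieldˣ ⧸ unitsAt X y) :=
    { toFun := fun a => Additive.ofMul
        (QuotientGroup.mk' (unitsAt X y) (D a).toMul)
      map_zero' := by rw [map_zero, toMul_zero, map_one]; rfl
      map_add' := fun a b => by rw [map_add, toMul_add, map_mul]; rfl }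
  have h : g₁.toIntLinearMap = g₂.toIntLinearMap := by
    refine b.ext fun i => ?_
    change Additive.ofMul ((δ (b i).toMul).germ y) =
      Additive.ofMul (QuotientGroup.mk' _ (D (b i)).toMul)
    rw [b.constr_basis, hd i y (hy' i)]
    rfl
  exact congr($h (Additive.ofMul a))

end LocalEquations

section Trivialization

variable {k : Type u} [Field k] {X : Over (Spec (.of k))} [IsVariety X] {L : Type u}
  [CommGroup L] {δ : L →* CartierDivisor X.left} [Monoid.FG L] [IsMulTorsionFree L]
  [IsIntegral (stableLocus δ).left] {hδ : CoveredByAffine δ} {π : stableLocus δ ⟶ X}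
  (hπ : IsProjection hδ π) {U : X.left.Opens}

instance (S : Over (Spec (.of k))) (V : S.left.Opens) : IsOpenImmersion (inc S V).left :=
  inferInstanceAs (IsOpenImmersion V.ι)

lemma isDominant_of_isOpenImmersion {S T : Scheme.{u}} [IsIntegral S] [IsIntegral T] (i : S ⟶ T)
    [IsOpenImmersion i] : IsDominant i :=
  ⟨i.isOpenEmbedding.isOpen_range.dense ⟨_, genericPoint S, rfl⟩⟩

lemma isUnitAt_of_isUnit {S : Over (Spec (.of k))} [IsIntegral S.left] {f : Γ(S.left, ⊤)}
    (hf : IsUnit f) (y : S.left) : IsUnitAt y (rat S f) := by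
  rw [isUnitAt_rat_iff, Scheme.basicOpen_of_isUnit _ hf]
  trivial

omit [Monoid.FG L] [IsMulTorsionFree L] [IsIntegral (stableLocus δ).left] in
-- In terms of d a section s of degree a is the regular function s · d_a on S. Twisting by the
-- character χ sends s to χ_a · s d_a, which is regular on S and invertible where s does not vanish.
lemma exists_toStable_of_localEquations (hδ : CoveredByAffine δ) (S : Over (Spec (.of k)))
    [IsIntegral S.left] (p : S ⟶ X) [IsDominant p.left] (d : L →* X.left.functionFieldˣ)
    (hd : ∀ y : S.left, ∀ a,
      (δ a).germ (p.left y) = (d a : X.left.functionFieldˣ ⧸ unitsAt X.left (p.left y)))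
    (χ : L →* Γ(S.left, ⊤)) : ∃ (Φ : S ⟶ stableLocus δ) (e : L →* S.left.functionField),
      (∀ F : sectionRing δ, rat S (pb Φ (stableFn δ F)) = gradedHom (ff p.left) e F.1) ∧
      ∀ a (s : globalSections (δ a)), rat S (pb Φ (stableFunction δ a s)) =
        rat S (χ a) * ff p.left (s.1 * d a) := by
  let e : L →* S.left.functionField :=
    { toFun := fun a => rat S (χ a) * ff p.left (d a)
      map_one' := by simp
      map_mul' := fun a b => by
        rw [map_mul, map_mul, map_mul, Units.val_mul, map_mul]
        exact mul_mul_mul_comm _ _ _ _ }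
  have he (a f) : ff p.left f * e a = rat S (χ a) * ff p.left (f * d a) := by
    rw [map_mul, mul_left_comm]; rfl
  obtain ⟨Φ, hΦ⟩ := exists_toStable (δ := δ) S (ff p.left) e
    (fun c => by rw [← rat_pb, pb_scalar])
    (fun a s hs y => by
      rw [he]
      exact Subring.mul_mem _ (rat_mem_regularAt _ _)
        (ff_mem_regularAt p.left ((isSectionAt_iff_mem (hd y a)).1 (hs _))))
    (fun y => by
      obtain ⟨a, s, hs, haff, hy⟩ := hδ (p.left y)
      refine ⟨a, s, hs, haff, ?_⟩
      rw [he]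
      exact (isUnitAt_of_isUnit ((Group.isUnit a).map χ) y).mul
        (((isGeneratorAt_iff_isUnitAt (hd y a)).1 hy).ff p.left))
  exact ⟨Φ, e, hΦ, fun a s => (hΦ (homogeneous δ a s)).trans
    ((gradedHom_single _ _ a s.1).trans (he a s.1))⟩

/-- The characters as functions on a scheme over a diagonalizable group. -/
def characterHom {S : Over (Spec (.of k))} (g : S ⟶ diag k L) : L →* Γ(S.left, ⊤) where
  toFun a := pb g (character k a)
  map_one' := by rw [character_one, map_one]
  map_mul' a b := by rw [character_mul, map_mul]

/-- Over an open set on which the divisors `δ a` have local equations, `Y` is the product of `U`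
and the diagonalizable group. -/
def IsTrivialization (π : stableLocus δ ⟶ X) (U : X.left.Opens)
    (Φ : diag k L ⊗ res X U ⟶ stableLocus δ) (g : res (stableLocus δ) (π.left ⁻¹ᵁ U) ⟶ diag k L) :
    Prop :=
  Φ ≫ π = snd _ _ ≫ inc X U ∧ lift g (resMap π U) ≫ Φ = inc (stableLocus δ) (π.left ⁻¹ᵁ U) ∧
    ∀ a s, ∃ w, pb Φ (stableFunction δ a s) = pb (fst _ _) (character k a) * pb (snd _ _) w

include hπ in
-- Since 1/d_a generates 𝒪(δ a), it is a unit on P as a homogeneous function of degree a. These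
-- units depend multiplicatively on a and form the group coordinate of a trivialization.
lemma IsProjection.exists_group (P : Over (Spec (.of k))) [IsIntegral P.left]
    (i : P ⟶ stableLocus δ) [IsDominant i.left] (d : L →* X.left.functionFieldˣ)
    (hd : ∀ y : P.left, ∀ a, (δ a).germ (π.left (i.left y)) =
      (d a : X.left.functionFieldˣ ⧸ unitsAt X.left (π.left (i.left y)))) :
    ∃ g : P ⟶ diag k L, ∀ a, rat P (pb g (character k a)) =
      ff i.left (homRat hδ a (d a : X.left.functionField)⁻¹) :=
  exists_toDiag P (M := L)
    { toFun := fun a => ff i.left (homRat hδ a (d a : X.left.functionField)⁻¹)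
      map_one' := by simp [homRat_one]
      map_mul' := fun a b => by
        rw [map_mul, Units.val_mul, mul_inv, homRat_mul, map_mul] }
    fun a y => ff_mem_regularAt i.left
      (hπ.mem_regularAt (isGeneratorAt_inv_rep (hd y a)).isSectionAt)

include hπ in
/-- If `p : S ⟶ Y` has a factorization through `T`, over which `Φ` is given by the character `χ` and
local equations, then it is determined by the functions. -/
lemma IsProjection.comp_eq {P Q : Over (Spec (.of k))} [IsIntegral P.left]
    [IsIntegral Q.left] (i : P ⟶ stableLocus δ) [IsDominant i.left]
    (Φ : Q ⟶ stableLocus δ) (g : P ⟶ diag k L) (j : P ⟶ Q) (χ : Q ⟶ diag k L) (hjχ : j ≫ χ = g)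
    (V : Over (Spec (.of k))) [IsIntegral V.left] (v : V ⟶ X) [IsDominant v.left] (q : Q ⟶ V)
    [IsDominant (j ≫ q).left] (hv : (j ≫ q) ≫ v = i ≫ π) (d : L →* X.left.functionFieldˣ)
    (hg : ∀ a, rat P (pb g (character k a)) =
      ff i.left (homRat hδ a (d a : X.left.functionField)⁻¹))
    (w : ∀ a, globalSections (δ a) → Γ(V.left, ⊤))
    (hw : ∀ a s, rat V (w a s) = ff v.left (s.1 * d a))
    (hΦ : ∀ a s, pb Φ (stableFunction δ a s) = pb χ (character k a) * pb q (w a s)) :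
    j ≫ Φ = i := by
  have hπd := hπ.isDominant
  refine hom_ext_stableLocus δ fun a s => ?_
  rw [pb_comp, hΦ, map_mul, ← pb_comp, ← pb_comp, hjχ]
  apply rat_injective
  rw [map_mul, rat_pb (j ≫ q), hw, rat_pb i, ← homRat_section hδ, hg]
  have e1 : ff (j ≫ q).left (ff v.left (s.1 * d a)) = ff i.left (ff π.left (s.1 * d a)) :=
    have : IsDominant ((j ≫ q) ≫ v).left := inferInstanceAs (IsDominant ((j ≫ q).left ≫ v.left))
    have : IsDominant (i ≫ π).left := inferInstanceAs (IsDominant (i.left ≫ π.left))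
    ((ff_comp (j ≫ q).left v.left _).symm.trans (ff_congr (congrArg Over.Hom.left hv) _)).trans
      (ff_comp i.left π.left _)
  rw [e1, hπ.ff_eq, ← map_mul, mul_comm, baseRat_mul_homRat,
    mul_inv_cancel_right₀ (d a).ne_zero]

include hπ in
-- `Φ` sends (g, x) to the point at which s takes the value χ_a(g) · (s d_a)(x), and the group
-- coordinate of a point of Y consists of the values of 1/d_a. That they match is the identity s =
-- (s d_a) · (1/d_a). Only one composition is needed: `Φ` after the coordinates is the identity.
theorem IsProjection.exists_trivialization {x : X.left} (hx : x ∈ U)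
    (d : L →* X.left.functionFieldˣ) (hd : ∀ y ∈ U, ∀ a,
      (δ a).germ y = (d a : X.left.functionFieldˣ ⧸ unitsAt X.left y)) :
    ∃ Φ g, IsTrivialization π U Φ g := by
  have hπd := hπ.isDominant
  have hvar := isVariety_res X U hx
  have hsep := IsVariety.isSeparated (X := X)
  have hP : Nonempty (res (stableLocus δ) (π.left ⁻¹ᵁ U)).left :=
    ⟨resPt (S := stableLocus δ) (π.left ⁻¹ᵁ U) (genericPoint _)
      (genericPoint_mem_preimage π.left (genericPoint_mem hx))⟩
  have hPi : IsIntegral (res (stableLocus δ) (π.left ⁻¹ᵁ U)).left :=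
    isIntegral_of_isOpenImmersion (inc (stableLocus δ) _).left
  have hiP : IsDominant (inc (stableLocus δ) (π.left ⁻¹ᵁ U)).left :=
    isDominant_of_isOpenImmersion _
  have hiU : IsDominant (inc X U).left := isDominant_of_isOpenImmersion _
  have hsn : IsDominant (snd (diag k L) (res X U) ≫ inc X U).left :=
    inferInstanceAs (IsDominant ((snd (diag k L) (res X U)).left ≫ (inc X U).left))
  obtain ⟨Φ, e, hΦe, hΦ⟩ := exists_toStable_of_localEquations hδ (diag k L ⊗ res X U)
    (snd (diag k L) (res X U) ≫ inc X U) d (fun y => hd _ (inc_mem ((snd (diag k L) (res X U)).left y)))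
    (characterHom (fst _ _))
  obtain ⟨g, hg⟩ := hπ.exists_group _ (inc (stableLocus δ) (π.left ⁻¹ᵁ U)) d
    (fun y => hd _ (resMap_mem π U y))
  have hw (a) (s : globalSections (δ a)) : ∃ w, rat (res X U) w = ff (inc X U).left (s.1 * d a) :=
    exists_rat_eq fun y => ff_mem_regularAt (inc X U).left
      ((isSectionAt_iff_mem (hd _ (inc_mem y) a)).1 (s.2 _))
  choose w hw using hw
  have hΦw (a) (s : globalSections (δ a)) : pb Φ (stableFunction δ a s) =
      pb (fst _ _) (character k a) * pb (snd _ _) (w a s) := by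
    apply rat_injective
    rw [hΦ, (rat (diag k L ⊗ res X U)).map_mul, rat_pb (snd (diag k L) (res X U)), hw]
    exact congrArg _ (ff_comp (snd (diag k L) (res X U)).left (inc X U).left _)
  have hq : IsDominant (lift g (resMap π U) ≫ snd _ _).left := by
    rw [lift_snd]
    refine isDominant_of_injective_of_mem _ (inc X U).left ?_
    rw [← Over.comp_left, resMap_inc]
    exact inferInstanceAs (IsDominant ((inc (stableLocus δ) (π.left ⁻¹ᵁ U)).left ≫ π.left))
  have hB : lift g (resMap π U) ≫ Φ = inc (stableLocus δ) (π.left ⁻¹ᵁ U) :=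
    hπ.comp_eq _ Φ g _ (fst _ _) (lift_fst _ _) (res X U) (inc X U) (snd _ _)
      (by rw [lift_snd, resMap_inc]) d hg w hw hΦw
  have hΦd : IsDominant Φ.left := by
    have h : IsDominant ((lift g (resMap π U)).left ≫ Φ.left) := by
      rw [← Over.comp_left, hB]; exact hiP
    exact IsDominant.of_comp (lift g (resMap π U)).left _
  have hΦπ : IsDominant (Φ ≫ π).left := inferInstanceAs (IsDominant (Φ.left ≫ π.left))
  refine ⟨Φ, g, over_ext_of_ff fun f => ?_, hB, fun a s => ⟨w a s, hΦw a s⟩⟩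
  refine (ff_comp Φ.left π.left f).trans ?_
  rw [hπ.ff_eq, baseRat_apply, ff_homRat hδ hΦe, map_one, mul_one]

end Trivialization

section StableVariety

variable {k : Type u} [Field k] {X : Over (Spec (.of k))} [IsVariety X] {L : Type u}
  [CommGroup L] {δ : L →* CartierDivisor X.left} [Monoid.FG L] [IsMulTorsionFree L]
  [IsIntegral (stableLocus δ).left] {hδ : CoveredByAffine δ} {π : stableLocus δ ⟶ X}
  {U : X.left.Opens}
  {Φ : diag k L ⊗ res X U ⟶ stableLocus δ} {g : res (stableLocus δ) (π.left ⁻¹ᵁ U) ⟶ diag k L}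

omit [Monoid.FG L] [IsMulTorsionFree L] [IsIntegral (stableLocus δ).left] in
lemma IsTrivialization.preimage_le_range (h : IsTrivialization π U Φ g) :
    ((π.left ⁻¹ᵁ U : (stableLocus δ).left.Opens) : Set (stableLocus δ).left) ⊆
      Set.range Φ.left := by
  intro y hy
  refine ⟨(lift g (resMap π U)).left (resPt (S := stableLocus δ) _ y hy), ?_⟩
  rw [← comp_left_apply, h.2.1, inc_resPt]

omit [IsMulTorsionFree L] [IsIntegral (stableLocus δ).left] in
-- The coordinates π⁻¹(U) → G × U have `Φ` as a retraction. By cancellation they are locally of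
-- finite type, and so is G × U over k.
lemma IsTrivialization.locallyOfFiniteType (h : IsTrivialization π U Φ g) :
    LocallyOfFiniteType (res (stableLocus δ) (π.left ⁻¹ᵁ U)).hom := by
  have hl := IsVariety.locallyOfFiniteType (X := X)
  have h1 : ∀ p : (diag k L ⊗ res X U).left, Φ.left p ∈ π.left ⁻¹ᵁ U := fun p => by
    change (Φ ≫ π).left p ∈ U
    rw [h.1]
    exact inc_mem ((snd (diag k L) (res X U)).left p)
  have h2 : lift g (resMap π U) ≫ liftRes Φ h1 = 𝟙 _ := by
    rw [← cancel_mono (inc (stableLocus δ) (π.left ⁻¹ᵁ U)), Category.assoc, liftRes_inc, h.2.1,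
      Category.id_comp]
  have h3 : LocallyOfFiniteType ((lift g (resMap π U)).left ≫ (liftRes Φ h1).left) := by
    rw [← Over.comp_left, h2]
    exact inferInstanceAs (LocallyOfFiniteType (𝟙 _))
  have h4 : LocallyOfFiniteType (lift g (resMap π U)).left :=
    locallyOfFiniteType_of_comp _ (liftRes Φ h1).left
  have h5 : LocallyOfFiniteType (snd (diag k L) (res X U)).left :=
    inferInstanceAs (LocallyOfFiniteType (Limits.pullback.snd (diag k L).hom (res X U).hom))
  have h6 : LocallyOfFiniteType (res X U).hom :=
    inferInstanceAs (LocallyOfFiniteType (U.ι ≫ X.hom))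
  rw [← Over.w (lift g (resMap π U)), ← Over.w (snd (diag k L) (res X U))]
  infer_instance

instance : IsOpenImmersion (stableInc δ).left :=
  inferInstanceAs (IsOpenImmersion (stableOpen δ).ι)

/-- The stable locus is a variety. -/
theorem isVariety_stableLocus
    (H : ∀ x : X.left, ∃ U : X.left.Opens, x ∈ U ∧ ∃ Φ g, IsTrivialization (δ := δ) π U Φ g) :
    IsVariety (stableLocus δ) := by
  choose U hxU Φ g H using H
  refine ⟨inferInstance, ?_, ?_, ?_⟩
  · rw [← Over.w (stableInc δ)]
    have : IsSeparated (sp k (sectionRing δ)).hom :=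
      inferInstanceAs (IsSeparated (Spec.map (CommRingCat.ofHom (algebraMap k (sectionRing δ)))))
    infer_instance
  · let 𝒰 : (stableLocus δ).left.OpenCover :=
      (stableLocus δ).left.openCoverOfIsOpenCover (fun x => π.left ⁻¹ᵁ U x) (by
        rw [TopologicalSpace.IsOpenCover, eq_top_iff]
        exact fun y _ => TopologicalSpace.Opens.mem_iSup.2 ⟨π.left y, hxU _⟩)
    have : IsZariskiLocalAtSource @LocallyOfFiniteType :=
      HasRingHomProperty.instIsZariskiLocalAtSource
    exact IsZariskiLocalAtSource.of_openCover 𝒰 fun x => (H x).locallyOfFiniteType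
  · obtain ⟨T, hT⟩ := isCompact_univ.elim_nhds_subcover (fun x : X.left => (U x : Set X.left))
      (fun x _ => (U x).2.mem_nhds (hxU x))
    -- The stable locus is a finite union of images of the quasi-compact schemes G × U.
    have hc : ∀ x, IsCompact (Set.range (Φ x).left) := by
      intro x
      have := isVariety_res X (U x) (hxU x)
      exact isCompact_range (Φ x).left.continuous
    have : CompactSpace (stableLocus δ).left := by
      refine ⟨(T.isCompact_biUnion fun x _ => hc x).of_isClosed_subset isClosed_univ ?_⟩
      intro y _
      obtain ⟨x, hx, hy⟩ := Set.mem_iUnion₂.1 (hT.2 (Set.mem_univ (π.left y)))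
      exact Set.mem_iUnion₂.2 ⟨x, hx, (H x).preimage_le_range hy⟩
    have : CompactSpace (stableLocus δ).left := this
    infer_instance

end StableVariety

/-! ### The grading action and the torus action on the stable locus -/

section GradingAction

variable {k : Type u} [Field k] {X : Over (Spec (.of k))} [IsVariety X] {L : Type u}
  [CommGroup L] {δ : L →* CartierDivisor X.left} [Monoid.FG L] [IsMulTorsionFree L]

/-- The morphism is prescribed on K(X)[Λ]: trivial on K(X), and multiplying the constant 1 of degree
a by the character a. Regular sections then remain regular because characters are regular units. -/
lemma exists_gradingMap [IsVariety (stableLocus δ)] (hδ : CoveredByAffine δ) :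
    ∃ b : diag k L ⊗ stableLocus δ ⟶ stableLocus δ, ∀ a s, pb b (stableFunction δ a s) =
      pb (fst _ _) (character k a) * pb (snd _ _) (stableFunction δ a s) := by
  let S := diag k L ⊗ stableLocus δ
  let p : S ⟶ stableLocus δ := snd _ _
  have hp : IsDominant p.left := inferInstanceAs (IsDominant (snd (diag k L) (stableLocus δ)).left)
  let χ : L →* Γ(S.left, ⊤) := characterHom (fst _ _)
  let e : L →* S.left.functionField :=
    { toFun := fun a => rat S (χ a) * ff p.left (homRat hδ a 1)
      map_one' := by simp [homRat_one]
      map_mul' := fun a b => by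
        rw [map_mul, map_mul, ← mul_one (1 : X.left.functionField), homRat_mul, mul_one, map_mul]
        exact mul_mul_mul_comm _ _ _ _ }
  have he (a f) : (ff p.left).comp (baseRat hδ) f * e a =
      rat S (χ a) * ff p.left (homRat hδ a f) := by
    change ff p.left (baseRat hδ f) * (_ * _) = _
    rw [mul_left_comm, ← map_mul, baseRat_mul_homRat, mul_one]
  obtain ⟨b, hb⟩ := exists_toStable (δ := δ) S ((ff p.left).comp (baseRat hδ)) e
    (fun c => by rw [RingHom.comp_apply, baseRat_scalar, ← rat_pb, pb_scalar])
    (fun a s hs y => by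
      rw [he]
      exact Subring.mul_mem _ (rat_mem_regularAt _ _)
        (ff_mem_regularAt p.left (homRat_mem_regularAt hδ _ hs)))
    (fun y => by
      obtain ⟨a, s, hs, haff, hy⟩ := exists_isUnitAt_homRat hδ (p.left y)
      refine ⟨a, s, hs, haff, ?_⟩
      rw [he]
      exact (isUnitAt_of_isUnit ((Group.isUnit a).map χ) y).mul (hy.ff p.left))
  refine ⟨b, fun a s => rat_injective ?_⟩
  rw [(rat (diag k L ⊗ stableLocus δ)).map_mul, rat_pb (snd (diag k L) (stableLocus δ)),
    ← homRat_section hδ]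
  exact (hb (homogeneous δ a s)).trans ((gradedHom_single _ _ a s.1).trans (he a s.1))

/-- The action on the stable locus that the grading of the section ring induces. -/
lemma exists_gradingAction [IsVariety (stableLocus δ)] (hδ : CoveredByAffine δ) :
    ∃ _ : ModObj (diag k L) (stableLocus δ), IsGradingAction δ := by
  obtain ⟨b, hb⟩ := exists_gradingMap hδ
  refine ⟨modObjOfPoints b ?_ ?_, hb⟩
  · refine hom_ext_stableLocus δ fun a s => ?_
    rw [pb_comp, hb, map_mul, ← pb_comp, ← pb_comp, lift_fst, lift_snd, pb_hom_one_character,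
      one_mul]
  · refine hom_ext_stableLocus δ fun a s => ?_
    rw [pb_comp, pb_comp, hb, map_mul, map_mul, ← pb_comp, ← pb_comp, ← pb_comp, ← pb_comp,
      lift_fst, lift_snd, lift_fst, lift_snd, pb_hom_mul_character, pb_comp (snd _ _) b, hb,
      map_mul, ← pb_comp, ← pb_comp, mul_assoc]

variable {S : Over (Spec (.of k))} [ModObj (diag k L) (stableLocus δ)]

omit [IsVariety X] [Monoid.FG L] [IsMulTorsionFree L] in
lemma pb_actPt_stableFunction {X : Over (Spec (.of k))} [IsIntegral X.left]
    {δ : L →* CartierDivisor X.left} [ModObj (diag k L) (stableLocus δ)]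
    (hact : IsGradingAction δ) (g : S ⟶ diag k L) (z : S ⟶ stableLocus δ) (a s) :
    pb (actPt g z) (stableFunction δ a s) =
      pb g (character k a) * pb z (stableFunction δ a s) := by
  have h : pb (act (diag k L) (stableLocus δ)) (stableFunction δ a s) =
      pb (fst _ _) (character k a) * pb (snd _ _) (stableFunction δ a s) := hact a s
  rw [actPt, pb_comp, h, map_mul, ← pb_comp, ← pb_comp, lift_fst, lift_snd]

omit [Monoid.FG L] [IsMulTorsionFree L] in
-- The section is x ↦ Φ(1, x). The formula for `Φ` on sections says that Φ(g, x) is the translate of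
-- Φ(1, x) by g.
lemma IsTrivialization.hasLocalSection (hact : IsGradingAction δ) {π : stableLocus δ ⟶ X}
    {U : X.left.Opens} {Φ : diag k L ⊗ res X U ⟶ stableLocus δ}
    {g : res (stableLocus δ) (π.left ⁻¹ᵁ U) ⟶ diag k L} (h : IsTrivialization π U Φ g) :
    HasLocalSection (G := diag k L) π U := by
  refine ⟨lift 1 (𝟙 _) ≫ Φ, g, ?_, ?_⟩
  · rw [Category.assoc, h.1, lift_snd_assoc, Category.id_comp]
  · rw [← h.2.1]
    refine hom_ext_stableLocus δ fun a s => ?_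
    obtain ⟨w, hw⟩ := h.2.2 a s
    rw [pb_actPt_stableFunction hact, pb_comp, pb_comp, pb_comp, hw, map_mul, map_mul,
      (pb (lift g (resMap π U))).map_mul, ← pb_comp (lift g _), ← pb_comp (lift g _),
      ← pb_comp (lift 1 _), ← pb_comp (lift 1 _),
      lift_fst, lift_snd, lift_fst, lift_snd, pb_hom_one_character, map_one, one_mul, pb_id]

lemma isUnit_res_of_le {S : Scheme.{u}} {U V : S.Opens} (hU : U ≤ V) {f : Γ(S, V)}
    (h : U ≤ S.basicOpen f) : IsUnit (S.presheaf.map (homOfLE hU).op f) := by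
  have h1 := S.toRingedSpace.isUnit_res_basicOpen f
  have h2 := h1.map (S.presheaf.map (homOfLE h).op).hom
  have h3 : S.presheaf.map (homOfLE hU).op = S.presheaf.map (homOfLE (S.basicOpen_le f)).op ≫
      S.presheaf.map (homOfLE h).op := by
    rw [← Functor.map_comp]; rfl
  rw [h3]
  exact h2

variable [IsIntegral (stableLocus δ).left] {hδ : CoveredByAffine δ} {π : stableLocus δ ⟶ X}
  (hπ : IsProjection hδ π)

include hπ in
-- If g z = h z, then χ_a(g) = χ_a(h) wherever some section of degree a does not vanish. Near a
-- given point a character c is the quotient of two such degrees c a and a: a local generator of 𝒪(δ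
-- c) times a suitable section t of degree a is again a global section, and neither vanishes there.
theorem IsProjection.isFreeAction (hact : IsGradingAction δ) :
    IsFreeAction (diag k L) (stableLocus δ) := by
  intro S g h z hgh
  have key (a s) : pb g (character k a) * pb z (stableFunction δ a s) =
      pb h (character k a) * pb z (stableFunction δ a s) := by
    rw [← pb_actPt_stableFunction hact, ← pb_actPt_stableFunction hact, actPt, actPt, hgh]
  refine diag_ext fun c => section_ext fun p _ => ?_
  obtain ⟨d, hd⟩ := exists_rep (δ c) (π.left (z.left p))
  have hgen := isGeneratorAt_inv_rep hd
  obtain ⟨a, t, ht, -, hpt, -, hr⟩ := hδ.exists_mul_mem hgen.isSectionAt (U := ⊤) trivial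
  have hpr := hgen.mul hpt
  rw [← map_mul] at hpr
  have u1 := hπ.isUnitAt hpt
  have u2 := hπ.isUnitAt hpr
  rw [homRat_section hδ a ⟨t, ht⟩, isUnitAt_rat_iff] at u1
  rw [homRat_section hδ (c * a) ⟨_, hr⟩, isUnitAt_rat_iff] at u2
  have k1 := key a ⟨t, ht⟩
  have k2 := key (c * a) ⟨_, hr⟩
  generalize stableFunction δ a ⟨t, ht⟩ = F₁ at u1 k1
  generalize stableFunction δ (c * a) ⟨_, hr⟩ = F₂ at u2 k2
  let U := S.left.basicOpen (pb z F₁) ⊓ S.left.basicOpen (pb z F₂)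
  have hpU : p ∈ U := by
    refine ⟨?_, ?_⟩
    · exact (SetLike.ext_iff.1 (z.left.preimage_basicOpen_top _) p).1 u1
    · exact (SetLike.ext_iff.1 (z.left.preimage_basicOpen_top _) p).1 u2
  refine ⟨U, le_top, hpU, ?_⟩
  have r1 := isUnit_res_of_le (le_top : U ≤ ⊤) (inf_le_left : U ≤ S.left.basicOpen _)
  have r2 := isUnit_res_of_le (le_top : U ≤ ⊤) (inf_le_right : U ≤ S.left.basicOpen _)
  have e1 := congrArg (S.left.presheaf.map (homOfLE (le_top : U ≤ ⊤)).op) k1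
  have e2 := congrArg (S.left.presheaf.map (homOfLE (le_top : U ≤ ⊤)).op) k2
  have v1 : IsUnit (S.left.presheaf.map (homOfLE (le_top : U ≤ ⊤)).op
    (pb h (character k a))) := ((isUnit_character a).map (pb h)).map (S.left.presheaf.map _).hom
  rw [map_mul, map_mul] at e1
  rw [character_mul, map_mul, map_mul, map_mul, map_mul, map_mul, map_mul] at e2
  have e3 := r1.mul_left_injective e1
  have e4 := r2.mul_left_injective e2
  change _ * _ = _ * _ at e4
  rw [e3] at e4
  exact v1.mul_left_injective e4

end GradingAction

section Invariance

variable {k : Type u} [Field k] {G X : Over (Spec (.of k))} [GrpObj G] [ModObj G X]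
  [IsIntegral X.left] [IsIntegral (G ⊗ X).left]

/-- The pull-backs of local equations of an invariant divisor under the action and under the
projection differ by a unit. -/
lemma isUnitAt_of_mem_invariantDivisors {D : CartierDivisor X.left}
    (hD : D ∈ invariantDivisors G X) (p : (G ⊗ X).left) {d d' : X.left.functionFieldˣ}
    (hd : D.germ ((act G X).left p) = (d : X.left.functionFieldˣ ⧸ unitsAt X.left _))
    (hd' : D.germ ((snd G X).left p) = (d' : X.left.functionFieldˣ ⧸ unitsAt X.left _)) :
    IsUnitAt p (ff (act G X).left d / ff (snd G X).left d') := by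
  obtain ⟨g, h, g', h', e, e', hh, hh', he, he', q, q', A⟩ := hD p
  have u1 := (quotient_eq_iff.1 (hd.symm.trans he)).ff (act G X).left
  have u2 := (quotient_eq_iff.1 (hd'.symm.trans he')).ff (snd G X).left
  have u3 : IsUnitAt p (ff (act G X).left e / ff (snd G X).left e') := by
    obtain ⟨v, hv⟩ := A
    have hv' : IsUnitAt p (algebraMap ((G ⊗ X).left.presheaf.stalk p) (G ⊗ X).left.functionField v) :=
      ⟨v, v.isUnit, rfl⟩
    have E := congrArg (algebraMap _ (G ⊗ X).left.functionField) hv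
    simp only [map_mul, ← ff_algebraMap, ← q, ← q'] at E
    have n1 : ff (act G X).left (algebraMap _ X.left.functionField h) ≠ 0 :=
      (map_ne_zero _).2 ((map_ne_zero_iff _ (algebraMap_stalk_injective _)).2 hh)
    have n2 : ff (snd G X).left (algebraMap _ X.left.functionField h') ≠ 0 :=
      (map_ne_zero _).2 ((map_ne_zero_iff _ (algebraMap_stalk_injective _)).2 hh')
    have n3 : ff (snd G X).left e' ≠ 0 := (map_ne_zero _).2 e'.ne_zero
    have n4 := hv'.ne_zero
    convert hv'.inv using 1
    rw [div_eq_iff n3, eq_inv_mul_iff_mul_eq₀ n4]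
    apply mul_left_cancel₀ (mul_ne_zero n1 n2)
    linear_combination E
  convert (u1.mul u3).div u2 using 1
  have n1 : ff (act G X).left e ≠ 0 := (map_ne_zero _).2 e.ne_zero
  have n2 : ff (snd G X).left e' ≠ 0 := (map_ne_zero _).2 e'.ne_zero
  have n3 : ff (snd G X).left d' ≠ 0 := (map_ne_zero _).2 d'.ne_zero
  rw [map_div₀, map_div₀]
  field_simp

end Invariance

section TorusAction

variable {k : Type u} [Field k] {X : Over (Spec (.of k))} [IsVariety X] {L : Type u}
  [CommGroup L] {δ : L →* CartierDivisor X.left} [Monoid.FG L] [IsMulTorsionFree L]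
  [IsVariety (stableLocus δ)] {hδ : CoveredByAffine δ} {π : stableLocus δ ⟶ X}
  [Surjective π.left] (hπ : IsProjection hδ π) {M : Type u} [CommGroup M] [Monoid.FG M]
  [IsMulTorsionFree M] [ModObj (diag k M) X]

instance surjective_comp_left {S T U : Over (Spec (.of k))} (f : S ⟶ T) (g : T ⟶ U)
    [Surjective f.left] [Surjective g.left] : Surjective (f ≫ g).left :=
  inferInstanceAs (Surjective (f.left ≫ g.left))

variable (M π) in
/-- The morphism `(t, y) ↦ t π(y)`. -/
abbrev twist : diag k M ⊗ stableLocus δ ⟶ X := (diag k M ◁ π) ≫ act (diag k M) X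

variable (M hδ) in
/-- The pull-back to `T × Y` of the constant `1` of degree `a`. -/
def degreeHom : L →* (diag k M ⊗ stableLocus δ).left.functionField where
  toFun a := ff (snd (diag k M) (stableLocus δ)).left (homRat hδ a 1)
  map_one' := by rw [homRat_one, map_one]
  map_mul' a b := by
    rw [← mul_one (1 : X.left.functionField), homRat_mul, mul_one, map_mul]

include hπ in
-- With a local equation d' at π(y), the constant 1 of degree a is d' times the unit 1/d' of degree
-- a. Invariance of δ a says that d' and the pull-back of d along the twisted map differ by a unit
-- at q. So the rule that multiplies the twisted pull-back of f by the constant 1 of degree a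
-- produces, up to a unit, the pull-back of f d.
lemma IsProjection.twist_eq (q : (diag k M ⊗ stableLocus δ).left) (hinv : ∀ a, δ a ∈ invariantDivisors (diag k M) X)
    {a : L} {d : X.left.functionFieldˣ} (hd : (δ a).germ ((twist π M).left q) =
      (d : X.left.functionFieldˣ ⧸ unitsAt X.left _)) (f : X.left.functionField) :
    ∃ v, IsUnitAt q v ∧ ff (twist π M).left f * degreeHom hδ M a =
      ff (twist π M).left (f * d) * v := by
  have hπd := hπ.isDominant
  obtain ⟨d', hd'⟩ := exists_rep (δ a) (π.left ((snd _ _ : diag k M ⊗ stableLocus δ ⟶ _).left q))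
  have e1 : (snd (diag k M) X).left ((diag k M ◁ π).left q) =
      π.left ((snd (diag k M) (stableLocus δ)).left q) := by
    rw [← comp_left_apply, ← comp_left_apply, whiskerLeft_snd]
  have hd2 : (δ a).germ ((snd (diag k M) X).left ((diag k M ◁ π).left q)) =
      (d' : X.left.functionFieldˣ ⧸ unitsAt X.left _) := by
    rw [e1]; exact hd'
  have u1 := (isUnitAt_of_mem_invariantDivisors (hinv a) ((diag k M ◁ π).left q) hd hd2).ff
    (diag k M ◁ π).left
  have u2 := (hπ.isUnitAt (isGeneratorAt_inv_rep hd')).ff (snd (diag k M) (stableLocus δ)).left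
  have e2 : ff (diag k M ◁ π).left (ff (act (diag k M) X).left d) = ff (twist π M).left d :=
    (ff_comp (diag k M ◁ π).left (act (diag k M) X).left _).symm
  have e3 : ff (diag k M ◁ π).left (ff (snd (diag k M) X).left d') =
      ff (snd (diag k M) (stableLocus δ)).left (baseRat hδ d') := by
    rw [← hπ.ff_eq]
    refine (ff_comp (diag k M ◁ π).left (snd (diag k M) X).left _).symm.trans
      (Eq.trans ?_ (ff_comp (snd (diag k M) (stableLocus δ)).left π.left _))
    exact ff_congr (congrArg Over.Hom.left (whiskerLeft_snd (diag k M) π)) _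
  rw [map_div₀, e2, e3] at u1
  refine ⟨_, u2.div u1, ?_⟩
  have e4 : homRat hδ a (d' : X.left.functionField)⁻¹ * baseRat hδ d' = homRat hδ a 1 := by
    rw [mul_comm, baseRat_mul_homRat, mul_inv_cancel₀ d'.ne_zero]
  have n : ff (twist π M).left (d : X.left.functionField) ≠ 0 := (map_ne_zero _).2 d.ne_zero
  change _ * ff (snd (diag k M) (stableLocus δ)).left (homRat hδ a 1) = _
  rw [← e4, map_mul, map_mul]
  field_simp

include hπ in
lemma IsProjection.exists_torusMap (hinv : ∀ a, δ a ∈ invariantDivisors (diag k M) X) :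
    ∃ b : diag k M ⊗ stableLocus δ ⟶ stableLocus δ, ∀ F : sectionRing δ,
      rat _ (pb b (stableFn δ F)) = gradedHom (ff (twist π M).left) (degreeHom hδ M) F.1 := by
  refine exists_toStable (δ := δ) _ (ff (twist π M).left) (degreeHom hδ M)
    (fun c => by rw [← rat_pb, pb_scalar]) (fun a s hs q => ?_) (fun q => ?_)
  · obtain ⟨d, hd⟩ := exists_rep (δ a) ((twist π M).left q)
    obtain ⟨v, hv, e⟩ := hπ.twist_eq q hinv hd s
    rw [e]
    exact Subring.mul_mem _ (ff_mem_regularAt _ ((isSectionAt_iff_mem hd).1 (hs _))) hv.mem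
  · obtain ⟨a, s, hs, haff, hq⟩ := hδ ((twist π M).left q)
    obtain ⟨d, hd⟩ := exists_rep (δ a) ((twist π M).left q)
    obtain ⟨v, hv, e⟩ := hπ.twist_eq q hinv hd s
    refine ⟨a, s, hs, haff, ?_⟩
    rw [e]
    exact (((isGeneratorAt_iff_isUnitAt hd).1 hq).ff _).mul hv

include hπ in
/-- The stable locus has an action for which the projection is equivariant. -/
theorem IsProjection.exists_torusAction (hinv : ∀ a, δ a ∈ invariantDivisors (diag k M) X) :
    ∃ _ : ModObj (diag k M) (stableLocus δ), IsEquivariant (diag k M) π := by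
  have hsep := IsVariety.isSeparated (X := X)
  have hπd := hπ.isDominant
  obtain ⟨b, hb⟩ := hπ.exists_torusMap hinv
  have hb' (a) (s : globalSections (δ a)) : rat _ (pb b (stableFunction δ a s)) =
      ff (twist π M).left s.1 * ff (snd (diag k M) (stableLocus δ)).left (homRat hδ a 1) :=
    (hb (homogeneous δ a s)).trans (gradedHom_single _ _ a s.1)
  -- the unit acts trivially
  let j : stableLocus δ ⟶ diag k M ⊗ stableLocus δ := lift 1 (𝟙 _)
  have j1 : j ≫ twist π M = π := by
    have : j ≫ (diag k M ◁ π) = lift 1 π := by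
      ext1 <;> simp [j]
    rw [twist, reassoc_of% this]
    exact one_actPt π
  have j2 : j ≫ snd _ _ = 𝟙 _ := lift_snd _ _
  have h1 : j ≫ b = 𝟙 _ := by
    refine hom_ext_stableLocus δ fun a s => rat_injective ?_
    have p1 := pulls_rat j (pb b (stableFunction δ a s))
    have d1 : IsDominant (j ≫ twist π M).left := by rw [j1]; exact hπd
    have d2 : IsDominant (j ≫ snd _ _).left := by
      rw [j2]; exact inferInstanceAs (IsDominant (𝟙 _))
    have p2 := (pulls_ff j (twist π M) s.1).mul (pulls_ff j (snd _ _) (homRat hδ a 1))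
    have : IsDominant (𝟙 (stableLocus δ) : stableLocus δ ⟶ stableLocus δ).left :=
      inferInstanceAs (IsDominant (𝟙 (stableLocus δ).left))
    rw [hb'] at p1
    rw [pb_comp, pb_id, p1.unique p2, ff_congr (congrArg Over.Hom.left j1),
      ff_congr (congrArg Over.Hom.left j2), hπ.ff_eq]
    have e : ff (𝟙 (stableLocus δ) : stableLocus δ ⟶ stableLocus δ).left (homRat hδ a 1) =
      homRat hδ a 1 := ff_id _
    rw [e, baseRat_mul_homRat, mul_one, homRat_section]
  have hbs : Surjective b.left := by
    have h : Surjective (j.left ≫ b.left) := by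
      rw [← Over.comp_left, h1]
      exact inferInstanceAs (Surjective (𝟙 (stableLocus δ).left))
    exact Surjective.of_comp j.left _
  -- Both sides are dominant and agree on rational functions, since in degree zero `b` is the
  -- twisted pull-back by construction.
  have hbπ : b ≫ π = twist π M := by
    refine over_ext_of_ff fun f => ?_
    refine (ff_comp b.left π.left f).trans ?_
    rw [hπ.ff_eq, baseRat_apply, ff_homRat hδ hb, map_one, mul_one]
  -- The constants 1 of degree a are invariant, so associativity on Y reduces to associativity of
  -- the action on X.
  have hb1 (a) : ff b.left (homRat hδ a 1) = ff (snd (diag k M) (stableLocus δ)).left (homRat hδ a 1) := by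
    rw [ff_homRat hδ hb, map_one, one_mul]; rfl
  -- associativity
  let h : (diag k M) ⊗ ((diag k M) ⊗ (stableLocus δ)) ⟶ (diag k M) ⊗ (stableLocus δ) := lift (fst (diag k M) ((diag k M) ⊗ (stableLocus δ)) * (snd (diag k M) ((diag k M) ⊗ (stableLocus δ)) ≫ fst (diag k M) (stableLocus δ)))
    (snd (diag k M) ((diag k M) ⊗ (stableLocus δ)) ≫ snd (diag k M) (stableLocus δ))
  let h' : (diag k M) ⊗ ((diag k M) ⊗ (stableLocus δ)) ⟶ (diag k M) ⊗ (stableLocus δ) := lift (fst (diag k M) ((diag k M) ⊗ (stableLocus δ))) (snd (diag k M) ((diag k M) ⊗ (stableLocus δ)) ≫ b)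
  have w1 : h ≫ twist π M = h' ≫ twist π M := by
    have e1 : h ≫ ((diag k M) ◁ π) = lift (fst (diag k M) ((diag k M) ⊗ (stableLocus δ)) * (snd (diag k M) ((diag k M) ⊗ (stableLocus δ)) ≫ fst (diag k M) (stableLocus δ)))
        (snd (diag k M) ((diag k M) ⊗ (stableLocus δ)) ≫ snd (diag k M) (stableLocus δ) ≫ π) := by
      ext1 <;> simp [h]
    have e2 : h' ≫ ((diag k M) ◁ π) = lift (fst (diag k M) ((diag k M) ⊗ (stableLocus δ))) (snd (diag k M) ((diag k M) ⊗ (stableLocus δ)) ≫ b ≫ π) := by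
      ext1 <;> simp [h']
    have e3 : twist π M = actPt (fst (diag k M) (stableLocus δ)) (snd (diag k M) (stableLocus δ) ≫ π) := by
      have : (diag k M) ◁ π = lift (fst (diag k M) (stableLocus δ)) (snd (diag k M) (stableLocus δ) ≫ π) := by ext1 <;> simp
      rw [twist, this]; rfl
    rw [twist, reassoc_of% e1, reassoc_of% e2, hbπ, e3, comp_actPt]
    exact mul_actPt _ _ _
  have hs : Surjective h'.left := by
    have : h' = (diag k M) ◁ b := by ext1 <;> simp [h']
    rw [this]
    infer_instance
  have w2 : h ≫ snd (diag k M) (stableLocus δ) = snd (diag k M) ((diag k M) ⊗ (stableLocus δ)) ≫ snd (diag k M) (stableLocus δ) := lift_snd _ _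
  have w3 : h' ≫ snd (diag k M) (stableLocus δ) = snd (diag k M) ((diag k M) ⊗ (stableLocus δ)) ≫ b := lift_snd _ _
  have h2 : h ≫ b = h' ≫ b := by
    refine hom_ext_stableLocus δ fun a s => rat_injective ?_
    have d1 : IsDominant (h' ≫ twist π M).left := inferInstance
    have d1' : IsDominant (h ≫ twist π M).left := by rw [w1]; exact d1
    have d2 : IsDominant (h ≫ snd (diag k M) (stableLocus δ)).left := by rw [w2]; infer_instance
    have d3 : IsDominant (h' ≫ snd (diag k M) (stableLocus δ)).left := by rw [w3]; infer_instance
    have p1 := pulls_rat h (pb b (stableFunction δ a s))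
    have p1' := pulls_rat h' (pb b (stableFunction δ a s))
    rw [hb'] at p1 p1'
    have p2 := (pulls_ff h (twist π M) s.1).mul (pulls_ff h (snd (diag k M) (stableLocus δ)) (homRat hδ a 1))
    have p2' := (pulls_ff h' (twist π M) s.1).mul (pulls_ff h' (snd (diag k M) (stableLocus δ)) (homRat hδ a 1))
    rw [pb_comp, pb_comp, p1.unique p2, p1'.unique p2', ff_congr (congrArg Over.Hom.left w1),
      ff_congr (congrArg Over.Hom.left w2), ff_congr (congrArg Over.Hom.left w3)]
    congr 1
    refine (ff_comp (snd (diag k M) ((diag k M) ⊗ (stableLocus δ))).left (snd (diag k M) (stableLocus δ)).left _).trans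
      (Eq.trans ?_ (ff_comp (snd (diag k M) ((diag k M) ⊗ (stableLocus δ))).left b.left _).symm)
    rw [hb1]
  exact ⟨modObjOfPoints b h1 h2, hbπ⟩

end TorusAction

/-! ### From an invariant ample family to the stable locus, and from there to a torus quotient -/

section Natural

variable {k : Type u} [Field k] {X : Over (Spec (.of k))} [IsVariety X] {L : Type u}
  [CommGroup L] {δ : L →* CartierDivisor X.left} [Monoid.FG L] [IsMulTorsionFree L]

lemma CoveredByAffine.nonempty_stableLocus (hδ : CoveredByAffine δ) :
    Nonempty (stableLocus δ).left := by
  obtain ⟨a, s, hs, haff, hx⟩ := hδ (genericPoint X.left)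
  have h0 : homogeneous δ a ⟨s, hs⟩ ≠ 0 := fun h => by
    refine IsGeneratorAt.ne_zero hx ?_
    simpa [homogeneous] using congrArg Subtype.val h
  have h1 : (⊥ : PrimeSpectrum (sectionRing δ)) ∈
      PrimeSpectrum.basicOpen (homogeneous δ a ⟨s, hs⟩) := h0
  exact ⟨resPt (S := sp k (sectionRing δ)) (stableOpen δ) _
    (TopologicalSpace.Opens.mem_iSup.2 ⟨a, TopologicalSpace.Opens.mem_iSup.2 ⟨⟨s, hs⟩,
      TopologicalSpace.Opens.mem_iSup.2 ⟨haff, h1⟩⟩⟩)⟩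

variable {hδ : CoveredByAffine δ} {π : stableLocus δ ⟶ X}

/-- The function field of X sits in degree zero, where the grading action is trivial. -/
lemma IsProjection.invariant [IsVariety (stableLocus δ)] (hπ : IsProjection hδ π)
    [ModObj (diag k L) (stableLocus δ)] (hact : IsGradingAction δ) :
    act (diag k L) (stableLocus δ) ≫ π = snd _ _ ≫ π := by
  have hsep := IsVariety.isSeparated (X := X)
  have hπd := hπ.isDominant
  let p : diag k L ⊗ stableLocus δ ⟶ stableLocus δ := snd _ _
  have hp : IsDominant p.left := inferInstanceAs (IsDominant (snd (diag k L) (stableLocus δ)).left)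
  let e : L →* (diag k L ⊗ stableLocus δ).left.functionField :=
    { toFun := fun a => rat _ (pb (fst _ _) (character k a)) * ff p.left (homRat hδ a 1)
      map_one' := by simp [homRat_one]
      map_mul' := fun a b => by
        rw [character_mul, map_mul, map_mul, ← mul_one (1 : X.left.functionField), homRat_mul,
          mul_one, map_mul]
        exact mul_mul_mul_comm _ _ _ _ }
  have H (F : sectionRing δ) : rat _ (pb (act (diag k L) (stableLocus δ)) (stableFn δ F)) =
      gradedHom ((ff p.left).comp (baseRat hδ)) e F.1 := by
    induction F using sectionRing_induction with
    | add F H hF hH =>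
      rw [map_add, map_add, map_add, hF, hH, ← map_add]; rfl
    | single a s =>
      refine (congrArg _ (hact a s)).trans (Eq.trans ?_ (gradedHom_single _ _ a s.1).symm)
      have e1 : ff p.left (baseRat hδ s.1) * ff p.left (homRat hδ a 1) =
          rat _ (pb p (stableFunction δ a s)) := by
        rw [← map_mul, baseRat_mul_homRat, mul_one, homRat_section, rat_pb]
      change rat _ (pb (fst _ _) (character k a) * pb p (stableFunction δ a s)) =
        ff p.left (baseRat hδ s.1) *
          (rat _ (pb (fst _ _) (character k a)) * ff p.left (homRat hδ a 1))
      rw [mul_left_comm, e1]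
      exact map_mul _ _ _
  have d1 : IsDominant (act (diag k L) (stableLocus δ) ≫ π).left :=
    inferInstanceAs (IsDominant ((act (diag k L) (stableLocus δ)).left ≫ π.left))
  have d2 : IsDominant (snd (diag k L) (stableLocus δ) ≫ π).left :=
    inferInstanceAs (IsDominant ((snd (diag k L) (stableLocus δ)).left ≫ π.left))
  refine over_ext_of_ff fun f => ?_
  refine (ff_comp (act (diag k L) (stableLocus δ)).left π.left f).trans
    (Eq.trans ?_ (ff_comp (snd (diag k L) (stableLocus δ)).left π.left f).symm)
  rw [hπ.ff_eq, baseRat_apply, ff_homRat hδ H, map_one, mul_one]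
  rfl

lemma IsProjection.isNaturalMap [IsIntegral (stableLocus δ).left] (hπ : IsProjection hδ π) :
    IsNaturalMap δ π := by
  intro a s _
  have hπd := hπ.isDominant
  refine ⟨?_, fun t f h => ?_⟩
  · ext y
    exact (hπ.isUnitAt_iff s.2).symm.trans (mem_stable_iff hδ)
  · by_cases hg : genericPoint X.left ∈ nonvanishing (δ a) s.1
    · have hg' := genericPoint_mem_preimage π.left hg
      refine toK_injective _ hg' ?_
      rw [map_mul, ← ff_toK π.left _ hg, toK_map, toK_map, hπ.ff_eq]
      refine Eq.trans ?_ (homRat_section hδ a t)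
      refine (congrArg _ (homRat_section hδ a s).symm).trans ?_
      rw [baseRat_mul_homRat, ← h _ hg, algebraMap_germ]
    -- A nonempty open set contains the generic point, so in this case X_s is empty and both sides
    -- lie in the zero ring.
    · have hb : nonvanishing (δ a) s.1 = ⊥ := by
        rw [eq_bot_iff]
        exact fun x hx => hg (genericPoint_mem hx)
      have : Subsingleton Γ((stableLocus δ).left, π.left ⁻¹ᵁ nonvanishing (δ a) s.1) := by
        rw [hb]
        exact CommRingCat.subsingleton_of_isTerminal (stableLocus δ).left.sheaf.isTerminalOfEmpty
      exact Subsingleton.elim _ _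

/-- The stable locus is a variety that has all the properties of a universal torsor. -/
theorem CoveredByAffine.exists_quotient [Module.Free ℤ (Additive L)]
    [Module.Finite ℤ (Additive L)] (hδ : CoveredByAffine δ) {M : Type u} [CommGroup M]
    [Monoid.FG M] [IsMulTorsionFree M] [ModObj (diag k M) X]
    (hinv : ∀ a, δ a ∈ invariantDivisors (diag k M) X) :
    ∃ (_ : ModObj (diag k L) (stableLocus δ)) (_ : ModObj (diag k M) (stableLocus δ))
      (π : stableLocus δ ⟶ X), IsGradingAction δ ∧ IsNaturalMap δ π ∧
        IsFreeAction (diag k L) (stableLocus δ) ∧ IsGeometricQuotient (diag k L) π ∧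
        IsVariety (stableLocus δ) ∧ IsEquivariant (diag k M) π := by
  have := hδ.nonempty_stableLocus
  have := isIntegral_stableLocus δ
  obtain ⟨π, ⟨h1, h2⟩, h3⟩ := exists_projection hδ
  have hπ : IsProjection hδ π := ⟨h1, h2 h1, h3⟩
  have H : ∀ x : X.left, ∃ U : X.left.Opens, x ∈ U ∧ ∃ Φ g, IsTrivialization (δ := δ) π U Φ g := by
    intro x
    obtain ⟨U, hx, d, hd⟩ := exists_localEquations δ x
    exact ⟨U, hx, hπ.exists_trivialization hx d hd⟩
  have hv := isVariety_stableLocus H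
  obtain ⟨i1, hact⟩ := exists_gradingAction hδ
  have H' : ∀ x : X.left, ∃ U : X.left.Opens, x ∈ U ∧ HasLocalSection (G := diag k L) π U := by
    intro x
    obtain ⟨U, hx, Φ, g, h⟩ := H x
    exact ⟨U, hx, h.hasLocalSection hact⟩
  have : Surjective π.left := ⟨surjective_of_local H'⟩
  obtain ⟨i2, heq⟩ := hπ.exists_torusAction hinv
  exact ⟨i1, i2, π, hact, hπ.isNaturalMap, hπ.isFreeAction hact,
    isGeometricQuotient_of_local (hπ.invariant hact) H', hv, heq⟩

end Natural

section Family

variable {k : Type u} [Field k] {G X : Over (Spec (.of k))} [GrpObj G] [ModObj G X]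
  [IsIntegral X.left] {m : ℕ}

lemma exists_principal_mul {D E : CartierDivisor X.left} (h : picClass D = picClass E) :
    ∃ f, E = D * principal f := by
  obtain ⟨f, hf⟩ := (isoSheaves_one_iff _).1 (QuotientGroup.eq.1 h)
  exact ⟨f, by rw [← hf, mul_inv_cancel_left]⟩

lemma isSectionAt_mul_principal {D : CartierDivisor X.left} (f : X.left.functionFieldˣ)
    {x : X.left} {s : X.left.functionField} (h : IsSectionAt D x s) :
    IsSectionAt (D * principal f) x (s * (f : X.left.functionField)⁻¹) := by
  obtain ⟨d, hd⟩ := exists_rep D x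
  rw [isSectionAt_iff_mem hd] at h
  rw [isSectionAt_iff_mem (germ_mul_eq hd (E := principal f) (e := f) rfl), Units.val_mul]
  convert h using 1
  have := f.ne_zero
  field_simp

lemma isGeneratorAt_mul_principal {D : CartierDivisor X.left} (f : X.left.functionFieldˣ)
    {x : X.left} {s : X.left.functionField} :
    IsGeneratorAt (D * principal f) x (s * (f : X.left.functionField)⁻¹) ↔
      IsGeneratorAt D x s := by
  obtain ⟨d, hd⟩ := exists_rep D x
  rw [isGeneratorAt_iff_isUnitAt hd,
    isGeneratorAt_iff_isUnitAt (germ_mul_eq hd (E := principal f) (e := f) rfl), Units.val_mul]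
  have := f.ne_zero
  have e : s * (f : X.left.functionField)⁻¹ * (d * f) = s * d := by field_simp
  rw [e]

/-- An invariant ample family yields a covering by affine nonvanishing loci of sections of the
divisors `δ a`. -/
lemma HasInvariantAmpleFamily.coveredByAffine (h : HasInvariantAmpleFamily G X) (hm : 0 < m)
    {δ : classGroup G X m →* CartierDivisor X.left}
    (hδ : ∀ a, picClass (δ a) = (a : Pic X.left)) : CoveredByAffine δ := by
  obtain ⟨q, D, h⟩ := h
  intro x
  obtain ⟨i, n, s, -, hs, haff, hx⟩ := h x
  -- From here on `m + 1` plays the role of the given multiplier. The class of (m + 1) n D_i lies in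
  -- Λ, so the chosen divisor of that class differs from it by the divisor of some f, and s^(m+1)/f
  -- is a section with the same nonvanishing locus as s.
  obtain ⟨m, rfl⟩ := Nat.exists_eq_succ_of_ne_zero hm.ne'
  let a : classGroup G X (m + 1) := ⟨_, D i ^ n, rfl⟩
  obtain ⟨f, hf⟩ := exists_principal_mul (D := ((D i : CartierDivisor X.left) ^ n) ^ (m + 1))
    (E := δ a) (by rw [hδ]; rfl)
  have e : nonvanishing (δ a) (s ^ (m + 1) * (f : X.left.functionField)⁻¹) =
      nonvanishing ((D i : CartierDivisor X.left) ^ n) s := by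
    rw [← nonvanishing_pow hs m, hf]
    ext x
    exact isGeneratorAt_mul_principal f
  refine ⟨a, _, fun y => ?_, e ▸ haff, e ▸ hx⟩
  rw [hf]
  exact isSectionAt_mul_principal f ((hs y).pow (m + 1))

lemma fg_classGroup (hfg : Group.FG (invariantDivisors G X)) : Group.FG (classGroup G X m) :=
  Group.fg_of_surjective (MonoidHom.rangeRestrict_surjective
    ((picClass.comp (powMonoidHom m)).comp (invariantDivisors G X).subtype))

lemma isMulTorsionFree_of_free {L : Type*} [CommGroup L] [Module.Free ℤ (Additive L)] :
    IsMulTorsionFree L := by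
  refine ⟨fun n hn a b h => ?_⟩
  have h1 : (n : ℤ) • Additive.ofMul a = (n : ℤ) • Additive.ofMul b := by
    rw [natCast_zsmul, natCast_zsmul, ← ofMul_pow, ← ofMul_pow]
    exact congrArg _ h
  exact smul_right_injective (Additive L) (Int.natCast_ne_zero.2 hn) h1

end Family

section Transfer

variable {k : Type u} [Field k] {G G' Z X : Over (Spec (.of k))} [GrpObj G] [GrpObj G']
  [ModObj G Z] [ModObj G' Z] {φ : G' ⟶ G} [IsIso φ]

omit [Field k] [GrpObj G] [GrpObj G'] [ModObj G Z] [ModObj G' Z] [IsIso φ] in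
lemma appLE_eq_appLE_iff {P' P Z : Scheme.{u}} {ψ : P' ⟶ P} [IsIso ψ] {a s : P ⟶ Z}
    {a' s' : P' ⟶ Z} (ha : a' = ψ ≫ a) (hs : s' = ψ ≫ s) {V : Z.Opens} {W : P.Opens}
    {W' : P'.Opens} (hW : W' = ψ ⁻¹ᵁ W) (e₁ : W ≤ a ⁻¹ᵁ V) (e₂ : W ≤ s ⁻¹ᵁ V)
    (e₁' : W' ≤ a' ⁻¹ᵁ V) (e₂' : W' ≤ s' ⁻¹ᵁ V) (f : Γ(Z, V)) :
    a.appLE V W e₁ f = s.appLE V W e₂ f ↔ a'.appLE V W' e₁' f = s'.appLE V W' e₂' f := by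
  subst ha hs hW
  rw [← appLE_appLE ψ a e₁ le_rfl, ← appLE_appLE ψ s e₂ le_rfl, ← Scheme.Hom.app_eq_appLE]
  exact (ConcreteCategory.bijective_of_isIso (ψ.app W)).1.eq_iff.symm

lemma IsFreeAction.of_iso (h : act G' Z = φ ▷ Z ≫ act G Z) (hf : IsFreeAction G Z) :
    IsFreeAction G' Z := by
  intro S g g' z hg
  rw [← cancel_mono φ]
  refine hf S _ _ z ?_
  rw [h, lift_whiskerRight_assoc, lift_whiskerRight_assoc] at hg
  exact hg

/-- The two actions differ by an isomorphism of the source G' × Z ≅ G × Z, which affects neither the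
image of the orbit map nor the equality of two pull-backs of a function. -/
theorem IsGeometricQuotient.of_iso (h : act G' Z = φ ▷ Z ≫ act G Z) {π : Z ⟶ X}
    (hπ : IsGeometricQuotient G π) : IsGeometricQuotient G' π := by
  have h1 : (act G' Z).left = (φ ▷ Z).left ≫ (act G Z).left := congrArg Over.Hom.left h
  have h2 : (snd G' Z).left = (φ ▷ Z).left ≫ (snd G Z).left :=
    congrArg Over.Hom.left (whiskerRight_snd φ Z).symm
  have inv : (act G' Z).left ≫ π.left = (snd G' Z).left ≫ π.left := by
    rw [h1, h2, Category.assoc, Category.assoc, hπ.invariant]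
  have hiso : IsIso (φ ▷ Z).left := inferInstanceAs (IsIso ((Over.forget _).map (φ ▷ Z)))
  refine ⟨inv, hπ.surjective, ?_, hπ.isQuotientMap, hπ.injective, fun U f => ?_⟩
  · have e : Limits.pullback.lift (f := π.left) (g := π.left) (act G' Z).left (snd G' Z).left inv =
        (φ ▷ Z).left ≫ Limits.pullback.lift (f := π.left) (g := π.left) (act G Z).left
          (snd G Z).left hπ.invariant := by
      apply Limits.pullback.hom_ext
      · rw [Limits.pullback.lift_fst, Category.assoc, Limits.pullback.lift_fst, h1]
      · rw [Limits.pullback.lift_snd, Category.assoc, Limits.pullback.lift_snd, h2]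
    have := hπ.orbits
    rw [e]
    infer_instance
  · rw [hπ.functions]
    exact appLE_eq_appLE_iff h1 h2 (by rw [h2]; rfl) _ _ _ _ f

end Transfer

section Torus

variable {k : Type u} [Field k] {L M : Type u} [CommGroup L] [CommGroup M]

/-- The isomorphism of diagonalizable groups given by an isomorphism of character groups. -/
def diagIso (e : L ≃* M) : diag k M ≅ diag k L where
  hom := toDiag _ ⟨⟨fun a => character k (e a), by simp⟩, fun a b => by simp⟩
  inv := toDiag _ ⟨⟨fun a => character k (e.symm a), by simp⟩, fun a b => by simp⟩
  hom_inv_id := diag_ext fun m => by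
    rw [pb_comp, pb_toDiag, pb_id]
    exact (pb_toDiag _ _ _).trans (congrArg (character k) (e.apply_symm_apply m))
  inv_hom_id := diag_ext fun m => by
    rw [pb_comp, pb_toDiag, pb_id]
    exact (pb_toDiag _ _ _).trans (congrArg (character k) (e.symm_apply_apply m))

lemma pb_comp_diagIso (e : L ≃* M) {S : Over (Spec (.of k))} (g : S ⟶ diag k M) (a : L) :
    pb (g ≫ (diagIso e).hom) (character k a) = pb g (character k (e a)) := by
  rw [pb_comp]
  exact congrArg _ (pb_toDiag _ _ _)

/-- The transport of an action along an isomorphism of diagonalizable groups. -/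
lemma exists_modObj_of_mulEquiv (e : L ≃* M) (Z : Over (Spec (.of k))) [ModObj (diag k L) Z] :
    ∃ _ : ModObj (diag k M) Z,
      act (diag k M) Z = (diagIso e).hom ▷ Z ≫ act (diag k L) Z := by
  have h {S : Over (Spec (.of k))} (g : S ⟶ diag k M) (z : S ⟶ Z) :
      lift g z ≫ (diagIso e).hom ▷ Z ≫ act (diag k L) Z = actPt (g ≫ (diagIso e).hom) z := by
    rw [lift_whiskerRight_assoc]; rfl
  refine ⟨modObjOfPoints ((diagIso e).hom ▷ Z ≫ act (diag k L) Z) ?_ ?_, rfl⟩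
  · have : (1 : Z ⟶ diag k M) ≫ (diagIso e).hom = 1 := diag_ext fun a => by
      rw [pb_comp_diagIso, pb_hom_one_character, pb_hom_one_character]
    rw [h, this, one_actPt]
  · have h3 : (diagIso e).hom ▷ Z ≫ act (diag k L) Z =
        actPt (fst (diag k M) Z ≫ (diagIso e).hom) (snd (diag k M) Z) := by
      rw [← h, lift_fst_snd, Category.id_comp]
    have h4 : ∀ {S : Over (Spec (.of k))} (f g : S ⟶ diag k M), (f * g) ≫ (diagIso e).hom =
        (f ≫ (diagIso e).hom) * (g ≫ (diagIso e).hom) := fun f g => diag_ext fun a => by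
      rw [pb_comp_diagIso, pb_hom_mul_character, pb_hom_mul_character, pb_comp_diagIso,
        pb_comp_diagIso]
    rw [h, h, h3, comp_actPt, h4, mul_actPt, Category.assoc]

lemma exists_mulEquiv_torus (L : Type u) [CommGroup L] [Module.Free ℤ (Additive L)]
    [Module.Finite ℤ (Additive L)] :
    ∃ s : ℕ, Nonempty (L ≃* ULift.{u} (Multiplicative (Fin s → ℤ))) := by
  let e := (Module.finBasis ℤ (Additive L)).equivFun.toAddEquiv
  exact ⟨_, ⟨(AddEquiv.toMultiplicativeRight e).trans MulEquiv.ulift.symm⟩⟩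

end Torus

section QuasiAffine

variable {k : Type u} [Field k] {X : Over (Spec (.of k))} [IsIntegral X.left] {L : Type u}
  [CommGroup L] {δ : L →* CartierDivisor X.left}

lemma isQuasiAffine_stableLocus [IsVariety (stableLocus δ)] :
    (stableLocus δ).left.IsQuasiAffine :=
  have : IsAffine (sp k (sectionRing δ)).left :=
    inferInstanceAs (IsAffine (Spec (.of (sectionRing δ))))
  have : IsImmersion (stableInc δ).left := inferInstanceAs (IsImmersion (stableOpen δ).ι)
  Scheme.IsQuasiAffine.of_isImmersion (stableInc δ).left

end QuasiAffine

/-! ### Actions of diagonalizable groups as gradings of global functions -/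

section Expansion

variable {k : Type u} [Field k] {M : Type u} [CommGroup M] {S S' E : Over (Spec (.of k))}

/-- The function `∑ χ_m(g) a_m(z)`. -/
def expand (g : S ⟶ diag k M) (z : S ⟶ E) : MonoidAlgebra Γ(E.left, ⊤) M →+* Γ(S.left, ⊤) :=
  MonoidAlgebra.liftNCRingHom (pb z) (characterHom g) fun _ _ => mul_comm _ _

@[simp]
lemma expand_single (g : S ⟶ diag k M) (z : S ⟶ E) (m : M) (a) :
    expand g z (MonoidAlgebra.single m a) = pb g (character k m) * pb z a :=
  (MonoidAlgebra.liftNCRingHom_single _ _ _ _ _).trans (mul_comm _ _)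

lemma pb_expand (f : S' ⟶ S) (g : S ⟶ diag k M) (z : S ⟶ E) (F) :
    pb f (expand g z F) = expand (f ≫ g) (f ≫ z) F := by
  induction F using MonoidAlgebra.induction_linear with
  | zero => simp
  | add F H hF hH => rw [map_add, map_add, map_add, hF, hH]
  | single m a => rw [expand_single, expand_single, map_mul, pb_comp, pb_comp]

instance : Flat (diag k M).hom := by
  change Flat (Spec.map (CommRingCat.ofHom (algebraMap k (MonoidAlgebra k M))))
  rw [Flat.SpecMap_iff]
  exact RingHom.flat_algebraMap_iff.2 inferInstance

lemma appLE_top {X Y : Scheme.{u}} (f : X ⟶ Y) (h) : f.appLE ⊤ ⊤ h = f.appTop :=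
  f.app_eq_appLE.symm

variable (M E) in
-- Flat base change: the group is affine and flat over k, and E is quasi-compact and
-- quasi-separated.
lemma isPushout_globalSections [CompactSpace E.left] [QuasiSeparatedSpace E.left] :
    IsPushout (diag k M).hom.appTop E.hom.appTop
      (fst (diag k M) E).left.appTop (snd (diag k M) E).left.appTop := by
  have H : IsPullback (fst (diag k M) E).left (snd (diag k M) E).left (diag k M).hom E.hom :=
    IsPullback.of_hasPullback (diag k M).hom E.hom
  have h := (isIso_pushoutSection_iff H (US := ⊤) (UT := ⊤) (UX := ⊤) (UY := ⊤) le_rfl le_rfl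
    (by simp)).1 (isIso_pushoutSection_of_isQuasiSeparated_of_flat_left H le_rfl le_rfl _
      (isAffineOpen_top _) (isAffineOpen_top _) isCompact_univ isQuasiSeparated_univ)
  convert h using 1 <;> exact (appLE_top _ _).symm

variable (M E) in
/-- The functions on `Hom(M, 𝔾_m) × E` are the Laurent polynomials over the functions on `E`. -/
theorem bijective_expand [CompactSpace E.left] [QuasiSeparatedSpace E.left] :
    Function.Bijective (expand (fst (diag k M) E) (snd (diag k M) E)) := by
  have h := isPushout_globalSections (k := k) M E
  -- Together with the inclusion of the constants, `u` defines by the pushout property a map into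
  -- the Laurent polynomials that is inverse to the expansion.
  let u : Γ((diag k M).left, ⊤) →+* MonoidAlgebra Γ(E.left, ⊤) M :=
    (MonoidAlgebra.mapRingHom M (scalar E)).comp
      (Scheme.ΓSpecIso (.of (MonoidAlgebra k M))).hom.hom
  have hu (a) : u (coord k (MonoidAlgebra k M) a) = MonoidAlgebra.mapRingHom M (scalar E) a :=
    congrArg (MonoidAlgebra.mapRingHom M (scalar E))
      congr($((Scheme.ΓSpecIso (.of (MonoidAlgebra k M))).inv_hom_id).hom a)
  have hs (c) : u (scalar (diag k M) c) = MonoidAlgebra.single 1 (scalar E c) := by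
    rw [← coord_algebraMap, hu]
    simp
  have w : (diag k M).hom.appTop ≫ CommRingCat.ofHom (R := Γ((diag k M).left, ⊤)) u =
      E.hom.appTop ≫ CommRingCat.ofHom MonoidAlgebra.singleOneRingHom := by
    rw [← cancel_epi (Scheme.ΓSpecIso (.of k)).inv]
    ext c : 2
    exact hs c
  let ψ := (h.desc _ _ w).hom
  have e1 (a) : ψ (pb (fst (diag k M) E) a) = u a := congr($(h.inl_desc _ _ w).hom a)
  have e2 (a) : ψ (pb (snd (diag k M) E) a) = MonoidAlgebra.single 1 a :=
    congr($(h.inr_desc _ _ w).hom a)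
  have k1 : ψ.comp (expand (fst (diag k M) E) (snd (diag k M) E)) = RingHom.id _ := by
    refine MonoidAlgebra.ringHom_ext (fun a => ?_) fun m => ?_
    · rw [RingHom.comp_apply, expand_single, character_one, map_one, one_mul, e2]
      rfl
    · rw [RingHom.comp_apply, expand_single, map_one, mul_one, e1, character_eq, hu]
      simp
  have k2 : CommRingCat.ofHom ((expand (fst (diag k M) E) (snd (diag k M) E)).comp ψ) = 𝟙 _ := by
    refine h.hom_ext ?_ ?_
    · ext a
      change expand _ _ (ψ (pb _ a)) = pb _ a
      obtain ⟨a, rfl⟩ := coord_surjective (k := k) (MonoidAlgebra k M) a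
      rw [e1, hu]
      induction a using MonoidAlgebra.induction_on with
      | of m =>
        rw [MonoidAlgebra.of_apply, MonoidAlgebra.mapRingHom_single, expand_single, map_one, map_one,
          mul_one]
        rfl
      | add x y hx hy => simp only [map_add, hx, hy]
      | smul r x hx =>
        rw [Algebra.smul_def, map_mul, map_mul, map_mul, map_mul, hx, coord_algebraMap, pb_scalar,
          MonoidAlgebra.coe_algebraMap, Function.comp_apply, Algebra.algebraMap_self_apply,
          MonoidAlgebra.mapRingHom_single, expand_single, character_one, map_one, one_mul,
          pb_scalar]
    · ext a
      change expand _ _ (ψ (pb _ a)) = pb _ a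
      rw [e2, expand_single, character_one, map_one, one_mul]
  refine ⟨fun a b hab => ?_, fun b => ⟨ψ b, congr($(k2).hom b)⟩⟩
  have := congrArg ψ hab
  exact (RingHom.congr_fun k1 a).symm.trans (this.trans (RingHom.congr_fun k1 b))

end Expansion

section Coaction

variable {k : Type u} [Field k] {M : Type u} [CommGroup M] {S E : Over (Spec (.of k))}
  [ModObj (diag k M) E]

/-- `a` is homogeneous of weight `m`. -/
def IsHomogeneous (m : M) (a : Γ(E.left, ⊤)) : Prop :=
  pb (act (diag k M) E) a = pb (fst _ _) (character k m) * pb (snd _ _) a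

lemma IsHomogeneous.mul {m n : M} {a b : Γ(E.left, ⊤)} (ha : IsHomogeneous m a)
    (hb : IsHomogeneous n b) : IsHomogeneous (m * n) (a * b) := by
  rw [IsHomogeneous, map_mul, ha, hb, character_mul, map_mul, map_mul]
  exact mul_mul_mul_comm _ _ _ _

lemma isHomogeneous_one : IsHomogeneous (1 : M) (1 : Γ(E.left, ⊤)) := by
  rw [IsHomogeneous, map_one, character_one, map_one, map_one, one_mul]

lemma IsHomogeneous.pow {m : M} {a : Γ(E.left, ⊤)} (ha : IsHomogeneous m a) (n : ℕ) :
    IsHomogeneous (m ^ n) (a ^ n) := by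
  induction n with
  | zero => rw [pow_zero, pow_zero]; exact isHomogeneous_one
  | succ n ih => rw [pow_succ, pow_succ]; exact ih.mul ha

variable [CompactSpace E.left] [QuasiSeparatedSpace E.left]

variable (M E) in
/-- The action as a homomorphism from the functions to the Laurent polynomials. -/
def coact : Γ(E.left, ⊤) →+* MonoidAlgebra Γ(E.left, ⊤) M :=
  ((RingEquiv.ofBijective _ (bijective_expand M E)).symm :
    Γ((diag k M ⊗ E).left, ⊤) →+* _).comp (pb (act (diag k M) E))

lemma expand_coact (a : Γ(E.left, ⊤)) :
    expand (fst (diag k M) E) (snd _ _) (coact M E a) = pb (act (diag k M) E) a :=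
  (RingEquiv.ofBijective _ (bijective_expand M E)).apply_symm_apply _

lemma pb_actPt (g : S ⟶ diag k M) (z : S ⟶ E) (a) :
    pb (actPt g z) a = expand g z (coact M E a) := by
  rw [actPt, pb_comp, ← expand_coact, pb_expand, lift_fst, lift_snd]

lemma expand_one_coact (a : Γ(E.left, ⊤)) :
    expand (1 : E ⟶ diag k M) (𝟙 E) (coact M E a) = a := by
  rw [← pb_actPt, one_actPt, pb_id]

omit [ModObj (diag k M) E] [CompactSpace E.left] [QuasiSeparatedSpace E.left] in
lemma expand_one (g : S ⟶ diag k M) (z : S ⟶ E) (F) (hg : ∀ m, F.coeff m ≠ 0 → pb g (character k m) = 1) :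
    expand g z F = ∑ m ∈ F.coeff.support, pb z (F.coeff m) := by
  conv_lhs => rw [← MonoidAlgebra.sum_coeff_single F, Finsupp.sum, map_sum]
  refine Finset.sum_congr rfl fun m hm => ?_
  rw [expand_single, hg m (Finsupp.mem_support_iff.1 hm), one_mul]

lemma sum_coeff_coact (a : Γ(E.left, ⊤)) :
    ∑ m ∈ (coact M E a).coeff.support, (coact M E a).coeff m = a := by
  have h := expand_one_coact (M := M) a
  rw [expand_one _ _ _ fun m _ => pb_hom_one_character m] at h
  simpa only [pb_id] using h

/-- Expanding a(g₁(g₂ z)) = a((g₁ g₂) z) as Laurent polynomials in g₁ and comparing the coefficients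
of the character m shows a_m(g₂ z) = χ_m(g₂) a_m(z). -/
theorem isHomogeneous_coeff [CompactSpace (diag k M ⊗ E).left]
    [QuasiSeparatedSpace (diag k M ⊗ E).left] (a : Γ(E.left, ⊤)) (m : M) :
    IsHomogeneous m ((coact M E a).coeff m) := by
  let P := diag k M ⊗ E
  -- `τ` encodes the substitution of g₁ g₂ for the group variable: the monomial m acquires the
  -- coefficient χ_m(g₂).
  let τ : MonoidAlgebra Γ(E.left, ⊤) M →+* MonoidAlgebra Γ(P.left, ⊤) M :=
    MonoidAlgebra.liftNCRingHom (MonoidAlgebra.singleOneRingHom.comp (pb (snd (diag k M) E)))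
      { toFun := fun m => MonoidAlgebra.single m (characterHom (fst (diag k M) E) m)
        map_one' := by rw [map_one]; rfl
        map_mul' := fun m n => by rw [map_mul, MonoidAlgebra.single_mul_single] }
      fun _ _ => mul_comm _ _
  have hτ (m a) : τ (MonoidAlgebra.single m a) =
      MonoidAlgebra.single m (pb (fst (diag k M) E) (character k m) * pb (snd _ _) a) := by
    refine (MonoidAlgebra.liftNCRingHom_single _ _ _ _ _).trans ?_
    refine (MonoidAlgebra.single_mul_single ..).trans ?_
    rw [one_mul, mul_comm]; rfl
  have hτ' (F m) : (τ F).coeff m =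
      pb (fst (diag k M) E) (character k m) * pb (snd _ _) (F.coeff m) := by
    classical
    induction F using MonoidAlgebra.induction_linear with
    | zero => simp
    | add F H hF hH => rw [map_add, MonoidAlgebra.coeff_add, MonoidAlgebra.coeff_add,
        Finsupp.add_apply, hF, hH, Finsupp.add_apply, map_add, mul_add]
    | single n a =>
      rw [hτ, MonoidAlgebra.coeff_single, MonoidAlgebra.coeff_single, Finsupp.single_apply,
        Finsupp.single_apply]
      split_ifs with h
      · rw [h]
      · rw [map_zero, mul_zero]
  have key : MonoidAlgebra.mapRingHom M (pb (act (diag k M) E)) (coact M E a) =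
      τ (coact M E a) := by
    refine (bijective_expand M P).1 ?_
    have e1 (F) : expand (fst (diag k M) P) (snd _ _)
        (MonoidAlgebra.mapRingHom M (pb (act (diag k M) E)) F) =
          expand (fst (diag k M) P) (snd (diag k M) P ≫ act (diag k M) E) F := by
      induction F using MonoidAlgebra.induction_linear with
      | zero => simp
      | add F H hF hH => rw [map_add, map_add, map_add, hF, hH]
      | single m a =>
        rw [MonoidAlgebra.mapRingHom_single, expand_single, expand_single]
        exact congrArg _ (pb_comp _ _ _).symm
    have e2 (F) : expand (fst (diag k M) P) (snd _ _) (τ F) =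
          expand (fst (diag k M) P * (snd (diag k M) P ≫ fst (diag k M) E))
            (snd (diag k M) P ≫ snd (diag k M) E) F := by
      induction F using MonoidAlgebra.induction_linear with
      | zero => simp
      | add F H hF hH => rw [map_add, map_add, map_add, hF, hH]
      | single m a =>
        rw [hτ, expand_single, expand_single, pb_hom_mul_character, map_mul, ← pb_comp, ← pb_comp,
          mul_assoc]
    rw [e1, e2, ← pb_actPt, ← pb_actPt, mul_actPt, act_eq_actPt, comp_actPt]
  have := congrArg (fun F => F.coeff m) key
  rw [hτ'] at this
  rw [IsHomogeneous, ← this]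
  simp

end Coaction

/-! ### Good functions on quasi-affine schemes -/

section QuasiAffineMaps

variable {k : Type u} [Field k] {S Z : Over (Spec (.of k))}

/-- The basic open set of `f` in the spectrum of the ring of global functions lies in `Z`. -/
def IsGood {Z : Scheme.{u}} (f : Γ(Z, ⊤)) : Prop :=
  ∀ p : Spec Γ(Z, ⊤), f ∉ p.asIdeal → p ∈ Set.range Z.toSpecΓ

lemma IsGood.mul {Z : Scheme.{u}} {f : Γ(Z, ⊤)} (h : IsGood f) (g : Γ(Z, ⊤)) : IsGood (f * g) :=
  fun p hp => h p fun hf => hp (p.asIdeal.mul_mem_right g hf)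

lemma mem_basicOpen_pb {h : S ⟶ Z} {p : S.left} {b : Γ(Z.left, ⊤)} :
    p ∈ S.left.basicOpen (pb h b) ↔ h.left p ∈ Z.left.basicOpen b :=
  (SetLike.ext_iff.1 (h.left.preimage_basicOpen_top b) p).symm

lemma mem_basicOpen_toSpecΓ {Z : Scheme.{u}} {p : Z} {b : Γ(Z, ⊤)} :
    p ∈ Z.basicOpen b ↔ b ∉ (Z.toSpecΓ p).asIdeal :=
  (SetLike.ext_iff.1 (Z.toSpecΓ_preimage_basicOpen b) p).symm

variable [Z.left.IsQuasiAffine]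

lemma IsGood.isAffineOpen {f : Γ(Z.left, ⊤)} (h : IsGood f) : IsAffineOpen (Z.left.basicOpen f) := by
  rw [← Scheme.toSpecΓ_preimage_basicOpen]
  exact (IsAffineOpen.Spec_basicOpen f).preimage_of_isOpenImmersion _ fun p hp => h p hp

variable (Z) in
lemma exists_isGood (z : Z.left) : ∃ f : Γ(Z.left, ⊤), IsGood f ∧ z ∈ Z.left.basicOpen f := by
  obtain ⟨_, ⟨_, ⟨f, rfl⟩, rfl⟩, h1, h2⟩ := (PrimeSpectrum.isBasis_basic_opens
    (R := Γ(Z.left, ⊤))).exists_subset_of_mem_open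
      (show Z.left.toSpecΓ z ∈ (Z.left.toSpecΓ.opensRange : Set _) from ⟨z, rfl⟩)
      Z.left.toSpecΓ.opensRange.2
  exact ⟨f, fun p hp => h2 hp, by rw [← Scheme.toSpecΓ_preimage_basicOpen]; exact h1⟩

lemma hom_ext_quasiAffine {f g : S ⟶ Z} (h : ∀ a, pb f a = pb g a) : f = g := by
  ext1
  rw [← cancel_mono Z.left.toSpecΓ, Scheme.toSpecΓ_naturality, Scheme.toSpecΓ_naturality]
  congr 2
  ext a
  exact h a

/-- A ring homomorphism defines a morphism to a quasi-affine scheme if good functions do not vanish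
simultaneously. -/
lemma exists_hom_quasiAffine (φ : Γ(Z.left, ⊤) →+* Γ(S.left, ⊤))
    (hφ : ∀ c, φ (scalar Z c) = scalar S c)
    (H : ∀ p : S.left, ∃ f, IsGood f ∧ p ∈ S.left.basicOpen (φ f)) :
    ∃ h : S ⟶ Z, ∀ a, pb h a = φ a := by
  let f₀ : S.left ⟶ Spec Γ(Z.left, ⊤) := S.left.toSpecΓ ≫ Spec.map (CommRingCat.ofHom φ)
  have h₀ : Set.range f₀ ⊆ Set.range Z.left.toSpecΓ := by
    rintro _ ⟨p, rfl⟩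
    obtain ⟨f, hf, hp⟩ := H p
    refine hf _ ?_
    rw [← Scheme.toSpecΓ_preimage_basicOpen] at hp
    exact hp
  let l := IsOpenImmersion.lift Z.left.toSpecΓ f₀ h₀
  have hl (a) : l.appTop.hom a = φ a := by
    have h1 := congrArg Scheme.Hom.appTop (IsOpenImmersion.lift_fac Z.left.toSpecΓ f₀ h₀)
    have h2 := congr($(h1).hom ((Scheme.ΓSpecIso Γ(Z.left, ⊤)).inv.hom a))
    rw [Scheme.Hom.comp_appTop, Scheme.toSpecΓ_appTop] at h2
    refine Eq.trans ?_ (h2.trans (appTop_toSpecΓ_map φ a))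
    exact congrArg l.appTop.hom (congr($((Scheme.ΓSpecIso Γ(Z.left, ⊤)).inv_hom_id).hom a)).symm
  refine ⟨Over.homMk l ?_, hl⟩
  refine ext_of_isAffine (Y := Spec (.of k)) ?_
  rw [← cancel_epi (Scheme.ΓSpecIso (.of k)).inv]
  ext c
  exact (hl (scalar Z c)).trans (hφ c)

lemma mem_basicOpen_coord {L : Type u} [Field L] [Algebra k L] (p : (sp k L).left) (l : L) :
    p ∈ (sp k L).left.basicOpen (coord k L l) ↔ l ≠ 0 := by
  have h2 : (sp k L).left.basicOpen (coord k L l) = PrimeSpectrum.basicOpen l :=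
    basicOpen_eq_of_affine (R := .of L) l
  rw [h2]
  refine ⟨fun h => ?_, fun h h' => ?_⟩
  · rintro rfl
    exact h (Ideal.zero_mem _)
  · exact (PrimeSpectrum.isPrime (R := L) p).ne_top (Ideal.eq_top_of_isUnit_mem _ h' h.isUnit)

end QuasiAffineMaps

section Components

variable {k : Type u} [Field k] {M : Type u} [CommGroup M] [Monoid.FG M] [IsMulTorsionFree M]

instance (E : Over (Spec (.of k))) [IsVariety E] : QuasiSeparatedSpace E.left :=
  have := IsVariety.isSeparated (X := E)
  (quasiSeparated_iff_quasiSeparatedSpace E.hom).1 inferInstance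

variable {S E : Over (Spec (.of k))}

omit [Monoid.FG M] [IsMulTorsionFree M] in
lemma expand_apply (g : S ⟶ diag k M) (z : S ⟶ E) (F) :
    expand g z F = ∑ m ∈ F.coeff.support, pb g (character k m) * pb z (F.coeff m) := by
  conv_lhs => rw [← MonoidAlgebra.sum_coeff_single F, Finsupp.sum, map_sum]
  exact Finset.sum_congr rfl fun m hm => expand_single _ _ _ _

variable [IsVariety E] [ModObj (diag k M) E]

omit [Monoid.FG M] [IsMulTorsionFree M] in
lemma isHomogeneous_iff {m : M} {a : Γ(E.left, ⊤)} :
    IsHomogeneous m a ↔ coact M E a = MonoidAlgebra.single m a := by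
  rw [← (bijective_expand M E).1.eq_iff, expand_coact, expand_single]
  rfl

omit [Monoid.FG M] [IsMulTorsionFree M] in
lemma coact_scalar (c : k) : coact M E (scalar E c) = MonoidAlgebra.single 1 (scalar E c) := by
  refine isHomogeneous_iff.1 ?_
  rw [IsHomogeneous, pb_scalar, pb_scalar, character_one, map_one, one_mul]

lemma coact_coeff (a : Γ(E.left, ⊤)) (m : M) :
    coact M E ((coact M E a).coeff m) = MonoidAlgebra.single m ((coact M E a).coeff m) :=
  isHomogeneous_iff.1 (isHomogeneous_coeff a m)

variable [E.left.IsQuasiAffine]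

/-- If the component `a_m` of a good function `a` does not vanish at a point of the spectrum of the
ring of global functions, then this point belongs to the scheme. -/
lemma IsGood.exists_point {a : Γ(E.left, ⊤)} (ha : IsGood a) {m : M} {κ F : Type u} [Field κ]
    [Field F] (ev : Γ(E.left, ⊤) →+* κ) (i : MonoidAlgebra κ M →+* F) (hi : Function.Injective i)
    (hm : ev ((coact M E a).coeff m) ≠ 0) :
    ∃ y : E.left, ∀ b, y ∈ E.left.basicOpen b ↔ ev b ≠ 0 := by
  let : Algebra k F := (((i.comp MonoidAlgebra.singleOneRingHom).comp ev).comp (scalar E)).toAlgebra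
  have hk (c : k) : algebraMap k F c = i (MonoidAlgebra.single 1 (ev (scalar E c))) := rfl
  -- `φ` is the translate of the point `ev` by the generic element of the group. The good function a
  -- does not vanish there: its value is the sum of the ev(a_m) χ_m, which has a nonzero
  -- coefficient. Hence this translate is an F-valued point `z` of E.
  let φ : Γ(E.left, ⊤) →+* F := (i.comp (MonoidAlgebra.mapRingHom M ev)).comp (coact M E)
  have hφ (b) : φ b = i (MonoidAlgebra.mapRingHom M ev (coact M E b)) := rfl
  obtain ⟨z, hz⟩ := exists_hom_quasiAffine (S := sp k F) (Z := E) ((coord k F).comp φ)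
    (fun c => by
      rw [RingHom.comp_apply, ← coord_algebraMap, hk, hφ, coact_scalar,
        MonoidAlgebra.mapRingHom_single])
    (fun p => ⟨a, ha, (mem_basicOpen_coord p _).2 fun h => by
      have h1 : MonoidAlgebra.mapRingHom M ev (coact M E a) = 0 := hi (h.trans (map_zero i).symm)
      have h2 := congrArg (fun F => F.coeff m) h1
      exact hm (by simpa using h2)⟩)
  have hz' (b) : pb z b = coord k F (φ b) := hz b
  -- The inverse of the generic element: translating back by it recovers `ev`, now as a point of E.
  let g : sp k F ⟶ diag k M := toDiag _
    { toFun := fun m => coord k F (i (MonoidAlgebra.single m⁻¹ 1))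
      map_one' := by
        rw [inv_one]
        exact (congrArg _ (map_one i)).trans (map_one _)
      map_mul' := fun m n => by
        rw [← map_mul, ← map_mul, MonoidAlgebra.single_mul_single, mul_inv, mul_one] }
  have hg (m) : pb g (character k m) = coord k F (i (MonoidAlgebra.single m⁻¹ 1)) := pb_toDiag _ _ _
  have h1 (b) : pb (actPt g z) b = coord k F (i (MonoidAlgebra.single 1 (ev b))) := by
    rw [pb_actPt, expand_apply]
    conv_rhs => rw [← sum_coeff_coact (M := M) b]
    refine Eq.trans ?_ (map_sum ((((coord k F).comp i).comp MonoidAlgebra.singleOneRingHom).comp ev)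
      (fun m => (coact M E b).coeff m) (coact M E b).coeff.support).symm
    refine Finset.sum_congr rfl fun m _ => ?_
    rw [hg, hz', hφ, coact_coeff, MonoidAlgebra.mapRingHom_single, ← map_mul, ← map_mul,
      MonoidAlgebra.single_mul_single, inv_mul_cancel, one_mul]
    rfl
  obtain ⟨p⟩ : Nonempty (sp k F).left := inferInstanceAs (Nonempty (PrimeSpectrum F))
  refine ⟨(actPt g z).left p, fun b => ?_⟩
  rw [← mem_basicOpen_pb, h1, mem_basicOpen_coord, Ne, map_eq_zero_iff i hi]
  exact not_congr MonoidAlgebra.single_eq_zero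

/-- The homogeneous components of a good function are good. -/
theorem IsGood.coeff {a : Γ(E.left, ⊤)} (ha : IsGood a) (m : M) :
    IsGood ((coact M E a).coeff m) := by
  intro c hc
  have : c.asIdeal.IsPrime := PrimeSpectrum.isPrime c
  have hev (b) : algebraMap _ c.asIdeal.ResidueField b = 0 ↔ b ∈ c.asIdeal :=
    Ideal.algebraMap_residueField_eq_zero
  -- Take the residue field at the given prime and embed its group algebra, a domain, into its field
  -- of fractions.
  obtain ⟨y, hy⟩ := ha.exists_point (m := m) (algebraMap _ c.asIdeal.ResidueField)
    (algebraMap _ (FractionRing (MonoidAlgebra c.asIdeal.ResidueField M)))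
    (IsFractionRing.injective _ _) fun h => hc ((hev _).1 h)
  refine ⟨y, PrimeSpectrum.ext (Ideal.ext fun b => ?_)⟩
  rw [← not_iff_not, ← mem_basicOpen_toSpecΓ, hy, Ne, hev]

end Components

/-! ### Weights of homogeneous functions at a point -/

section Constant

variable {k : Type u} [Field k] {Z : Over (Spec (.of k))}

/-- The value of a global function at a point. -/
def valueAt (z : Z.left) : Γ(Z.left, ⊤) →+* Z.left.residueField z :=
  (Z.left.evaluation ⊤ z trivial).hom

lemma valueAt_ne_zero {z : Z.left} {b : Γ(Z.left, ⊤)} : valueAt z b ≠ 0 ↔ z ∈ Z.left.basicOpen b :=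
  Z.left.evaluation_ne_zero_iff_mem_basicOpen (U := ⊤) z trivial b

variable [Z.left.IsQuasiAffine]

lemma eq_of_mem_basicOpen_iff {y z : Z.left}
    (h : ∀ b : Γ(Z.left, ⊤), y ∈ Z.left.basicOpen b ↔ z ∈ Z.left.basicOpen b) : y = z := by
  apply Z.left.toSpecΓ.isOpenEmbedding.injective
  refine PrimeSpectrum.ext (Ideal.ext fun b => ?_)
  rw [← not_iff_not, ← mem_basicOpen_toSpecΓ, ← mem_basicOpen_toSpecΓ, h]

/-- The constant morphism with value `z` of the spectrum of an algebra over the residue field. -/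
lemma exists_constant (z : Z.left) (R : Type u) [CommRing R] [Nontrivial R]
    [Algebra (Z.left.residueField z) R] [Algebra k R]
    (hk : ∀ c, algebraMap k R c = algebraMap _ R (valueAt z (scalar Z c))) :
    ∃ c : sp k R ⟶ Z, (∀ b, pb c b = coord k R (algebraMap _ R (valueAt z b))) ∧
      ∀ p, c.left p = z := by
  have hu {b} (hb : valueAt z b ≠ 0) (p : (sp k R).left) :
      p ∈ (sp k R).left.basicOpen (coord k R (algebraMap _ R (valueAt z b))) := by
    rw [Scheme.basicOpen_of_isUnit _ ((hb.isUnit.map (algebraMap _ R)).map (coord k R))]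
    trivial
  obtain ⟨c, hc⟩ := exists_hom_quasiAffine (S := sp k R) (Z := Z)
    (((coord k R).comp (algebraMap _ R)).comp (valueAt z))
    (fun c => by rw [← coord_algebraMap, hk]; rfl)
    (fun p => by
      obtain ⟨f, hf, hz⟩ := exists_isGood Z z
      exact ⟨f, hf, hu (valueAt_ne_zero.2 hz) p⟩)
  have hc' (b) : pb c b = coord k R (algebraMap _ R (valueAt z b)) := hc b
  refine ⟨c, hc', fun p => eq_of_mem_basicOpen_iff fun b => ?_⟩
  rw [← mem_basicOpen_pb, hc', ← valueAt_ne_zero (z := z)]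
  refine ⟨fun h h0 => ?_, fun h => hu h p⟩
  rw [h0, map_zero, map_zero, Scheme.basicOpen_zero] at h
  exact h

end Constant

section Weights

variable {k : Type u} [Field k] {N : Type u} [CommGroup N] [Monoid.FG N] [IsMulTorsionFree N]
  {X Z : Over (Spec (.of k))} [IsVariety Z] [Z.left.IsQuasiAffine] [ModObj (diag k N) Z]

/-- The weights of the homogeneous functions that do not vanish at a given point generate the
character group if the action is free. -/
lemma IsFreeAction.eq_top (hf : IsFreeAction (diag k N) Z) {z : Z.left} (N' : Subgroup N)
    (h : ∀ n b, IsHomogeneous (n : N) b → z ∈ Z.left.basicOpen b → n ∈ N') : N' = ⊤ := by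
  -- Spec R is the diagonalizable group with characters N/N' over the residue field, a subgroup of
  -- the acting group, and `g` is its universal point.
  let R := MonoidAlgebra (Z.left.residueField z) (N ⧸ N')
  let : Algebra k R := ((algebraMap _ R).comp ((valueAt z).comp (scalar Z))).toAlgebra
  obtain ⟨c, hc, -⟩ := exists_constant z R fun _ => rfl
  let g : sp k R ⟶ diag k N := toDiag _ (((coord k R : R →+* _) : R →* _).comp
    ((MonoidAlgebra.of _ (N ⧸ N')).comp (QuotientGroup.mk' N')))
  have hg (n : N) : pb g (character k n) = coord k R (MonoidAlgebra.single (n : N ⧸ N') 1) :=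
    pb_toDiag _ _ _
  -- This subgroup fixes z: a component that is nonzero at z has weight in N', and there the
  -- character is trivial. Freeness then forces N/N' to be trivial.
  have key : actPt g c = actPt (1 : sp k R ⟶ diag k N) c := by
    refine hom_ext_quasiAffine fun b => ?_
    rw [pb_actPt, pb_actPt, expand_apply, expand_apply]
    refine Finset.sum_congr rfl fun n _ => ?_
    by_cases h0 : valueAt z ((coact N Z b).coeff n) = 0
    · rw [hc, h0, map_zero, map_zero, mul_zero, mul_zero]
    · have := h n _ (isHomogeneous_coeff b n) (valueAt_ne_zero.1 h0)
      rw [hg, (QuotientGroup.eq_one_iff n).2 this, pb_hom_one_character]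
      exact congrArg (· * _) (map_one (coord k R))
  have hg1 := hf _ _ _ _ key
  rw [eq_top_iff]
  intro n _
  have h1 := hg n
  rw [hg1, pb_hom_one_character, ← map_one (coord k R), coord_injective.eq_iff] at h1
  have h2 : MonoidAlgebra.single (1 : N ⧸ N') (1 : Z.left.residueField z) =
    MonoidAlgebra.single (n : N ⧸ N') 1 := h1
  have h3 := congrArg (fun F => F.coeff (1 : N ⧸ N')) h2
  classical
  simp only [MonoidAlgebra.coeff_single, Finsupp.single_apply, if_true] at h3
  by_contra h4
  rw [if_neg (fun h => h4 ((QuotientGroup.eq_one_iff n).1 h))] at h3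
  exact one_ne_zero h3

omit [Monoid.FG N] [IsMulTorsionFree N] [IsVariety Z] [Z.left.IsQuasiAffine] in
lemma IsHomogeneous.mem_basicOpen_act {n : N} {b : Γ(Z.left, ⊤)} (hb : IsHomogeneous n b)
    {p : (diag k N ⊗ Z).left} : (act (diag k N) Z).left p ∈ Z.left.basicOpen b ↔
      (snd (diag k N) Z).left p ∈ Z.left.basicOpen b := by
  rw [← mem_basicOpen_pb, ← mem_basicOpen_pb, hb, Scheme.basicOpen_mul,
    Scheme.basicOpen_of_isUnit _ ((isUnit_character n).map _), top_inf_eq]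

omit [Monoid.FG N] [IsMulTorsionFree N] [IsVariety Z] [Z.left.IsQuasiAffine] in
lemma IsGeometricQuotient.exists_act_eq {π : Z ⟶ X} (hq : IsGeometricQuotient (diag k N) π)
    {y z : Z.left} (h : π.left y = π.left z) :
    ∃ p, (act (diag k N) Z).left p = y ∧ (snd (diag k N) Z).left p = z := by
  obtain ⟨q, rfl, rfl⟩ := Scheme.Pullback.exists_preimage_pullback y z h
  obtain ⟨p, rfl⟩ := hq.orbits.surj q
  refine ⟨p, ?_, ?_⟩
  · rw [← Scheme.Hom.comp_apply, Limits.pullback.lift_fst]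
  · rw [← Scheme.Hom.comp_apply, Limits.pullback.lift_snd]

omit [Monoid.FG N] [IsMulTorsionFree N] [IsVariety Z] [Z.left.IsQuasiAffine] in
lemma IsGeometricQuotient.actPt_comp {π : Z ⟶ X} (hq : IsGeometricQuotient (diag k N) π)
    {S : Over (Spec (.of k))} (g : S ⟶ diag k N) (z : S ⟶ Z) : actPt g z ≫ π = z ≫ π := by
  have h : act (diag k N) Z ≫ π = snd _ _ ≫ π := by
    ext1
    exact hq.invariant
  rw [actPt, Category.assoc, h, lift_snd_assoc]

/-- Points of the spectrum of `A` at which the functions that vanish on an orbit vanish. -/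
lemma IsGeometricQuotient.eq_of_ker_le {π : Z ⟶ X} (hq : IsGeometricQuotient (diag k N) π)
    {y z : Z.left} (hz : IsClosed {π.left z})
    (h : ∀ b, y ∈ Z.left.basicOpen b →
      MonoidAlgebra.mapRingHom N (valueAt z) (coact N Z b) ≠ 0) : π.left y = π.left z := by
  by_contra hne
  let R := MonoidAlgebra (Z.left.residueField z) N
  let : Algebra k R := ((algebraMap _ R).comp ((valueAt z).comp (scalar Z))).toAlgebra
  obtain ⟨c, hc, hc'⟩ := exists_constant z R fun _ => rfl
  -- The universal element: `actPt g c` is the orbit map of z, and by `ho` a function b pulls back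
  -- to the Laurent polynomial with coefficients b_n(z).
  let g : sp k R ⟶ diag k N := toDiag _ (((coord k R : R →+* _) : R →* _).comp
    (MonoidAlgebra.of _ N))
  have hg (n : N) : pb g (character k n) = coord k R (MonoidAlgebra.single n 1) :=
    pb_toDiag _ _ _
  have ho (b) : pb (actPt g c) b =
      coord k R (MonoidAlgebra.mapRingHom N (valueAt z) (coact N Z b)) := by
    rw [pb_actPt]
    generalize coact N Z b = F
    induction F using MonoidAlgebra.induction_linear with
    | zero => rw [map_zero, map_zero, map_zero]
    | add F H hF hH => rw [map_add, map_add, map_add, hF, hH]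
    | single n a =>
      rw [expand_single, hg, hc, MonoidAlgebra.mapRingHom_single, ← map_mul]
      congr 1
      change MonoidAlgebra.single n 1 * MonoidAlgebra.single 1 _ = _
      rw [MonoidAlgebra.single_mul_single, mul_one, one_mul]
      rfl
  -- If y were outside the closed fibre through z, some b would be nonzero at y and vanish on the
  -- fibre, hence along the orbit map. As R is a domain, b would then pull back to 0.
  obtain ⟨_, ⟨_, ⟨b, -, rfl⟩, rfl⟩, hyb, hb⟩ := (Scheme.IsQuasiAffine.isBasis_basicOpen
    Z.left).exists_subset_of_mem_open (show y ∈ (π.left ⁻¹' {π.left z})ᶜ from hne)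
      (hz.preimage π.left.continuous).isOpen_compl
  refine h b hyb ?_
  have hbot : ∀ p, p ∉ (sp k R).left.basicOpen (pb (actPt g c) b) := by
    intro p hp
    refine hb (mem_basicOpen_pb.1 hp) ?_
    change (actPt g c ≫ π).left p = _
    rw [hq.actPt_comp]
    exact congrArg π.left (hc' p)
  simp only [ho] at hbot
  generalize MonoidAlgebra.mapRingHom N (valueAt z) (coact N Z b) = r at hbot ⊢
  have h2 : (sp k R).left.basicOpen (coord k R r) = PrimeSpectrum.basicOpen r :=
    basicOpen_eq_of_affine (R := .of R) r
  rw [h2] at hbot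
  by_contra hr
  exact hbot (⊥ : PrimeSpectrum R) hr

/-- Up to powers of a given good homogeneous function `f`, every character is the weight of a
homogeneous function that does not vanish at a given point of `Z_f` over a closed point. -/
theorem IsGeometricQuotient.exists_isHomogeneous {π : Z ⟶ X}
    (hq : IsGeometricQuotient (diag k N) π) (hfree : IsFreeAction (diag k N) Z) {z : Z.left}
    (hz : IsClosed {π.left z}) {w : N} {f : Γ(Z.left, ⊤)} (hf : IsHomogeneous w f) (hgood : IsGood f)
    (hfz : z ∈ Z.left.basicOpen f) (n : N) :
    ∃ (j : ℕ) (b : Γ(Z.left, ⊤)), IsHomogeneous (n * w ^ j) b ∧ z ∈ Z.left.basicOpen b := by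
  -- Weights can be inverted up to powers of w. If not, the ideal generated by b and by the
  -- functions vanishing on the orbit of z contains no power of f. A prime Q that contains it but
  -- not f is a point of Z, as f is good; it lies in the fibre, that is, on the orbit of z. But b,
  -- being homogeneous and nonzero at z, vanishes nowhere on this orbit.
  have inv : ∀ (m : N) (b : Γ(Z.left, ⊤)), IsHomogeneous m b → z ∈ Z.left.basicOpen b →
      ∃ (l : ℕ) (c : Γ(Z.left, ⊤)), IsHomogeneous (m⁻¹ * w ^ l) c ∧ z ∈ Z.left.basicOpen c := by
    intro m b hb hbz
    by_contra! H
    let ρ : Γ(Z.left, ⊤) →+* MonoidAlgebra (Z.left.residueField z) N :=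
      (MonoidAlgebra.mapRingHom N (valueAt z)).comp (coact N Z)
    have hρ {m a} (ha : IsHomogeneous m a) : ρ a = MonoidAlgebra.single m (valueAt z a) := by
      change MonoidAlgebra.mapRingHom N (valueAt z) (coact N Z a) = _
      rw [isHomogeneous_iff.1 ha, MonoidAlgebra.mapRingHom_single]
    have hdisj : Disjoint ((Ideal.span {b} ⊔ RingHom.ker ρ : Ideal Γ(Z.left, ⊤)) : Set Γ(Z.left, ⊤))
        (Submonoid.powers f) := by
      rw [Set.disjoint_left]
      rintro _ hI ⟨l, rfl⟩
      obtain ⟨c', hc', d, hd, e⟩ := Submodule.mem_sup.1 hI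
      obtain ⟨c, rfl⟩ := Ideal.mem_span_singleton'.1 hc'
      have e1 := congrArg ρ e
      rw [map_add, RingHom.mem_ker.1 hd, add_zero, map_mul, hρ hb, hρ (hf.pow l)] at e1
      have e2 := congrArg (fun F => F.coeff (m⁻¹ * w ^ l * m)) e1
      -- Restricting c b + d = f^l to the orbit and comparing coefficients of weight w^l, the
      -- component of c of weight m⁻¹ w^l times b takes the value f(z)^l ≠ 0 at z.
      refine H l _ (isHomogeneous_coeff c (m⁻¹ * w ^ l)) (valueAt_ne_zero.1 fun h0 => ?_)
      have e3 : (ρ c).coeff (m⁻¹ * w ^ l) = 0 := by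
        change (MonoidAlgebra.mapRingHom N (valueAt z) (coact N Z c)).coeff _ = 0
        simpa using h0
      simp only [MonoidAlgebra.coeff_mul_single_mul, e3, zero_mul] at e2
      rw [show m⁻¹ * w ^ l * m = w ^ l by rw [mul_right_comm, inv_mul_cancel, one_mul],
        MonoidAlgebra.coeff_single, Finsupp.single_eq_same, map_pow] at e2
      exact pow_ne_zero l (valueAt_ne_zero.2 hfz) e2.symm
    obtain ⟨Q, hQ, hIQ, hfQ⟩ := Ideal.exists_le_prime_disjoint _ _ hdisj
    obtain ⟨y, hy⟩ := hgood ⟨Q, hQ⟩ fun h => Set.disjoint_left.1 hfQ h ⟨1, pow_one f⟩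
    have hy' (a) : y ∈ Z.left.basicOpen a ↔ a ∉ Q := by rw [mem_basicOpen_toSpecΓ, hy]
    have hyz := hq.eq_of_ker_le hz (y := y) fun a ha h0 =>
      (hy' a).1 ha (hIQ (Ideal.mem_sup_right (RingHom.mem_ker.2 h0)))
    obtain ⟨p, rfl, hp⟩ := hq.exists_act_eq hyz
    refine (hy' b).1 (hb.mem_basicOpen_act.2 ?_)
      (hIQ (Ideal.mem_sup_left (Ideal.mem_span_singleton_self b)))
    rwa [hp]
  have mul_mem {a b : Γ(Z.left, ⊤)} (ha : z ∈ Z.left.basicOpen a) (hb : z ∈ Z.left.basicOpen b) :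
      z ∈ Z.left.basicOpen (a * b) := by
    rw [Scheme.basicOpen_mul]; exact ⟨ha, hb⟩
  have pow_mem (l : ℕ) : z ∈ Z.left.basicOpen (f ^ l) := by
    rw [← valueAt_ne_zero, map_pow]
    exact pow_ne_zero l (valueAt_ne_zero.2 hfz)
  -- The characters in question form a subgroup by the previous step, and it contains all weights at
  -- z. By freeness it is everything.
  let W : Subgroup N :=
    { carrier := {n | ∃ (j : ℕ) (b : Γ(Z.left, ⊤)),
        IsHomogeneous (n * w ^ j) b ∧ z ∈ Z.left.basicOpen b}
      one_mem' := ⟨0, 1, by rw [pow_zero, mul_one]; exact isHomogeneous_one, by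
        rw [Scheme.basicOpen_of_isUnit _ isUnit_one]; trivial⟩
      mul_mem' := by
        rintro n m ⟨j, b, hb, hbz⟩ ⟨l, c, hc, hcz⟩
        refine ⟨j + l, b * c, ?_, mul_mem hbz hcz⟩
        rw [pow_add, mul_mul_mul_comm]
        exact hb.mul hc
      inv_mem' := by
        rintro n ⟨j, b, hb, hbz⟩
        obtain ⟨l, c, hc, hcz⟩ := inv _ b hb hbz
        refine ⟨l, c * f ^ j, ?_, mul_mem hcz (pow_mem j)⟩
        have := hc.mul (hf.pow j)
        rwa [mul_inv, mul_right_comm, inv_mul_cancel_right] at this }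
  have h : n ∈ W := by
    rw [hfree.eq_top W fun n b hb hbz => ⟨0, b, by rwa [pow_zero, mul_one], hbz⟩]
    trivial
  exact h

end Weights

/-! ### Semi-invariant rational functions, local sections and affine images -/

section SemiInvariant

variable {k : Type u} [Field k] {N : Type u} [CommGroup N] [Monoid.FG N] [IsMulTorsionFree N]
  {X Z : Over (Spec (.of k))} [IsVariety Z] [ModObj (diag k N) Z]

/-- The rational function `q` is semi-invariant of weight `n`. -/
def IsSemiInvariant (n : N) (q : Z.left.functionField) : Prop :=
  ff (act (diag k N) Z).left q =
    rat (diag k N ⊗ Z) (pb (fst (diag k N) Z) (character k n)) * ff (snd (diag k N) Z).left q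

lemma isSemiInvariant_rat_iff {n : N} {a : Γ(Z.left, ⊤)} :
    IsSemiInvariant n (rat Z a) ↔ IsHomogeneous n a := by
  rw [IsSemiInvariant, IsHomogeneous, ← rat_pb, ← rat_pb, ← map_mul]
  exact rat_injective.eq_iff

lemma IsSemiInvariant.mul {m n : N} {q r : Z.left.functionField} (hq : IsSemiInvariant m q)
    (hr : IsSemiInvariant n r) : IsSemiInvariant (m * n) (q * r) := by
  rw [IsSemiInvariant, map_mul, hq, hr, character_mul, map_mul, map_mul, map_mul]
  exact mul_mul_mul_comm _ _ _ _

lemma IsSemiInvariant.inv {n : N} {q : Z.left.functionField} (hq : IsSemiInvariant n q) :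
    IsSemiInvariant n⁻¹ q⁻¹ := by
  rw [IsSemiInvariant, map_inv₀, hq, map_inv₀, mul_inv]
  congr 1
  refine (eq_inv_of_mul_eq_one_left ?_).symm
  rw [← map_mul, ← map_mul, ← character_mul, inv_mul_cancel, character_one, map_one, map_one]

lemma IsSemiInvariant.div {m n : N} {q r : Z.left.functionField} (hq : IsSemiInvariant m q)
    (hr : IsSemiInvariant n r) : IsSemiInvariant (m / n) (q / r) := by
  rw [div_eq_mul_inv, div_eq_mul_inv]
  exact hq.mul hr.inv

lemma ff_toK_appLE {X Y : Scheme.{u}} [IsIntegral X] [IsIntegral Y] (f : X ⟶ Y) [IsDominant f]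
    {U : Y.Opens} {V : X.Opens} (hU : genericPoint Y ∈ U) (hV : genericPoint X ∈ V)
    (e : V ≤ f ⁻¹ᵁ U) (a : Γ(Y, U)) : ff f (toK U hU a) = toK V hV (f.appLE U V e a) := by
  rw [ff_toK]
  exact (toK_map e hV _).symm

variable [IsIntegral X.left] {π : Z ⟶ X} (hq : IsGeometricQuotient (diag k N) π)

omit [Monoid.FG N] [IsMulTorsionFree N] [IsVariety Z] [IsIntegral X.left] in
lemma IsGeometricQuotient.isDominant (hq : IsGeometricQuotient (diag k N) π) :
    IsDominant π.left :=
  have := hq.surjective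
  inferInstance

variable [IsDominant π.left]

include hq

lemma IsGeometricQuotient.isSemiInvariant_ff (r : X.left.functionField) :
    IsSemiInvariant (1 : N) (ff π.left r) := by
  rw [IsSemiInvariant, character_one, map_one, map_one, one_mul]
  exact (ff_comp _ π.left r).symm.trans ((ff_congr hq.invariant r).trans (ff_comp _ π.left r))

/-- Invariant rational functions that are regular on the preimage of an open set descend to functions
that are regular on this set. -/
theorem IsGeometricQuotient.exists_ff_eq {q : Z.left.functionField} (hinv : IsSemiInvariant (1 : N) q)
    {V : X.left.Opens} {x : X.left} (hx : x ∈ V)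
    (hreg : ∀ z, π.left z ∈ V → q ∈ regularAt z) :
    ∃ r, ff π.left r = q ∧ ∀ x ∈ V, r ∈ regularAt x := by
  have hV := genericPoint_mem hx
  have hV' := genericPoint_mem_preimage π.left hV
  obtain ⟨a, rfl⟩ := exists_toK_eq (U := π.left ⁻¹ᵁ V) hV' hreg
  have hW : genericPoint (diag k N ⊗ Z).left ∈ ((snd (diag k N) Z).left ≫ π.left) ⁻¹ᵁ V :=
    genericPoint_mem_preimage (snd (diag k N) Z).left hV'
  obtain ⟨b, rfl⟩ := (hq.functions V a).2 (by
    rw [IsSemiInvariant, character_one, map_one, map_one, one_mul] at hinv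
    exact toK_injective _ hW ((ff_toK_appLE _ hV' hW _ a).symm.trans
      (hinv.trans (ff_toK_appLE _ hV' hW _ a))))
  exact ⟨toK V hV b, ff_toK _ _ _ _, fun x hx => toK_mem_regularAt hx b _⟩

/-- The pull-back of r is invariant, so its regularity over V lets it descend to a function regular
on V, which must be r as pull-back is injective. -/
lemma IsGeometricQuotient.mem_regularAt_of_ff {r : X.left.functionField} {V : X.left.Opens}
    (hreg : ∀ z, π.left z ∈ V → ff π.left r ∈ regularAt z) {x : X.left} (hx : x ∈ V) :
    r ∈ regularAt x := by
  obtain ⟨r', h, h'⟩ := hq.exists_ff_eq (hq.isSemiInvariant_ff r) hx hreg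
  rw [← (ff_injective π.left) h]
  exact h' x hx

end SemiInvariant

section ImageOpen

variable {k : Type u} [Field k] {N : Type u} [CommGroup N]
  {X Z : Over (Spec (.of k))} [ModObj (diag k N) Z] {π : Z ⟶ X}
  (hq : IsGeometricQuotient (diag k N) π) {w : N} {f : Γ(Z.left, ⊤)} (hf : IsHomogeneous w f)

include hq hf in
-- The nonvanishing set of a homogeneous function is stable. Fibres are orbits, so it is a full
-- preimage, and its image is open because π is submersive.
lemma IsGeometricQuotient.exists_preimage_eq :
    ∃ U : X.left.Opens, π.left ⁻¹ᵁ U = Z.left.basicOpen f := by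
  have h : π.left ⁻¹' (π.left '' (Z.left.basicOpen f : Set Z.left)) = Z.left.basicOpen f := by
    refine Set.Subset.antisymm ?_ (Set.subset_preimage_image _ _)
    rintro y ⟨z, hz, h⟩
    obtain ⟨p, rfl, hp⟩ := hq.exists_act_eq h.symm
    refine hf.mem_basicOpen_act.2 ?_
    rwa [hp]
  refine ⟨⟨π.left '' (Z.left.basicOpen f : Set Z.left), ?_⟩, TopologicalSpace.Opens.ext h⟩
  rw [← hq.isQuotientMap.isOpen_preimage, h]
  exact (Z.left.basicOpen f).2

end ImageOpen

section Trivializing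

variable {k : Type u} [Field k] {N : Type u} [CommGroup N] [Monoid.FG N] [IsMulTorsionFree N]
  {X Z : Over (Spec (.of k))} [IsVariety Z] [Z.left.IsQuasiAffine] [ModObj (diag k N) Z]

/-- The good homogeneous function `f` belongs to `P`, and every character is the weight of a quotient
of homogeneous functions that belong to `P` and do not vanish where `f` does not vanish. -/
structure IsTrivializing (P : Submonoid Γ(Z.left, ⊤)) (w : N) (f : Γ(Z.left, ⊤)) : Prop where
  mem : f ∈ P
  isHomogeneous : IsHomogeneous w f
  isGood : IsGood f
  exists_weight : ∀ n : N, ∃ (l : N), ∃ b ∈ P, ∃ c ∈ P, IsHomogeneous (n * l) b ∧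
    IsHomogeneous l c ∧ Z.left.basicOpen f ≤ Z.left.basicOpen b ∧
    Z.left.basicOpen f ≤ Z.left.basicOpen c

omit [IsMulTorsionFree N] [IsVariety Z] [Z.left.IsQuasiAffine] in
-- The character group is finitely generated. Multiplying f by the functions b_n for n in a finite
-- generating set gives a function f' such that all the b_n and f are nonzero on Z_{f'}; there n is
-- the weight of the quotient of b_n by f^(j n).
lemma exists_isTrivializing {P : Submonoid Γ(Z.left, ⊤)} {w : N} {f : Γ(Z.left, ⊤)} {z : Z.left}
    (hf : f ∈ P) (hw : IsHomogeneous w f) (hg : IsGood f) (hz : z ∈ Z.left.basicOpen f)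
    (H : ∀ n : N, ∃ (j : ℕ), ∃ b ∈ P, IsHomogeneous (n * w ^ j) b ∧ z ∈ Z.left.basicOpen b) :
    ∃ w' f', IsTrivializing (N := N) P w' f' ∧ z ∈ Z.left.basicOpen f' := by
  classical
  choose j b hb hbw hbz using H
  obtain ⟨S, hS⟩ := Group.fg_def.1 (Group.fg_iff_monoid_fg.2 ‹Monoid.FG N›)
  have hle (n) (hn : n ∈ S) :
      Z.left.basicOpen (f * ∏ n ∈ S, b n) ≤ Z.left.basicOpen (b n) := by
    rw [← Finset.mul_prod_erase S b hn, mul_left_comm, Scheme.basicOpen_mul]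
    exact inf_le_left
  have hle' : Z.left.basicOpen (f * ∏ n ∈ S, b n) ≤ Z.left.basicOpen f := by
    rw [Scheme.basicOpen_mul]
    exact inf_le_left
  have one_top : Z.left.basicOpen (1 : Γ(Z.left, ⊤)) = ⊤ := Scheme.basicOpen_of_isUnit _ isUnit_one
  have pow_le (f : Γ(Z.left, ⊤)) (l : ℕ) : Z.left.basicOpen f ≤ Z.left.basicOpen (f ^ l) := by
    induction l with
    | zero => rw [pow_zero, one_top]; exact le_top
    | succ l ih => rw [pow_succ, Scheme.basicOpen_mul]; exact le_inf ih le_rfl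
  have hprod : IsHomogeneous (∏ n ∈ S, n * w ^ j n) (∏ n ∈ S, b n) := by
    clear hle hle' hS
    induction S using Finset.induction_on with
    | empty => exact isHomogeneous_one
    | insert n S hn ih =>
      rw [Finset.prod_insert hn, Finset.prod_insert hn]
      exact (hbw n).mul ih
  have hprodz : z ∈ Z.left.basicOpen (∏ n ∈ S, b n) := by
    rw [← valueAt_ne_zero, map_prod]
    exact Finset.prod_ne_zero_iff.2 fun n _ => valueAt_ne_zero.2 (hbz n)
  let W : Subgroup N :=
    { carrier := {n | ∃ (l : N), ∃ b' ∈ P, ∃ c ∈ P, IsHomogeneous (n * l) b' ∧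
        IsHomogeneous l c ∧ Z.left.basicOpen (f * ∏ n ∈ S, b n) ≤ Z.left.basicOpen b' ∧
        Z.left.basicOpen (f * ∏ n ∈ S, b n) ≤ Z.left.basicOpen c}
      one_mem' := ⟨1, 1, P.one_mem, 1, P.one_mem, by rw [one_mul]; exact isHomogeneous_one,
        isHomogeneous_one, by rw [one_top]; exact le_top, by rw [one_top]; exact le_top⟩
      mul_mem' := by
        rintro n n' ⟨l, b', hb', c, hc, h1, h2, h3, h4⟩ ⟨l', b₂, hb₂, c₂, hc₂, k1, k2, k3, k4⟩
        refine ⟨l * l', b' * b₂, P.mul_mem hb' hb₂, c * c₂, P.mul_mem hc hc₂, ?_, h2.mul k2, ?_, ?_⟩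
        · rw [mul_mul_mul_comm]; exact h1.mul k1
        · exact (le_inf h3 k3).trans_eq (Scheme.basicOpen_mul _ _ _).symm
        · exact (le_inf h4 k4).trans_eq (Scheme.basicOpen_mul _ _ _).symm
      inv_mem' := by
        rintro n ⟨l, b', hb', c, hc, h1, h2, h3, h4⟩
        exact ⟨n * l, c, hc, b', hb', by rwa [inv_mul_cancel_left], h1, h4, h3⟩ }
  have hW : W = ⊤ := by
    rw [eq_top_iff, ← hS, Subgroup.closure_le]
    exact fun n hn => ⟨w ^ j n, b n, hb n, f ^ j n, P.pow_mem hf _, hbw n, hw.pow _, hle n hn,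
      hle'.trans (pow_le f _)⟩
  refine ⟨_, _, ⟨P.mul_mem hf (P.prod_mem fun n _ => hb n), hw.mul hprod, hg.mul _, fun n => ?_⟩, ?_⟩
  · have h : n ∈ W := by rw [hW]; trivial
    exact h
  · rw [Scheme.basicOpen_mul]
    exact ⟨hz, hprodz⟩

omit [Z.left.IsQuasiAffine] in
lemma IsTrivializing.exists_semiInvariant {P : Submonoid Γ(Z.left, ⊤)} {w : N} {f : Γ(Z.left, ⊤)}
    (h : IsTrivializing P w f) (n : N) : ∃ b ∈ P, ∃ c ∈ P,
      IsSemiInvariant n (rat Z b / rat Z c) ∧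
      ∀ z ∈ Z.left.basicOpen f, IsUnitAt z (rat Z b) ∧ IsUnitAt z (rat Z c) := by
  obtain ⟨l, b, hb, c, hc, h1, h2, h3, h4⟩ := h.exists_weight n
  refine ⟨b, hb, c, hc, ?_, fun z hz => ⟨isUnitAt_rat_iff.2 (h3 hz), isUnitAt_rat_iff.2 (h4 hz)⟩⟩
  have := (isSemiInvariant_rat_iff.2 h1).div (isSemiInvariant_rat_iff.2 h2)
  rwa [mul_div_cancel_right] at this

omit [Z.left.IsQuasiAffine] in
/-- A multiplicative family of semi-invariant rational functions. -/
lemma IsTrivializing.exists_hom {P : Submonoid Γ(Z.left, ⊤)} {w : N} {f : Γ(Z.left, ⊤)}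
    (h : IsTrivializing P w f) {z : Z.left} (hz : z ∈ Z.left.basicOpen f) :
    ∃ β : N →* Z.left.functionFieldˣ, ∀ n, IsSemiInvariant n (β n : Z.left.functionField) ∧
      ∀ z ∈ Z.left.basicOpen f, IsUnitAt z (β n : Z.left.functionField) := by
  -- `Q` consists of the weights paired with semi-invariant units of that weight on Z_f. It surjects
  -- onto the free group N, and a splitting chooses the units multiplicatively.
  let Q : Subgroup (N × Z.left.functionFieldˣ) :=
    { carrier := {q | IsSemiInvariant q.1 (q.2 : Z.left.functionField) ∧
        ∀ z ∈ Z.left.basicOpen f, IsUnitAt z (q.2 : Z.left.functionField)}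
      one_mem' := ⟨by
        have := isSemiInvariant_rat_iff.2 (isHomogeneous_one (M := N) (E := Z))
        rwa [map_one] at this, fun z _ => isUnitAt_one⟩
      mul_mem' := fun ha hb => ⟨ha.1.mul hb.1, fun z hz => (ha.2 z hz).mul (hb.2 z hz)⟩
      inv_mem' := fun {a} ha => by
        refine ⟨?_, fun z hz => ?_⟩
        · rw [Prod.snd_inv, Units.val_inv_eq_inv_val]; exact ha.1.inv
        · rw [Prod.snd_inv, Units.val_inv_eq_inv_val]; exact (ha.2 z hz).inv }
  have hs : Function.Surjective ((MonoidHom.fst N Z.left.functionFieldˣ).comp Q.subtype) := by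
    intro n
    obtain ⟨b, -, c, -, h1, h2⟩ := h.exists_semiInvariant n
    have h3 : ∀ z ∈ Z.left.basicOpen f, IsUnitAt z (rat Z b / rat Z c) := fun z hz =>
      (h2 z hz).1.div (h2 z hz).2
    exact ⟨⟨(n, Units.mk0 _ (h3 z hz).ne_zero), h1, h3⟩, rfl⟩
  have : AddGroup.FG (Additive N) :=
    have : Group.FG N := Group.fg_iff_monoid_fg.2 inferInstance
    inferInstance
  have : Module.Finite ℤ (Additive N) := Module.Finite.iff_addGroup_fg.2 inferInstance
  have : Module.Free ℤ (Additive N) := Module.free_of_finite_type_torsion_free'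
  let p : Additive Q →ₗ[ℤ] Additive N :=
    (MonoidHom.toAdditive ((MonoidHom.fst N Z.left.functionFieldˣ).comp Q.subtype)).toIntLinearMap
  obtain ⟨σ, hσ⟩ := Module.projective_lifting_property p LinearMap.id hs
  have hσ' (n : N) : (σ (Additive.ofMul n)).toMul.1.1 = n := congr($hσ (Additive.ofMul n))
  refine ⟨(MonoidHom.snd N Z.left.functionFieldˣ).comp (Q.subtype.comp
    (MonoidHom.toAdditive.symm σ.toAddMonoidHom)), fun n => ?_⟩
  have h1 := (σ (Additive.ofMul n)).toMul.2
  have h2 : IsSemiInvariant (σ (Additive.ofMul n)).toMul.1.1 _ := h1.1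
  rw [hσ'] at h2
  exact ⟨h2, h1.2⟩

end Trivializing

lemma exists_ringHom_comp_eq {A K L : Type*} [CommRing A] [CommRing K] [CommRing L] (i : K →+* L)
    (hi : Function.Injective i) (φ : A →+* L) (h : ∀ a, ∃ r, i r = φ a) :
    ∃ ψ : A →+* K, ∀ a, i (ψ a) = φ a := by
  choose ψ hψ using h
  exact ⟨{ toFun := ψ
           map_one' := hi (by rw [hψ, map_one, map_one])
           map_mul' := fun a b => hi (by rw [hψ, map_mul, map_mul, hψ, hψ])
           map_zero' := hi (by rw [hψ, map_zero, map_zero])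
           map_add' := fun a b => hi (by rw [hψ, map_add, map_add, hψ, hψ]) }, hψ⟩

section AffineImage

variable {k : Type u} [Field k] {N : Type u} [CommGroup N] [Monoid.FG N] [IsMulTorsionFree N]
  {X Z : Over (Spec (.of k))} [IsVariety Z] [ModObj (diag k N) Z]

lemma IsSemiInvariant.add {n : N} {q r : Z.left.functionField} (hq : IsSemiInvariant n q)
    (hr : IsSemiInvariant n r) : IsSemiInvariant n (q + r) := by
  rw [IsSemiInvariant, map_add, hq, hr, map_add, mul_add]

lemma isSemiInvariant_zero (n : N) : IsSemiInvariant n (0 : Z.left.functionField) := by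
  rw [IsSemiInvariant, map_zero, map_zero, mul_zero]

/-- The function `∑ β(n)⁻¹ a_n`. -/
def normalize (β : N →* Z.left.functionFieldˣ) : Γ(Z.left, ⊤) →+* Z.left.functionField :=
  (MonoidAlgebra.liftNCRingHom (rat Z) ((Units.coeHom _).comp β⁻¹) fun _ _ => mul_comm _ _).comp
    (coact N Z)

omit [Monoid.FG N] [IsMulTorsionFree N] in
lemma normalize_apply (β : N →* Z.left.functionFieldˣ) (a : Γ(Z.left, ⊤)) :
    normalize β a = ∑ n ∈ (coact N Z a).coeff.support,
      rat Z ((coact N Z a).coeff n) * (β n : Z.left.functionField)⁻¹ := by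
  rw [normalize, RingHom.comp_apply]
  conv_lhs => rw [← MonoidAlgebra.sum_coeff_single (coact N Z a), Finsupp.sum, map_sum]
  refine Finset.sum_congr rfl fun m hm => (MonoidAlgebra.liftNCRingHom_single _ _ _ _ _).trans ?_
  simp

omit [Monoid.FG N] [IsMulTorsionFree N] in
lemma normalize_of_isHomogeneous (β : N →* Z.left.functionFieldˣ) {a : Γ(Z.left, ⊤)} {n : N}
    (ha : IsHomogeneous n a) : normalize β a = rat Z a * (β n : Z.left.functionField)⁻¹ := by
  rw [normalize, RingHom.comp_apply, isHomogeneous_iff.1 ha]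
  refine (MonoidAlgebra.liftNCRingHom_single _ _ _ _ _).trans ?_
  simp

/-- The normalized function is z ↦ a(β(z)⁻¹ z), which is constant on orbits: each summand a_n/β(n)
has weight n n⁻¹. -/
lemma isSemiInvariant_normalize {β : N →* Z.left.functionFieldˣ}
    (hβ : ∀ n, IsSemiInvariant n (β n : Z.left.functionField)) (a) :
    IsSemiInvariant (1 : N) (normalize β a) := by
  rw [normalize_apply]
  refine Finset.sum_induction _ _ (fun _ _ => IsSemiInvariant.add) (isSemiInvariant_zero _)
    fun n _ => ?_
  have := (isSemiInvariant_rat_iff.2 (isHomogeneous_coeff a n)).mul (hβ n).inv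
  rwa [mul_inv_cancel] at this

omit [Monoid.FG N] [IsMulTorsionFree N] in
lemma normalize_mem_regularAt {β : N →* Z.left.functionFieldˣ} {z : Z.left}
    (hβ : ∀ n, IsUnitAt z (β n : Z.left.functionField)) (a) : normalize β a ∈ regularAt z := by
  rw [normalize_apply]
  exact sum_mem fun n _ => mul_mem (rat_mem_regularAt _ _) (hβ n).inv.mem

variable [IsVariety X] [Z.left.IsQuasiAffine] {π : Z ⟶ X} (hq : IsGeometricQuotient (diag k N) π)

omit [Monoid.FG N] [IsMulTorsionFree N] [IsVariety Z] [ModObj (diag k N) Z] [IsVariety X]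
  [Z.left.IsQuasiAffine] in
instance surjective_resMap (π : Z ⟶ X) [Surjective π.left] (U : X.left.Opens) :
    Surjective (resMap π U).left := by
  refine ⟨fun p => ?_⟩
  obtain ⟨z, hz⟩ := π.left.surjective ((inc X U).left p)
  refine ⟨resPt (π.left ⁻¹ᵁ U) z (show π.left z ∈ U from hz ▸ inc_mem p), ?_⟩
  apply (inc X U).left.isOpenEmbedding.injective
  rw [← comp_left_apply, resMap_inc, comp_left_apply]
  exact hz

include hq in
/-- A semi-invariant trivialization defines a section of the quotient. -/
theorem IsGeometricQuotient.exists_section {β : N →* Z.left.functionFieldˣ} {w : N}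
    {f : Γ(Z.left, ⊤)} (hf : IsHomogeneous w f) (hgood : IsGood f) {U : X.left.Opens}
    (hU : π.left ⁻¹ᵁ U = Z.left.basicOpen f) {x : X.left} (hx : x ∈ U)
    (hβ : ∀ n, IsSemiInvariant n (β n : Z.left.functionField))
    (hβu : ∀ n, ∀ z ∈ Z.left.basicOpen f, IsUnitAt z (β n : Z.left.functionField)) :
    ∃ σ : res X U ⟶ Z, σ ≫ π = inc X U := by
  have hsurj := hq.surjective
  have hdom := hq.isDominant
  obtain ⟨z, hz⟩ := π.left.surjective x
  have hmem {z} : π.left z ∈ U ↔ z ∈ Z.left.basicOpen f := by rw [← hU]; rfl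
  have := isVariety_res X U hx
  have := isVariety_res Z (π.left ⁻¹ᵁ U) (x := z) (show π.left z ∈ U from hz ▸ hx)
  have d1 : IsDominant (inc X U).left := isDominant_of_isOpenImmersion _
  have d2 : IsDominant (inc Z (π.left ⁻¹ᵁ U)).left := isDominant_of_isOpenImmersion _
  -- Normalized functions are invariant and regular over U, so they descend. The resulting
  -- homomorphism from the functions on Z to those on U is the section to be constructed; it takes
  -- values in Z because the good function f goes to a unit.
  have hdesc (a) : ∃ r, ff π.left r = normalize β a ∧ ∀ x ∈ U, r ∈ regularAt x :=
    hq.exists_ff_eq (isSemiInvariant_normalize hβ a) hx fun z hz =>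
      normalize_mem_regularAt (fun n => hβu n z (hmem.1 hz)) a
  obtain ⟨ψ₀, hψ₀⟩ := exists_ringHom_comp_eq (ff π.left) (ff_injective _) (normalize β)
    fun a => (hdesc a).imp fun _ h => h.1
  have hreg (a) {x} (hx : x ∈ U) : ψ₀ a ∈ regularAt x := by
    obtain ⟨r, h1, h2⟩ := hdesc a
    rw [ff_injective π.left ((hψ₀ a).trans h1.symm)]
    exact h2 x hx
  obtain ⟨ψ, hψ⟩ := exists_ringHom_comp_eq (rat (res X U)) rat_injective
    ((ff (inc X U).left).comp ψ₀) fun a => exists_rat_eq fun p =>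
      ff_mem_regularAt (inc X U).left (hreg a (inc_mem p))
  have hψ' (a) : rat _ (ψ a) = ff (inc X U).left (ψ₀ a) := hψ a
  obtain ⟨σ, hσ⟩ := exists_hom_quasiAffine (S := res X U) (Z := Z) ψ (fun c => by
      apply rat_injective
      rw [hψ', ← pb_scalar (inc X U), rat_pb]
      congr 1
      apply ff_injective π.left
      have h1 : IsHomogeneous (1 : N) (scalar Z c) := isHomogeneous_iff.2 (coact_scalar c)
      rw [hψ₀, ← rat_pb, pb_scalar, normalize_of_isHomogeneous β h1, map_one, Units.val_one,
        inv_one, mul_one])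
    (fun p => ⟨f, hgood, by
      rw [← isUnitAt_rat_iff, hψ']
      refine IsUnitAt.ff (inc X U).left ?_
      obtain ⟨y, hy⟩ := π.left.surjective ((inc X U).left p)
      have hyf : y ∈ Z.left.basicOpen f := hmem.1 (hy ▸ inc_mem p)
      rw [← hy]
      refine IsUnitAt.of_ff π.left ?_ (hreg f (hmem.2 hyf))
      rw [hψ₀, normalize_of_isHomogeneous β hf]
      exact (isUnitAt_rat_iff.2 hyf).mul (hβu w y hyf).inv⟩)
  obtain ⟨g, hg⟩ := exists_toDiag (k := k) (res Z (π.left ⁻¹ᵁ U))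
    (((ff (inc Z (π.left ⁻¹ᵁ U)).left : _ →* _).comp (Units.coeHom _)).comp β⁻¹) fun n p => by
      have h := ((hβu n _ (hmem.1 (inc_mem p))).inv.ff (inc Z (π.left ⁻¹ᵁ U)).left).mem
      rwa [← Units.val_inv_eq_inv_val] at h
  have d3 : IsDominant (resMap π U ≫ inc X U).left :=
    inferInstanceAs (IsDominant ((resMap π U).left ≫ (inc X U).left))
  have d4 : IsDominant (inc Z (π.left ⁻¹ᵁ U) ≫ π).left :=
    inferInstanceAs (IsDominant ((inc Z (π.left ⁻¹ᵁ U)).left ≫ π.left))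
  -- `σ` after π is the translation z ↦ β(z)⁻¹ z, which preserves the fibres of π. As π is
  -- surjective, `σ` is a section.
  have key : resMap π U ≫ σ = actPt g (inc Z (π.left ⁻¹ᵁ U)) := by
    refine hom_ext_quasiAffine fun a => rat_injective ?_
    rw [pb_comp, hσ, rat_pb, hψ', pb_actPt]
    have h1 : ff (resMap π U).left (ff (inc X U).left (ψ₀ a)) =
        ff (inc Z (π.left ⁻¹ᵁ U)).left (normalize β a) := by
      rw [← hψ₀]
      exact (ff_comp (resMap π U).left (inc X U).left _).symm.trans
        ((ff_congr (congrArg Over.Hom.left (resMap_inc π U)) _).trans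
          (ff_comp (inc Z (π.left ⁻¹ᵁ U)).left π.left _))
    rw [h1, normalize_apply, expand_apply, map_sum, map_sum]
    refine Finset.sum_congr rfl fun n _ => ?_
    rw [map_mul, map_mul, hg, rat_pb, mul_comm]
    exact congrArg (· * _) (congrArg (ff (inc Z (π.left ⁻¹ᵁ U)).left) (Units.val_inv_eq_inv_val _).symm)
  refine ⟨σ, ?_⟩
  ext1
  have hsep := IsVariety.isSeparated (X := X)
  refine ext_of_isDominant_of_isSeparated X.hom ((Over.w _).trans (Over.w _).symm) (resMap π U).left ?_
  refine congrArg Over.Hom.left (show resMap π U ≫ σ ≫ π = resMap π U ≫ inc X U from ?_)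
  rw [← Category.assoc, key, hq.actPt_comp, resMap_inc]

omit [Monoid.FG N] [IsMulTorsionFree N] [ModObj (diag k N) Z] [Z.left.IsQuasiAffine]
  [IsVariety X] in
-- A section of a separated morphism is a closed immersion, so U is closed in the affine scheme
-- π⁻¹(U).
lemma isAffineOpen_of_section {U : X.left.Opens} (hU : IsAffineOpen (π.left ⁻¹ᵁ U))
    {σ : res X U ⟶ Z} (hσ : σ ≫ π = inc X U) : IsAffineOpen U := by
  have hm : ∀ p, σ.left p ∈ π.left ⁻¹ᵁ U := fun p => by
    change (σ ≫ π).left p ∈ U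
    rw [hσ]
    exact inc_mem p
  have h1 : liftRes σ hm ≫ resMap π U = 𝟙 _ := by
    rw [← cancel_mono (inc X U), Category.assoc, resMap_inc, liftRes_inc_assoc, hσ, Category.id_comp]
  have hsep : IsSeparated (res Z (π.left ⁻¹ᵁ U)).hom := by
    have := IsVariety.isSeparated (X := Z)
    exact inferInstanceAs (IsSeparated ((π.left ⁻¹ᵁ U).ι ≫ Z.hom))
  have h2 : IsSeparated (resMap π U).left := by
    have : IsSeparated ((resMap π U).left ≫ (res X U).hom) := by rwa [Over.w]
    exact IsSeparated.of_comp _ (res X U).hom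
  have h3 : IsClosedImmersion ((liftRes σ hm).left ≫ (resMap π U).left) := by
    rw [← Over.comp_left, h1]
    exact inferInstanceAs (IsClosedImmersion (𝟙 (res X U).left))
  have h4 := IsClosedImmersion.of_comp (liftRes σ hm).left (resMap π U).left
  have : IsAffine (res Z (π.left ⁻¹ᵁ U)).left := hU
  exact isAffine_of_isAffineHom (liftRes σ hm).left

include hq in
/-- The image of the nonvanishing set of a trivializing function is affine. -/
theorem IsTrivializing.isAffineOpen {P : Submonoid Γ(Z.left, ⊤)} {w : N} {f : Γ(Z.left, ⊤)}
    (h : IsTrivializing P w f) {U : X.left.Opens} (hU : π.left ⁻¹ᵁ U = Z.left.basicOpen f)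
    {z : Z.left} (hz : z ∈ Z.left.basicOpen f) : IsAffineOpen U := by
  obtain ⟨β, hβ⟩ := h.exists_hom hz
  rw [← hU] at hz
  obtain ⟨σ, hσ⟩ := hq.exists_section h.isHomogeneous h.isGood hU (x := π.left z) hz
    (fun n => (hβ n).1) fun n => (hβ n).2
  refine isAffineOpen_of_section ?_ hσ
  rw [hU]
  exact h.isGood.isAffineOpen

end AffineImage

/-! ### Compatibility of the two actions on Z -/

/-- The units of a group algebra over a domain are the monomials. -/
lemma exists_eq_single_of_isUnit {R M : Type*} [CommRing R] [IsDomain R] [CommGroup M]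
    [UniqueProds M] {F : MonoidAlgebra R M} (h : IsUnit F) :
    ∃ m a, F = MonoidAlgebra.single m a := by
  have := UniqueProds.toTwoUniqueProds_of_group (G := M)
  obtain ⟨G, hG⟩ := h.exists_right_inv
  have hF0 : F.coeff.support.card ≠ 0 := by
    intro h0
    rw [Finset.card_eq_zero, Finsupp.support_eq_empty] at h0
    have : F = 0 := MonoidAlgebra.ext (by simp [h0])
    rw [this, zero_mul] at hG
    exact zero_ne_one hG
  have hG0 : G.coeff.support.card ≠ 0 := by
    intro h0
    rw [Finset.card_eq_zero, Finsupp.support_eq_empty] at h0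
    have : G = 0 := MonoidAlgebra.ext (by simp [h0])
    rw [this, mul_zero] at hG
    exact zero_ne_one hG
  by_cases hc : 1 < F.coeff.support.card * G.coeff.support.card
  -- If one of the supports has more than one element, two different pairs of exponents have
  -- products that are attained only once. Both products occur in FG = 1 with nonzero coefficient,
  -- so both are 1, contradicting uniqueness.
  · obtain ⟨p, hp, q, hq, hne, h1, h2⟩ := TwoUniqueProds.uniqueMul_of_one_lt_card hc
    have hone {r : M × M} (hr : r ∈ F.coeff.support ×ˢ G.coeff.support)
        (hr' : UniqueMul F.coeff.support G.coeff.support r.1 r.2) : r.1 * r.2 = 1 := by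
      have h3 := MonoidAlgebra.coeff_mul_mul_of_uniqueMul hr'
      rw [hG] at h3
      obtain ⟨k1, k2⟩ := Finset.mem_product.1 hr
      by_contra h4
      rw [MonoidAlgebra.one_def, MonoidAlgebra.coeff_single, Finsupp.single_eq_of_ne h4] at h3
      exact mul_ne_zero (Finsupp.mem_support_iff.1 k1) (Finsupp.mem_support_iff.1 k2) h3.symm
    obtain ⟨k1, k2⟩ := Finset.mem_product.1 hq
    obtain ⟨e1, e2⟩ := h1 k1 k2 ((hone hq h2).trans (hone hp h1).symm)
    exact absurd (Prod.ext e1 e2).symm hne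
  · have h1 : F.coeff.support.card = 1 := by
      have := Nat.le_mul_of_pos_right F.coeff.support.card (Nat.pos_of_ne_zero hG0)
      omega
    obtain ⟨m, a, -, h⟩ := Finsupp.card_support_eq_one'.1 h1
    exact ⟨m, a, MonoidAlgebra.ext (by simp [h])⟩

section Commute

variable {k : Type u} [Field k] {M N : Type u} [CommGroup M] [CommGroup N] [Monoid.FG M]
  [Monoid.FG N] [IsMulTorsionFree M] [IsMulTorsionFree N] {X Z : Over (Spec (.of k))}
  [IsVariety X] [IsVariety Z] [ModObj (diag k M) X] [ModObj (diag k M) Z] [ModObj (diag k N) Z]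
  {π : Z ⟶ X}

instance isDomain_globalSections (S : Over (Spec (.of k))) [IsIntegral S.left] :
    IsDomain Γ(S.left, ⊤) := (rat_injective (S := S)).isDomain (rat S)

lemma exists_unit_rat_eq {S : Over (Spec (.of k))} [IsIntegral S.left] {q : S.left.functionField}
    (h : ∀ p, IsUnitAt p q) : ∃ u, IsUnit u ∧ rat S u = q := by
  obtain ⟨u, hu⟩ := exists_rat_eq fun p => (h p).mem
  obtain ⟨v, hv⟩ := exists_rat_eq fun p => (h p).inv.mem
  refine ⟨u, IsUnit.of_mul_eq_one v (rat_injective ?_), hu⟩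
  rw [map_mul, hu, hv, map_one, mul_inv_cancel₀ (h (genericPoint S.left)).ne_zero]

variable (M N Z) in
/-- The morphism `(t, h, z) ↦ t (h z)`. -/
abbrev actAct : diag k M ⊗ (diag k N ⊗ Z) ⟶ Z := (diag k M ◁ act (diag k N) Z) ≫ act (diag k M) Z

variable (M N Z) in
/-- The morphism `(t, h, z) ↦ t z`. -/
abbrev actSnd : diag k M ⊗ (diag k N ⊗ Z) ⟶ Z := (diag k M ◁ snd (diag k N) Z) ≫ act (diag k M) Z

omit [Monoid.FG M] [Monoid.FG N] [IsMulTorsionFree M] [IsMulTorsionFree N] [IsVariety X]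
  [IsVariety Z] in
lemma actAct_comp (hq : IsGeometricQuotient (diag k N) π) (he : IsEquivariant (diag k M) π) :
    actAct M N Z ≫ π = actSnd M N Z ≫ π := by
  have h : act (diag k N) Z ≫ π = snd _ _ ≫ π := by
    ext1
    exact hq.invariant
  have he' : act (diag k M) Z ≫ π = diag k M ◁ π ≫ act (diag k M) X := he
  rw [Category.assoc, Category.assoc, he', ← MonoidalCategory.whiskerLeft_comp_assoc, h,
    MonoidalCategory.whiskerLeft_comp_assoc]

variable (hq : IsGeometricQuotient (diag k N) π) (he : IsEquivariant (diag k M) π)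
  (hcov : ∀ z : Z.left, ∃ (w : N) (f : Γ(Z.left, ⊤)), IsTrivializing ⊤ w f ∧
    z ∈ Z.left.basicOpen f)

include hq he hcov

/-- Locally a = π^* r · β with a semi-invariant unit β of weight w. The points t(h z) and t z have
the same image in X, so r cancels in the ratio and a ratio of units remains. -/
lemma isUnitAt_ratio {w : N} {a : Γ(Z.left, ⊤)} (ha : IsHomogeneous w a) (h0 : a ≠ 0)
    (p : (diag k M ⊗ (diag k N ⊗ Z)).left) :
    IsUnitAt p (ff (actAct M N Z).left (rat Z a) / ff (actSnd M N Z).left (rat Z a)) := by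
  have hdom := hq.isDominant
  have hsurj := hq.surjective
  obtain ⟨n, f, hf, hp⟩ := hcov ((actSnd M N Z).left p)
  obtain ⟨U, hU⟩ := hq.exists_preimage_eq hf.isHomogeneous
  have hmem {z} : π.left z ∈ U ↔ z ∈ Z.left.basicOpen f := by rw [← hU]; rfl
  have hp' : (actAct M N Z).left p ∈ Z.left.basicOpen f := by
    rw [← hmem] at hp ⊢
    have := congr($(actAct_comp hq he).left p)
    change (actAct M N Z ≫ π).left p ∈ U
    rwa [this]
  obtain ⟨b, -, c, -, hβ, hu⟩ := hf.exists_semiInvariant w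
  have hu' : ∀ z ∈ Z.left.basicOpen f, IsUnitAt z (rat Z b / rat Z c) := fun z hz =>
    (hu z hz).1.div (hu z hz).2
  generalize rat Z b / rat Z c = β at hβ hu'
  have h1 := (isSemiInvariant_rat_iff.2 ha).div hβ
  rw [div_self'] at h1
  obtain ⟨r, hr, -⟩ := hq.exists_ff_eq h1 (hmem.2 hp) fun z hz =>
    mul_mem (rat_mem_regularAt _ _) (hu' z (hmem.1 hz)).inv.mem
  have hβ0 : β ≠ 0 := (hu' _ hp).ne_zero
  have e : rat Z a = ff π.left r * β := by rw [hr, div_mul_cancel₀ _ hβ0]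
  have hr0 : r ≠ 0 := by
    rintro rfl
    rw [map_zero, zero_mul, ← map_zero (rat Z)] at e
    exact h0 (rat_injective e)
  have d1 : IsDominant (actAct M N Z ≫ π).left := inferInstance
  have d2 : IsDominant (actSnd M N Z ≫ π).left := inferInstance
  have e2 : ff (actAct M N Z).left (ff π.left r) = ff (actSnd M N Z).left (ff π.left r) :=
    (ff_comp (actAct M N Z).left π.left r).symm.trans
      ((ff_congr (congrArg Over.Hom.left (actAct_comp hq he)) r).trans
        (ff_comp (actSnd M N Z).left π.left r))
  have e3 : ff (actAct M N Z).left (rat Z a) / ff (actSnd M N Z).left (rat Z a) =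
      ff (actAct M N Z).left β / ff (actSnd M N Z).left β := by
    rw [e, map_mul, map_mul, e2, mul_div_mul_left]
    exact (map_ne_zero _).2 ((map_ne_zero _).2 hr0)
  rw [e3]
  exact ((hu' _ hp').ff _).div ((hu' _ hp).ff _)

/-- The two actions commute as far as homogeneous functions are concerned. -/
theorem IsHomogeneous.pb_actAct {w : N} {a : Γ(Z.left, ⊤)} (ha : IsHomogeneous w a) :
    pb (actAct M N Z) a =
      pb (snd (diag k M) (diag k N ⊗ Z) ≫ fst _ _) (character k w) * pb (actSnd M N Z) a := by
  by_cases h0 : a = 0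
  · rw [h0, map_zero, map_zero, mul_zero]
  let χ := pb (snd (diag k M) (diag k N ⊗ Z) ≫ fst (diag k N) Z) (character k w)
  have hχ : IsUnit χ := (isUnit_character w).map _
  obtain ⟨u, hu, hu'⟩ := exists_unit_rat_eq
    (q := ff (actAct M N Z).left (rat Z a) / ff (actSnd M N Z).left (rat Z a) * (rat _ χ)⁻¹)
    fun p => (isUnitAt_ratio hq he hcov ha h0 p).mul (isUnitAt_of_isUnit hχ p).inv
  have hrel : pb (actAct M N Z) a = u * χ * pb (actSnd M N Z) a := by
    apply rat_injective
    have h1 : ff (actSnd M N Z).left (rat Z a) ≠ 0 :=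
      (map_ne_zero _).2 ((map_ne_zero_iff _ rat_injective).2 h0)
    have h2 : rat _ χ ≠ 0 := (hχ.map (rat _)).ne_zero
    rw [map_mul, map_mul, hu', rat_pb (actAct M N Z), rat_pb (actSnd M N Z)]
    field_simp
  obtain ⟨F, rfl⟩ := (bijective_expand M (diag k N ⊗ Z)).2 u
  have hF : IsUnit F := by
    obtain ⟨v, hv⟩ := hu.exists_right_inv
    obtain ⟨G, rfl⟩ := (bijective_expand M (diag k N ⊗ Z)).2 v
    refine IsUnit.of_mul_eq_one G ((bijective_expand M (diag k N ⊗ Z)).1 ?_)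
    rw [map_mul, hv, map_one]
  -- The correction factor is a unit of the Laurent polynomials in t over the functions on H × Z,
  -- hence a monomial χ_m(t) b(h, z). Putting t = 1 gives b = 1, and putting h = 1 gives χ_m = 1.
  obtain ⟨m, b, rfl⟩ := exists_eq_single_of_isUnit hF
  rw [expand_single] at hrel
  have hinj {S T : Over (Spec (.of k))} [IsIntegral S.left] [IsIntegral T.left] (f : S ⟶ T)
      [IsDominant f.left] {a : Γ(T.left, ⊤)} (h : a ≠ 0) : pb f a ≠ 0 := fun h' => h (by
    apply rat_injective
    apply ff_injective f.left
    rw [← rat_pb, h', map_zero, map_zero, map_zero])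
  have hb : b = 1 := by
    have h1 := congrArg (pb (lift (1 : _ ⟶ diag k M) (𝟙 (diag k N ⊗ Z)))) hrel
    have e1 : lift (1 : _ ⟶ diag k M) (𝟙 (diag k N ⊗ Z)) ≫ actAct M N Z = act (diag k N) Z := by
      rw [lift_whiskerLeft_assoc, Category.id_comp]
      exact one_actPt _
    have e2 : lift (1 : _ ⟶ diag k M) (𝟙 (diag k N ⊗ Z)) ≫ actSnd M N Z = snd (diag k N) Z := by
      rw [lift_whiskerLeft_assoc, Category.id_comp]
      exact one_actPt _
    simp only [χ, map_mul, ← pb_comp, e1, e2, lift_fst, lift_snd, lift_snd_assoc, Category.id_comp,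
      pb_hom_one_character, pb_id, one_mul] at h1
    rw [ha, mul_assoc] at h1
    refine (mul_right_cancel₀ (mul_ne_zero ((isUnit_character (k := k) w).map (pb (fst (diag k N) Z))).ne_zero
      (hinj (snd (diag k N) Z) h0)) ?_)
    rw [← h1, one_mul]
  have hm : pb (fst (diag k M) Z) (character k m) = 1 := by
    have h1 := congrArg (pb (diag k M ◁ lift (1 : _ ⟶ diag k N) (𝟙 Z))) hrel
    have e1 : diag k M ◁ lift (1 : _ ⟶ diag k N) (𝟙 Z) ≫ actAct M N Z = act (diag k M) Z := by
      rw [← MonoidalCategory.whiskerLeft_comp_assoc]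
      have : lift (1 : _ ⟶ diag k N) (𝟙 Z) ≫ act (diag k N) Z = 𝟙 Z := one_actPt _
      rw [this, MonoidalCategory.whiskerLeft_id, Category.id_comp]
    have e2 : diag k M ◁ lift (1 : _ ⟶ diag k N) (𝟙 Z) ≫ actSnd M N Z = act (diag k M) Z := by
      rw [← MonoidalCategory.whiskerLeft_comp_assoc, lift_snd, MonoidalCategory.whiskerLeft_id,
        Category.id_comp]
    have e3 : diag k M ◁ lift (1 : _ ⟶ diag k N) (𝟙 Z) ≫ snd _ _ ≫ fst _ _ = 1 := by
      rw [whiskerLeft_snd_assoc, lift_fst, MonObj.comp_one]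
    rw [hb] at h1
    simp only [χ, map_mul, ← pb_comp, e1, e2, e3, whiskerLeft_fst, map_one, mul_one,
      pb_hom_one_character] at h1
    refine mul_right_cancel₀ (hinj (act (diag k M) Z) h0) ?_
    rw [← h1, one_mul]
  have hm' : pb (fst (diag k M) (diag k N ⊗ Z)) (character k m) = 1 := by
    rw [← whiskerLeft_fst (diag k M) (snd (diag k N) Z), pb_comp, hm, map_one]
  rw [hrel, hb, hm', map_one, one_mul, one_mul]

/-- The components of a homogeneous function with respect to the other action are homogeneous. -/
theorem IsHomogeneous.coeff {w : N} {a : Γ(Z.left, ⊤)} (ha : IsHomogeneous w a) (m : M) :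
    IsHomogeneous w ((coact M Z a).coeff m) := by
  have hmap {S E : Over (Spec (.of k))} (z : S ⟶ E) (F : MonoidAlgebra Γ(E.left, ⊤) M) :
      expand (fst (diag k M) S) (snd _ _) (MonoidAlgebra.mapRingHom M (pb z) F) =
        expand (fst (diag k M) S) (snd (diag k M) S ≫ z) F := by
    induction F using MonoidAlgebra.induction_linear with
    | zero => simp
    | add F H hF hH => rw [map_add, map_add, map_add, hF, hH]
    | single m a =>
      rw [MonoidAlgebra.mapRingHom_single, expand_single, expand_single]
      exact congrArg _ (pb_comp _ _ _).symm
  have hact {S : Over (Spec (.of k))} (z : S ⟶ Z) :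
      (diag k M ◁ z) ≫ act (diag k M) Z = actPt (fst _ _) (snd _ _ ≫ z) := by
    rw [actPt]
    congr 1
  have key : MonoidAlgebra.mapRingHom M (pb (act (diag k N) Z)) (coact M Z a) =
      MonoidAlgebra.single 1 (pb (fst (diag k N) Z) (character k w)) *
        MonoidAlgebra.mapRingHom M (pb (snd (diag k N) Z)) (coact M Z a) := by
    refine (bijective_expand M (diag k N ⊗ Z)).1 ?_
    rw [map_mul, hmap, hmap, expand_single, character_one, map_one, one_mul, ← ToricQuot.pb_actPt,
      ← ToricQuot.pb_actPt,
      ← hact, ← hact, ha.pb_actAct hq he hcov, pb_comp]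
  have := congrArg (fun F => F.coeff (1 * m)) key
  rw [IsHomogeneous]
  simpa [MonoidAlgebra.coeff_single_mul_mul] using this

end Commute

/-! ### Trivializing functions that are homogeneous for both actions -/

section Cover

variable {k : Type u} [Field k] {M N : Type u} [CommGroup M] [CommGroup N] [Monoid.FG M]
  [Monoid.FG N] [IsMulTorsionFree M] [IsMulTorsionFree N] {X Z : Over (Spec (.of k))}
  [IsVariety X] [IsVariety Z] [Z.left.IsQuasiAffine] [ModObj (diag k M) X] [ModObj (diag k M) Z]
  [ModObj (diag k N) Z] {π : Z ⟶ X} (hq : IsGeometricQuotient (diag k N) π)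
  (hfree : IsFreeAction (diag k N) Z) (he : IsEquivariant (diag k M) π)

omit [Monoid.FG N] [IsMulTorsionFree N] [IsVariety Z] [Z.left.IsQuasiAffine] in
include hq in
/-- If trivializing functions exist at the points over closed points, then they exist everywhere. -/
lemma IsGeometricQuotient.exists_isTrivializing_of_isClosed {P : Submonoid Γ(Z.left, ⊤)}
    (H : ∀ z : Z.left, IsClosed {π.left z} →
      ∃ (w : N) (f : Γ(Z.left, ⊤)), IsTrivializing P w f ∧ z ∈ Z.left.basicOpen f) (z : Z.left) :
    ∃ (w : N) (f : Γ(Z.left, ⊤)), IsTrivializing P w f ∧ z ∈ Z.left.basicOpen f := by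
  have hsurj := hq.surjective
  let S : Set X.left := {x | ∃ (w : N) (f : Γ(Z.left, ⊤)) (z : Z.left), IsTrivializing P w f ∧
    z ∈ Z.left.basicOpen f ∧ π.left z = x}
  have hS {w : N} {f : Γ(Z.left, ⊤)} (hf : IsTrivializing P w f) {z : Z.left}
      (hz : z ∈ Z.left.basicOpen f) : ∃ U : X.left.Opens, π.left z ∈ U ∧ (U : Set X.left) ⊆ S ∧
        ∀ y, π.left y ∈ U → y ∈ Z.left.basicOpen f := by
    obtain ⟨U, hU⟩ := hq.exists_preimage_eq hf.isHomogeneous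
    have hmem {z} : π.left z ∈ U ↔ z ∈ Z.left.basicOpen f := by rw [← hU]; rfl
    refine ⟨U, hmem.2 hz, fun x hx => ?_, fun y => hmem.1⟩
    obtain ⟨y, rfl⟩ := π.left.surjective x
    exact ⟨w, f, y, hf, hmem.1 hx, rfl⟩
  have hopen : IsOpen S := by
    rw [isOpen_iff_forall_mem_open]
    rintro _ ⟨w, f, y, hf, hy, rfl⟩
    obtain ⟨U, h1, h2, -⟩ := hS hf hy
    exact ⟨U, h2, U.2, h1⟩
  -- The set `S` of points of X with a trivializing function above them is open; were its complement
  -- nonempty, it would contain a closed point by quasi-compactness.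
  have hz : π.left z ∈ S := by
    by_contra hz
    obtain ⟨x, hx, hx'⟩ := hopen.isClosed_compl.exists_closed_singleton ⟨_, hz⟩
    obtain ⟨y, rfl⟩ := π.left.surjective x
    obtain ⟨w, f, hf, hy⟩ := H y hx'
    exact hx ⟨w, f, y, hf, hy, rfl⟩
  obtain ⟨w, f, y, hf, hy, hyz⟩ := hz
  obtain ⟨U, h1, -, h2⟩ := hS hf hy
  exact ⟨w, f, hf, h2 z (hyz ▸ h1)⟩

omit [Monoid.FG M] [IsMulTorsionFree M] [IsVariety X] [Z.left.IsQuasiAffine] in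
variable (M) in
lemma exists_coeff_ne_zero {a : Γ(Z.left, ⊤)} {z : Z.left}
    (hz : z ∈ Z.left.basicOpen a) : ∃ m : M, z ∈ Z.left.basicOpen ((coact M Z a).coeff m) := by
  by_contra! h
  rw [← valueAt_ne_zero, ← sum_coeff_coact (M := M) a, map_sum] at hz
  refine hz (Finset.sum_eq_zero fun m _ => ?_)
  have := h m
  rw [← valueAt_ne_zero] at this
  exact not_not.1 this

omit [Monoid.FG M] [IsMulTorsionFree M] [ModObj (diag k M) X] [ModObj (diag k M) Z] in
include hq hfree in
-- A preliminary version without T-homogeneity. It supplies the semi-invariant units needed to show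
-- that T-components of H-homogeneous functions are H-homogeneous, on which
-- `IsGeometricQuotient.exists_isTrivializing` relies.
lemma IsGeometricQuotient.exists_isTrivializing_top (z : Z.left) :
    ∃ (w : N) (f : Γ(Z.left, ⊤)), IsTrivializing ⊤ w f ∧ z ∈ Z.left.basicOpen f := by
  refine hq.exists_isTrivializing_of_isClosed (fun z hz => ?_) z
  obtain ⟨a, ha, haz⟩ := exists_isGood Z z
  obtain ⟨w, hw⟩ := exists_coeff_ne_zero N haz
  refine ToricQuot.exists_isTrivializing (w := w) trivial (isHomogeneous_coeff a w) (ha.coeff w) hw fun n => ?_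
  obtain ⟨j, b, hb, hbz⟩ := hq.exists_isHomogeneous hfree hz (isHomogeneous_coeff a w) (ha.coeff w) hw n
  exact ⟨j, b, trivial, hb, hbz⟩

variable (k M Z) in
/-- The homogeneous functions. -/
def homogeneousSubmonoid : Submonoid Γ(Z.left, ⊤) where
  carrier := {a | ∃ m : M, IsHomogeneous m a}
  one_mem' := ⟨1, isHomogeneous_one⟩
  mul_mem' := fun ⟨m, hm⟩ ⟨n, hn⟩ => ⟨m * n, hm.mul hn⟩

include hq hfree he in
/-- Trivializing functions that are homogeneous for both actions. -/
theorem IsGeometricQuotient.exists_isTrivializing (z : Z.left) :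
    ∃ (w : N) (f : Γ(Z.left, ⊤)), IsTrivializing (homogeneousSubmonoid k M Z) w f ∧
      z ∈ Z.left.basicOpen f := by
  have hcov := hq.exists_isTrivializing_top hfree
  refine hq.exists_isTrivializing_of_isClosed (fun z hz => ?_) z
  obtain ⟨a, ha, haz⟩ := exists_isGood Z z
  obtain ⟨w, hw⟩ := exists_coeff_ne_zero N haz
  obtain ⟨m, hm⟩ := exists_coeff_ne_zero M hw
  have h1 := (isHomogeneous_coeff a w).coeff hq he hcov m
  have h2 := (ha.coeff w).coeff m
  refine ToricQuot.exists_isTrivializing (w := w) ⟨m, isHomogeneous_coeff _ m⟩ h1 h2 hm fun n => ?_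
  obtain ⟨j, b, hb, hbz⟩ := hq.exists_isHomogeneous hfree hz h1 h2 hm n
  obtain ⟨l, hl⟩ := exists_coeff_ne_zero M hbz
  exact ⟨j, _, ⟨l, isHomogeneous_coeff b l⟩, hb.coeff hq he hcov l, hl⟩

end Cover

/-! ### Invariant divisors from trivializing functions -/

section Glue

variable {X : Scheme.{u}} [IsIntegral X]

/-- Local equations that agree up to units define a Cartier divisor. -/
lemma exists_cartierDivisor (E : X.Opens → X.functionFieldˣ → Prop)
    (hE : ∀ x, ∃ U, x ∈ U ∧ ∃ d, E U d)
    (hu : ∀ U V d e, E U d → E V e → ∀ y ∈ U, y ∈ V →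
      IsUnitAt y ((d : X.functionField) / (e : X.functionField))) :
    ∃ D : CartierDivisor X, ∀ U d, E U d → ∀ y ∈ U,
      D.germ y = (d : X.functionFieldˣ ⧸ unitsAt X y) := by
  choose U hU d hd using hE
  have h (V e) (he : E V e) (y) (hy : y ∈ V) :
      (d y : X.functionFieldˣ ⧸ unitsAt X y) = (e : X.functionFieldˣ ⧸ unitsAt X y) :=
    quotient_eq_iff.2 (hu _ _ _ _ (hd y) he y (hU y) hy)
  exact ⟨⟨fun x => d x, fun x => ⟨U x, hU x, d x, h _ _ (hd x)⟩⟩, h⟩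

end Glue

section Invariance

variable {k : Type u} [Field k] {G X : Over (Spec (.of k))} [GrpObj G] [ModObj G X]
  [IsIntegral X.left] [IsIntegral (G ⊗ X).left]

lemma mem_invariantDivisors {D : CartierDivisor X.left} (H : ∀ p : (G ⊗ X).left,
    ∃ d d' : X.left.functionFieldˣ,
      D.germ ((act G X).left p) = (d : X.left.functionFieldˣ ⧸ unitsAt X.left _) ∧
      D.germ ((snd G X).left p) = (d' : X.left.functionFieldˣ ⧸ unitsAt X.left _) ∧
      IsUnitAt p (ff (act G X).left d / ff (snd G X).left d')) : D ∈ invariantDivisors G X := by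
  intro p
  obtain ⟨d, d', hd, hd', a, ha, hau⟩ := H p
  have frac (x : X.left) (q : X.left.functionField) : ∃ g h : X.left.presheaf.stalk x, h ≠ 0 ∧
      q * algebraMap _ X.left.functionField h = algebraMap _ X.left.functionField g := by
    obtain ⟨g, h, hh, rfl⟩ := IsFractionRing.div_surjective (A := X.left.presheaf.stalk x) q
    have h0 := nonZeroDivisors.ne_zero hh
    exact ⟨g, h, h0, div_mul_cancel₀ _ ((map_ne_zero_iff _ (algebraMap_stalk_injective _)).2 h0)⟩
  obtain ⟨g, h, hh, e⟩ := frac ((act G X).left p) d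
  obtain ⟨g', h', hh', e'⟩ := frac ((snd G X).left p) d'
  refine ⟨g, h, g', h', d, d', hh, hh', hd, hd', e, e', Associated.symm ⟨ha.unit, ?_⟩⟩
  apply algebraMap_stalk_injective p
  have n : ff (snd G X).left (d' : X.left.functionField) ≠ 0 := (map_ne_zero _).2 d'.ne_zero
  rw [map_mul, map_mul, map_mul, IsUnit.unit_spec, hau]
  simp only [← ff_algebraMap, ← e, ← e', map_mul]
  field_simp

end Invariance

section Divisor

variable {k : Type u} [Field k] {M N : Type u} [CommGroup M] [CommGroup N] [Monoid.FG M]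
  [Monoid.FG N] [IsMulTorsionFree M] [IsMulTorsionFree N] {X Z : Over (Spec (.of k))}
  [IsVariety X] [IsVariety Z] [ModObj (diag k M) X] [ModObj (diag k M) Z]
  [ModObj (diag k N) Z] {π : Z ⟶ X} [IsDominant π.left]
  (hq : IsGeometricQuotient (diag k N) π) (he : IsEquivariant (diag k M) π)

variable (M π) in
/-- `q` is the local equation over the stable open set `U` that is given by `f`, i.e. it is the
quotient of `f` by a semi-invariant unit. -/
structure IsLocalEquation (f : Γ(Z.left, ⊤)) (U : X.left.Opens) (q : X.left.functionFieldˣ) :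
    Prop where
  act_mem : ∀ p : (diag k M ⊗ X).left, (snd (diag k M) X).left p ∈ U →
    (act (diag k M) X).left p ∈ U
  exists_mul_eq : ∃ (m : M) (β : Z.left.functionField), IsSemiInvariant m β ∧
    (∀ z, π.left z ∈ U → IsUnitAt z β) ∧ ff π.left q * β = rat Z f

omit [Monoid.FG M] [IsMulTorsionFree M] [ModObj (diag k M) X] [ModObj (diag k M) Z] in
include hq in
lemma IsGeometricQuotient.isUnitAt_of_ff {r : X.left.functionField} {V : X.left.Opens}
    (hu : ∀ z, π.left z ∈ V → IsUnitAt z (ff π.left r)) {x : X.left} (hx : x ∈ V) :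
    IsUnitAt x r := by
  have hsurj := hq.surjective
  have h := hq.mem_regularAt_of_ff (fun z hz => (hu z hz).mem) hx
  obtain ⟨z, rfl⟩ := π.left.surjective x
  exact IsUnitAt.of_ff π.left (hu z hx) h

include hq in
-- Both equations come from the same f, so their quotient pulls back to a quotient of the two units
-- β' and β.
lemma IsLocalEquation.isUnitAt_div {f : Γ(Z.left, ⊤)} {U V : X.left.Opens}
    {q r : X.left.functionFieldˣ} (h : IsLocalEquation M π f U q) (h' : IsLocalEquation M π f V r)
    {x : X.left} (hU : x ∈ U) (hV : x ∈ V) :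
    IsUnitAt x ((q : X.left.functionField) / (r : X.left.functionField)) := by
  obtain ⟨-, m, β, -, hβ, e⟩ := h
  obtain ⟨-, m', β', -, hβ', e'⟩ := h'
  refine hq.isUnitAt_of_ff (V := U ⊓ V) (fun z hz => ?_) ⟨hU, hV⟩
  have hr : ff π.left (r : X.left.functionField) ≠ 0 := (map_ne_zero _).2 r.ne_zero
  have : ff π.left ((q : X.left.functionField) / (r : X.left.functionField)) = β' / β := by
    rw [map_div₀, div_eq_div_iff hr (hβ z hz.1).ne_zero, e, mul_comm, e']
  rw [this]
  exact (hβ' z hz.2).div (hβ z hz.1)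

include he in
-- Both f and β are semi-invariant for T, hence so is π^* q = f/β. By equivariance this descends to
-- q: the ratio of its two pull-backs is a character, which is a unit everywhere.
lemma IsLocalEquation.isUnitAt_act [Surjective π.left] {f : Γ(Z.left, ⊤)}
    (hf : f ∈ homogeneousSubmonoid k M Z) {U : X.left.Opens} {q : X.left.functionFieldˣ}
    (h : IsLocalEquation M π f U q) (hne : f ≠ 0) (p : (diag k M ⊗ X).left) :
    IsUnitAt p (ff (act (diag k M) X).left q / ff (snd (diag k M) X).left q) := by
  obtain ⟨-, m, β, hβ, -, e⟩ := h
  obtain ⟨n, hn⟩ := hf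
  have hβ0 : β ≠ 0 := by
    rintro rfl
    rw [mul_zero, ← map_zero (rat Z)] at e
    exact hne (rat_injective e.symm)
  have hw := (isSemiInvariant_rat_iff.2 hn).div hβ
  rw [← e, mul_div_cancel_right₀ _ hβ0] at hw
  have he' : act (diag k M) Z ≫ π = diag k M ◁ π ≫ act (diag k M) X := he
  have d1 : IsDominant (act (diag k M) Z ≫ π).left := inferInstance
  have d2 : IsDominant (diag k M ◁ π ≫ act (diag k M) X).left := inferInstance
  have d3 : IsDominant (snd (diag k M) Z ≫ π).left := inferInstance
  have d4 : IsDominant (diag k M ◁ π ≫ snd (diag k M) X).left := inferInstance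
  have e1 : ff (act (diag k M) Z).left (ff π.left q) =
      ff (diag k M ◁ π).left (ff (act (diag k M) X).left q) :=
    (ff_comp (act (diag k M) Z).left π.left _).symm.trans
      ((ff_congr (congrArg Over.Hom.left he') _).trans
        (ff_comp (diag k M ◁ π).left (act (diag k M) X).left _))
  have e2 : ff (snd (diag k M) Z).left (ff π.left q) =
      ff (diag k M ◁ π).left (ff (snd (diag k M) X).left q) :=
    (ff_comp (snd (diag k M) Z).left π.left _).symm.trans
      ((ff_congr (congrArg Over.Hom.left (whiskerLeft_snd (diag k M) π).symm) _).trans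
        (ff_comp (diag k M ◁ π).left (snd (diag k M) X).left _))
  have e3 : rat (diag k M ⊗ Z) (pb (fst (diag k M) Z) (character k (n / m))) =
      ff (diag k M ◁ π).left (rat (diag k M ⊗ X) (pb (fst (diag k M) X) (character k (n / m)))) := by
    rw [← rat_pb, ← pb_comp, whiskerLeft_fst]
  rw [IsSemiInvariant, e1, e2, e3, ← map_mul] at hw
  rw [ff_injective (diag k M ◁ π).left hw, mul_div_cancel_right₀ _ ((map_ne_zero _).2 q.ne_zero)]
  exact isUnitAt_of_isUnit ((isUnit_character _).map _) p

variable [Z.left.IsQuasiAffine]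

include he in
omit [Monoid.FG M] [IsMulTorsionFree M] [IsVariety X] [IsVariety Z] [IsDominant π.left]
  [Z.left.IsQuasiAffine] in
lemma act_mem_of_preimage_eq [Surjective π.left] {f : Γ(Z.left, ⊤)}
    (hf : f ∈ homogeneousSubmonoid k M Z) {U : X.left.Opens}
    (hU : π.left ⁻¹ᵁ U = Z.left.basicOpen f) (p : (diag k M ⊗ X).left)
    (hp : (snd (diag k M) X).left p ∈ U) : (act (diag k M) X).left p ∈ U := by
  have hmem {z} : π.left z ∈ U ↔ z ∈ Z.left.basicOpen f := by rw [← hU]; rfl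
  have he' : act (diag k M) Z ≫ π = diag k M ◁ π ≫ act (diag k M) X := he
  obtain ⟨n, hn⟩ := hf
  obtain ⟨p, rfl⟩ := (diag k M ◁ π).left.surjective p
  rw [← comp_left_apply, whiskerLeft_snd, comp_left_apply, hmem] at hp
  rw [← comp_left_apply, ← he', comp_left_apply, hmem]
  exact hn.mem_basicOpen_act.2 hp

omit [Z.left.IsQuasiAffine] in
include hq he in
/-- Local equations exist. -/
lemma exists_isLocalEquation {w : N} {f : Γ(Z.left, ⊤)} (hw : IsHomogeneous w f) (hf : f ≠ 0)
    (hcov : ∀ z : Z.left, ∃ (w : N) (f : Γ(Z.left, ⊤)),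
      IsTrivializing (homogeneousSubmonoid k M Z) w f ∧ z ∈ Z.left.basicOpen f) (x : X.left) :
    ∃ U, x ∈ U ∧ ∃ q, IsLocalEquation M π f U q := by
  have hsurj := hq.surjective
  obtain ⟨z, rfl⟩ := π.left.surjective x
  obtain ⟨n, g, hg, hz⟩ := hcov z
  obtain ⟨U, hU⟩ := hq.exists_preimage_eq hg.isHomogeneous
  have hmem {z} : π.left z ∈ U ↔ z ∈ Z.left.basicOpen g := by rw [← hU]; rfl
  -- The unit β = b/c has the same H-weight as f and is T-semi-invariant because b and c are
  -- T-homogeneous. Thus f/β is H-invariant and descends.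
  obtain ⟨b, ⟨m, hb⟩, c, ⟨m', hc⟩, hβ, hu⟩ := hg.exists_semiInvariant w
  have hu' (y) (hy : π.left y ∈ U) : IsUnitAt y (rat Z b / rat Z c) :=
    (hu y (hmem.1 hy)).1.div (hu y (hmem.1 hy)).2
  have hβ' := (isSemiInvariant_rat_iff.2 hb).div (isSemiInvariant_rat_iff.2 hc)
  generalize rat Z b / rat Z c = β at hβ hu' hβ'
  have h1 := (isSemiInvariant_rat_iff.2 hw).div hβ
  rw [div_self'] at h1
  obtain ⟨r, hr, -⟩ := hq.exists_ff_eq h1 (hmem.2 hz) fun y hy =>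
    mul_mem (rat_mem_regularAt _ _) (hu' y hy).inv.mem
  have hβ0 := (hu' z (hmem.2 hz)).ne_zero
  have hr' : ff π.left r * β = rat Z f := by rw [hr, div_mul_cancel₀ _ hβ0]
  have hr0 : r ≠ 0 := by
    rintro rfl
    rw [map_zero, zero_mul, ← map_zero (rat Z)] at hr'
    exact hf (rat_injective hr'.symm)
  exact ⟨U, hmem.2 hz, Units.mk0 r hr0, act_mem_of_preimage_eq he hg.mem hU, _, β, hβ', hu', hr'⟩

include hq he in
/-- The divisor of a trivializing function. -/
lemma IsTrivializing.exists_divisor {w : N} {f : Γ(Z.left, ⊤)}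
    (h : IsTrivializing (homogeneousSubmonoid k M Z) w f)
    (hcov : ∀ z : Z.left, ∃ (w : N) (f : Γ(Z.left, ⊤)),
      IsTrivializing (homogeneousSubmonoid k M Z) w f ∧ z ∈ Z.left.basicOpen f) {z : Z.left}
    (hz : z ∈ Z.left.basicOpen f) : ∃ D ∈ invariantDivisors (diag k M) X,
      1 ∈ globalSections D ∧ IsAffineOpen (nonvanishing D 1) ∧ π.left z ∈ nonvanishing D 1 := by
  have hsurj := hq.surjective
  have hne : f ≠ 0 := by
    rintro rfl
    rw [Scheme.basicOpen_zero] at hz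
    exact hz
  have hloc := exists_isLocalEquation hq he h.isHomogeneous hne hcov
  obtain ⟨D, hD⟩ := exists_cartierDivisor (IsLocalEquation M π f) hloc
    fun U V d e hd he' y hU hV => hd.isUnitAt_div hq he' hU hV
  obtain ⟨U, hU⟩ := hq.exists_preimage_eq h.isHomogeneous
  have hmem {z} : π.left z ∈ U ↔ z ∈ Z.left.basicOpen f := by rw [← hU]; rfl
  -- A local equation is f up to a unit on Z, so it is invertible at π(z) exactly when f does not
  -- vanish at z.
  have hnon : nonvanishing D 1 = U := by
    ext x
    obtain ⟨V, hV, q, hVq⟩ := hloc x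
    have h1 : x ∈ nonvanishing D 1 ↔ IsUnitAt x (q : X.left.functionField) := by
      rw [mem_nonvanishing, isGeneratorAt_iff_isUnitAt (hD V q hVq x hV), one_mul]
    obtain ⟨-, m, β, -, hβ, e⟩ := hVq
    have e' (y) (hy : π.left y ∈ V) : ff π.left (q : X.left.functionField) = rat Z f / β := by
      rw [← e, mul_div_cancel_right₀ _ (hβ y hy).ne_zero]
    refine h1.trans ⟨fun hx => ?_, fun hx => ?_⟩
    · obtain ⟨y, rfl⟩ := π.left.surjective x
      refine hmem.2 (isUnitAt_rat_iff.1 ?_)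
      rw [← e]
      exact (hx.ff π.left).mul (hβ y hV)
    · refine hq.isUnitAt_of_ff (V := U ⊓ V) (fun y hy => ?_) ⟨hx, hV⟩
      rw [e' y hy.2]
      exact (isUnitAt_rat_iff.2 (hmem.1 hy.1)).div (hβ y hy.2)
  refine ⟨D, mem_invariantDivisors fun p => ?_, fun x => ?_, ?_, ?_⟩
  -- The set V is stable under T, so one local equation serves at both images of p.
  · obtain ⟨V, hV, q, hVq⟩ := hloc ((snd (diag k M) X).left p)
    exact ⟨q, q, hD V q hVq _ (hVq.act_mem p hV), hD V q hVq _ hV,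
      hVq.isUnitAt_act he h.mem hne p⟩
  · obtain ⟨V, hV, q, hVq⟩ := hloc x
    rw [isSectionAt_iff_mem (hD V q hVq x hV), one_mul]
    obtain ⟨-, m, β, -, hβ, e⟩ := hVq
    refine hq.mem_regularAt_of_ff (V := V) (fun y hy => ?_) hV
    rw [← mul_div_cancel_right₀ (ff π.left (q : X.left.functionField)) (hβ y hy).ne_zero, e]
    exact mul_mem (rat_mem_regularAt _ _) (hβ y hy).inv.mem
  · rw [hnon]
    exact h.isAffineOpen hq hU hz
  · rw [hnon]
    exact hmem.2 hz

end Divisor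

/-- A variety that is the equivariant geometric quotient of a quasi-affine variety by a free action
of a torus has an invariant ample family. -/
theorem hasInvariantAmpleFamily_of_isGeometricQuotient {k : Type u} [Field k]
    {X Z : Over (Spec (.of k))} [IsVariety X] [IsVariety Z] {M N : Type u} [CommGroup M]
    [CommGroup N] [Monoid.FG M] [Monoid.FG N] [IsMulTorsionFree M] [IsMulTorsionFree N]
    [ModObj (diag k M) X] [ModObj (diag k M) Z] [ModObj (diag k N) Z] {π : Z ⟶ X}
    (hqa : Z.left.IsQuasiAffine) (hf : IsFreeAction (diag k N) Z)
    (hq : IsGeometricQuotient (diag k N) π) (he : IsEquivariant (diag k M) π) :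
    HasInvariantAmpleFamily (diag k M) X := by
  have hsurj := hq.surjective
  have hdom := hq.isDominant
  have H (x : X.left) : ∃ D : invariantDivisors (diag k M) X, 1 ∈ globalSections D.1 ∧
      IsAffineOpen (nonvanishing D.1 1) ∧ x ∈ nonvanishing D.1 1 := by
    obtain ⟨z, rfl⟩ := π.left.surjective x
    have hcov := hq.exists_isTrivializing hf he
    obtain ⟨w, f, h, hz⟩ := hcov z
    obtain ⟨D, hD, h⟩ := h.exists_divisor hq he hcov hz
    exact ⟨⟨D, hD⟩, h⟩
  choose D h1 h2 h3 using H
  obtain ⟨t, ht⟩ := CompactSpace.elim_nhds_subcover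
    (fun x => (nonvanishing (D x).1 1 : Set X.left)) fun x => (nonvanishing (D x).1 1).2.mem_nhds (h3 x)
  refine ⟨t.card, fun i => D (t.equivFin.symm i), fun x => ?_⟩
  have hx : x ∈ ⋃ y ∈ t, (nonvanishing (D y).1 1 : Set X.left) := by rw [ht]; trivial
  obtain ⟨y, hy, hxy⟩ := Set.mem_iUnion₂.1 hx
  refine ⟨t.equivFin ⟨y, hy⟩, 1, 1, le_rfl, ?_⟩
  simp only [pow_one, Equiv.symm_apply_apply]
  exact ⟨h1 y, h2 y, hxy⟩

end ToricQuot

end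

theorem mainTheorem6 {k : Type u} [Field k] (r : ℕ) (X : Over (Spec (.of k)))
    [IsVariety X] [ModObj (torus k r) X]
    (hfg : Group.FG (invariantDivisors (torus k r) X))
    (m : ℕ) (hm : 0 < m)
    (hfree : Module.Free ℤ (Additive (classGroup (torus k r) X m)))
    (δ : classGroup (torus k r) X m →* CartierDivisor X.left)
    (hδ : ∀ a, δ a ∈ invariantDivisors (torus k r) X)
    (hδ' : ∀ a, picClass (δ a) = (a : Pic X.left)) :
    List.TFAE [
      HasInvariantAmpleFamily (torus k r) X,
      ∃ (s : ℕ) (Z : Over (Spec (.of k))) (_ : ModObj (torus k r) Z) (_ : ModObj (torus k s) Z)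
        (π : Z ⟶ X), IsVariety Z ∧ Z.left.IsQuasiAffine ∧ IsFreeAction (torus k s) Z ∧
          IsGeometricQuotient (torus k s) π ∧ IsEquivariant (torus k r) π,
      ∃ (_ : ModObj (diag k (classGroup (torus k r) X m)) (stableLocus δ))
        (_ : ModObj (torus k r) (stableLocus δ)) (π : stableLocus δ ⟶ X),
        IsGradingAction δ ∧ IsNaturalMap δ π ∧
          IsFreeAction (diag k (classGroup (torus k r) X m)) (stableLocus δ) ∧
          IsGeometricQuotient (diag k (classGroup (torus k r) X m)) π ∧
          IsVariety (stableLocus δ) ∧ IsEquivariant (torus k r) π] := by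
  have : Module.Free ℤ (Additive (classGroup (torus k r) X m)) := hfree
  have : IsMulTorsionFree (classGroup (torus k r) X m) := isMulTorsionFree_of_free
  have : Group.FG (classGroup (torus k r) X m) := fg_classGroup hfg
  have : Monoid.FG (classGroup (torus k r) X m) := Group.fg_iff_monoid_fg.1 this
  have : Module.Finite ℤ (Additive (classGroup (torus k r) X m)) :=
    Module.Finite.iff_addGroup_fg.2 inferInstance
  tfae_have 1 → 3 := fun h => (h.coveredByAffine hm hδ').exists_quotient hδ
  tfae_have 3 → 2 := by
    rintro ⟨i₁, i₂, π, -, -, hf, hq, hv, he⟩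
    obtain ⟨s, ⟨e⟩⟩ := exists_mulEquiv_torus (classGroup (torus k r) X m)
    obtain ⟨i₃, h⟩ := exists_modObj_of_mulEquiv e (stableLocus δ)
    exact ⟨s, stableLocus δ, i₂, i₃, π, hv, isQuasiAffine_stableLocus, hf.of_iso h, hq.of_iso h, he⟩
  tfae_have 2 → 1 := by
    rintro ⟨s, Z, i₁, i₂, π, hv, hqa, hf, hq, he⟩
    exact hasInvariantAmpleFamily_of_isGeometricQuotient hqa hf hq he
  tfae_finish
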